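/- Let $k$ be a field, $q\in k\setminus\{0\}$ with $[2]_q=q+q^{-1}\neq 0$, and let $n\ge 2$ be an integer. **Algebras.** For $l\ge 0$ let $T_l=T_l(q)$ be the Temperley–Lieb algebra: the unital $k$-algebra generated by $U_1,\dots,U_{l-1}$ with relations $U_i^2=(q+q^{-1})U_i$, $U_iU_jU_i=U_i$ if $|i-j|=1$, and $U_iU_j=U_jU_i$ if $|i-j|\ne 1$. For $\gamma,\delta\in k$ with $\delta\neq 0$ let $b_l$ be the blob algebra: $b_0=k$, and for $l\ge 1$ it is generated by $e,U_1,\dots,U_{l-1}$ with the relations above together with $U_1eU_1=\gamma U_1$, $e^2=\delta e$, and $U_ie=eU_i$ for $i\neq 1$. (For instance $\gamma=q^{m-1}-q^{1-m}$, $\delta=q^m-q^{-m}\ne0$ with $m\in\mathbb Z$.) Let $A_l$ be either $T_l$ (for all $l$) or $b_l$ (for all $l$), with weight set $W_l=\Lambda_l=\{l,l-2,\dots,0\text{ or }1\}$ if $A_l=T_l$, and $W_l=\Gamma_l=\{-l,-l+2,\dots,l-2,l\}$ if $A_l=b_l$. **Simple and standard modules.** For $\lambda\in W_l$ with $|\lambda|=l-2j$,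 let $L_l(\lambda)$ be the simple $A_l$-module $L$ such that $U_{l-1}U_{l-3}\cdots U_{l-2j+1}L\neq 0$ and $U_{l-1}U_{l-3}\cdots U_{l-2j-1}L=0$ (the latter condition being void if $j=\lfloor l/2\rfloor$), and such that, in the blob case, $e$ acts on $U_{l-1}U_{l-3}\cdots U_{l-2j+1}L$ as $\delta$ if $\lambda>0$ and as $0$ if $\lambda<0$. Order $W_l$ by: $\mu$ is strictly below $\lambda$ if and only if $|\mu|>|\lambda|$. The standard module $\Delta_l(\lambda)$ is the largest quotient of the projective cover of $L_l(\lambda)$ all of whose composition factors are $L_l(\mu)$ with $\mu=\lambda$ or $\mu$ strictly below $\lambda$. A standard filtration of an $A_l$-module $M$ is a finite chain of submodules $0=M_0\subseteq M_1\subseteq\dots\subseteq M_r=M$ in which every $M_i/M_{i-1}$ is isomorphic to some $\Delta_l(\lambda)$, $\lambda \in W_l$; and $(M:\Delta_l(\mu))$ is the number of $i$ with $M_i/M_{i-1}\cong\Delta_l(\mu)$. **Globalisation.** Let $\varepsilon=\frac1{[2]_q}U_{n-1}\in A_n$. It commutes with the image of the homomorphism $A_{n-2}\to A_n$ sending each generator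 to the generator of the same name, so $A_n\varepsilon$ is an $(A_n,A_{n-2})$-bimodule; for an $A_{n-2}$-module $M$ put $G(M)=A_n\varepsilon\otimes_{A_{n-2}}M$. **Proposition.** In both cases ($A=T$ and $A=b$): if an $A_{n-2}$-module $M$ has a standard filtration, then the $A_n$-module $G(M)$ has a standard filtration, and for every $\mu\in W_n$ $$(G(M):\Delta_n(\mu))=\begin{cases}(M:\Delta_{n-2}(\mu)) & \text{if }\mu\in W_{n-2},\\ 0 & \text{otherwise,}\end{cases}$$ for any choice of standard filtrations of $M$ and of $G(M)$ used to compute the two multiplicities. -/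

import Mathlib

open scoped TensorProduct

universe u v

/-! ## Standard modules and standard filtrations -/

section Generic

variable {A : Type u} [Ring A] {Λ : Type}

/-- All simple subquotients (composition factors) of the module `X` carry a label `μ` with `S μ`.
Here `isL μ L` says that `L` is the simple module with label `μ`. -/
def FactorsIn (isL : Λ → ∀ (L : Type u) [AddCommGroup L] [Module A L], Prop) (S : Λ → Prop)
    (X : Type u) [AddCommGroup X] [Module A X] : Prop :=
  ∀ N₁ N₂ : Submodule A X, N₁ ≤ N₂ → IsSimpleModule A (N₂ ⧸ N₁.submoduleOf N₂) →
    ∃ μ, S μ ∧ isL μ (N₂ ⧸ N₁.submoduleOf N₂)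

/-- `π : P → L` is a projective cover: `P` is projective, `π` is onto, and its kernel is
superfluous. -/
def IsProjectiveCover {P L : Type u} [AddCommGroup P] [Module A P] [AddCommGroup L] [Module A L]
    (π : P →ₗ[A] L) : Prop :=
  Module.Projective A P ∧ Function.Surjective π ∧
    ∀ N : Submodule A P, N ⊔ LinearMap.ker π = ⊤ → N = ⊤

/-- `D` is (isomorphic to) the standard module `Δ(lam)`: the largest quotient of the projective
cover `P(lam)` of `L(lam)` all of whose composition factors are `L(μ)` with `μ` below `lam`. -/
def IsStandardModule (le : Λ → Λ → Prop)
    (isL : Λ → ∀ (L : Type u) [AddCommGroup L] [Module A L], Prop)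
    (lam : Λ) (D : Type v) [AddCommGroup D] [Module A D] : Prop :=
  ∃ (P : Type u) (_ : AddCommGroup P) (_ : Module A P)
    (L : Type u) (_ : AddCommGroup L) (_ : Module A L) (π : P →ₗ[A] L),
    isL lam L ∧ IsProjectiveCover π ∧
      Nonempty (D ≃ₗ[A] (P ⧸ sInf {N : Submodule A P | FactorsIn isL (fun μ => le μ lam) (P ⧸ N)}))

/-- A finite filtration `0 = M₀ ⊆ M₁ ⊆ ⋯ ⊆ M_r = M` all of whose factors are standard modules;
`isStd μ D` says that `D` is the standard module `Δ(μ)`. -/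
structure StandardFiltration (isStd : Λ → ∀ (D : Type v) [AddCommGroup D] [Module A D], Prop)
    (M : Type v) [AddCommGroup M] [Module A M] where
  length : ℕ
  sub : Fin (length + 1) → Submodule A M
  mono : Monotone sub
  sub_zero : sub 0 = ⊥
  sub_last : sub (Fin.last length) = ⊤
  factor : ∀ i : Fin length, ∃ μ, isStd μ (sub i.succ ⧸ (sub i.castSucc).submoduleOf (sub i.succ))

/-- The number of factors of the filtration that are isomorphic to `Δ(μ)`. -/
noncomputable def StandardFiltration.mult
    {isStd : Λ → ∀ (D : Type v) [AddCommGroup D] [Module A D], Prop}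
    {M : Type v} [AddCommGroup M] [Module A M] (F : StandardFiltration isStd M) (μ : Λ) : ℕ :=
  Nat.card {i : Fin F.length //
    isStd μ (F.sub i.succ ⧸ (F.sub i.castSucc).submoduleOf (F.sub i.succ))}

end Generic

/-! ## Globalisation -/

section Globalisation

variable {k : Type u} [Field k] {A B : Type u} [Ring A] [Algebra k A] [Ring B] [Algebra k B]

/-- Right multiplication by (the image of) `b : B` on the left ideal `A ε`. -/
def rightMul (ι : B →ₐ[k] A) (ε : A) (h : ∀ b, Commute (ι b) ε) (b : B) :
    (Submodule.span A {ε}) →ₗ[A] (Submodule.span A {ε}) where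
  toFun x := ⟨x.1 * ι b, by
    obtain ⟨a, ha⟩ := Submodule.mem_span_singleton.1 x.2
    refine Submodule.mem_span_singleton.2 ⟨a * ι b, ?_⟩
    rw [← ha, smul_eq_mul, smul_eq_mul, mul_assoc, mul_assoc, (h b).eq]⟩
  map_add' x y := by ext; simp [add_mul]
  map_smul' a x := by ext; simp [mul_assoc]

/-- The relations `x b ⊗ m = x ⊗ b m` that turn `A ε ⊗_k M` into `A ε ⊗_B M`. -/
def balancedRelations (ι : B →ₐ[k] A) (ε : A) (h : ∀ b, Commute (ι b) ε)
    (M : Type v) [AddCommGroup M] [Module k M] [Module B M] :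
    Submodule A ((Submodule.span A {ε}) ⊗[k] M) :=
  Submodule.span A {t | ∃ (x : Submodule.span A {ε}) (b : B) (m : M),
    t = (rightMul ι ε h b x) ⊗ₜ[k] m - x ⊗ₜ[k] (b • m)}

/-- The left `A`-module `A ε ⊗_B M`, where `B` acts on the right of `A ε` through `ι : B → A`. -/
abbrev Globalise (ι : B →ₐ[k] A) (ε : A) (h : ∀ b, Commute (ι b) ε)
    (M : Type v) [AddCommGroup M] [Module k M] [Module B M] : Type (max u v) :=
  ((Submodule.span A {ε}) ⊗[k] M) ⧸ balancedRelations ι ε h M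

end Globalisation

/-! ## The Temperley–Lieb algebra -/

namespace TL

/-- The index set `{1, …, n - 1}` of the generators `U_i`. -/
abbrev Gen (n : ℕ) : Type := {i : ℕ // 1 ≤ i ∧ i < n}

/-- The defining relations of `T_n(q)`. -/
inductive Rel (k : Type u) [Field k] (q : k) (n : ℕ) :
    FreeAlgebra k (Gen n) → FreeAlgebra k (Gen n) → Prop
  | sq (i : Gen n) :
      Rel k q n (FreeAlgebra.ι k i * FreeAlgebra.ι k i) ((q + q⁻¹) • FreeAlgebra.ι k i)
  | braid (i j : Gen n) (h : i.1 = j.1 + 1 ∨ j.1 = i.1 + 1) :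
      Rel k q n (FreeAlgebra.ι k i * FreeAlgebra.ι k j * FreeAlgebra.ι k i) (FreeAlgebra.ι k i)
  | comm (i j : Gen n) (h : ¬ (i.1 = j.1 + 1 ∨ j.1 = i.1 + 1)) :
      Rel k q n (FreeAlgebra.ι k i * FreeAlgebra.ι k j) (FreeAlgebra.ι k j * FreeAlgebra.ι k i)

/-- The Temperley–Lieb algebra `T_n(q)`. -/
abbrev Alg (k : Type u) [Field k] (q : k) (n : ℕ) : Type u := RingQuot (Rel k q n)

variable {k : Type u} [Field k] {q : k}

/-- The generator `U_i` of `T_n(q)` for `1 ≤ i < n`; by convention `0` for other `i`. -/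
noncomputable def U (k : Type u) [Field k] (q : k) (n i : ℕ) : Alg k q n :=
  if h : 1 ≤ i ∧ i < n then RingQuot.mkAlgHom k (Rel k q n) (FreeAlgebra.ι k ⟨i, h⟩) else 0

theorem U_sq (n i : ℕ) : U k q n i * U k q n i = (q + q⁻¹) • U k q n i := by
  unfold U
  split_ifs with h
  · rw [← map_mul, RingQuot.mkAlgHom_rel k (Rel.sq _), map_smul]
  · simp

theorem U_braid (n : ℕ) {i j : ℕ} (hj : 1 ≤ j ∧ j < n) (h : i = j + 1 ∨ j = i + 1) :
    U k q n i * U k q n j * U k q n i = U k q n i := by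
  by_cases hi : 1 ≤ i ∧ i < n
  · simp only [U, dif_pos hi, dif_pos hj]
    rw [← map_mul, ← map_mul]
    exact RingQuot.mkAlgHom_rel k (Rel.braid _ _ h)
  · simp [U, dif_neg hi]

theorem U_comm (n : ℕ) {i j : ℕ} (h : ¬ (i = j + 1 ∨ j = i + 1)) :
    U k q n i * U k q n j = U k q n j * U k q n i := by
  by_cases hi : 1 ≤ i ∧ i < n
  · by_cases hj : 1 ≤ j ∧ j < n
    · simp only [U, dif_pos hi, dif_pos hj]
      rw [← map_mul, ← map_mul]
      exact RingQuot.mkAlgHom_rel k (Rel.comm _ _ h)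
    · simp [U, dif_neg hj]
  · simp [U, dif_neg hi]

/-- The homomorphism `T_n → T_{n+2}`, `U_i ↦ U_i`. -/
noncomputable def incl (k : Type u) [Field k] (q : k) (n : ℕ) : Alg k q n →ₐ[k] Alg k q (n + 2) :=
  RingQuot.liftAlgHom k ⟨FreeAlgebra.lift k fun i : Gen n => U k q (n + 2) i.1, by
    intro x y hxy
    cases hxy with
    | sq i => simpa only [map_mul, map_smul, FreeAlgebra.lift_ι_apply] using U_sq (n + 2) i.1
    | braid i j h =>
      simpa only [map_mul, FreeAlgebra.lift_ι_apply] using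
        U_braid (n + 2) ⟨j.2.1, by have := j.2.2; omega⟩ h
    | comm i j h => simpa only [map_mul, FreeAlgebra.lift_ι_apply] using U_comm (n + 2) h⟩

/-- The idempotent `ε = U_{n+1} / [2]` of `T_{n+2}`. -/
noncomputable def eps (k : Type u) [Field k] (q : k) (n : ℕ) : Alg k q (n + 2) :=
  (q + q⁻¹)⁻¹ • U k q (n + 2) (n + 1)

theorem incl_commute_eps (n : ℕ) (b : Alg k q n) : Commute (incl k q n b) (eps k q n) := by
  obtain ⟨x, rfl⟩ := RingQuot.mkAlgHom_surjective k (Rel k q n) b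
  rw [incl, RingQuot.liftAlgHom_mkAlgHom_apply]
  refine Commute.smul_right ?_ _
  induction x using FreeAlgebra.induction with
  | grade0 r => rw [AlgHom.commutes]; exact Algebra.commute_algebraMap_left r _
  | grade1 i =>
    rw [FreeAlgebra.lift_ι_apply]
    exact U_comm _ (by have := i.2.2; omega)
  | mul a b ha hb => rw [map_mul]; exact ha.mul_left hb
  | add a b ha hb => rw [map_add]; exact ha.add_left hb

/-- The globalisation functor on objects: `G M = T_{n+2} ε ⊗_{T_n} M`. -/
abbrev G (k : Type u) [Field k] (q : k) (n : ℕ) (M : Type v) [AddCommGroup M] [Module k M]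
    [Module (Alg k q n) M] : Type (max u v) :=
  Globalise (incl k q n) (eps k q n) (incl_commute_eps n) M

/-- The weight set `Λ_n = {n, n - 2, …, 0 or 1}`. -/
def weights (n : ℕ) : Finset ℕ := (Finset.range (n + 1)).filter fun l => l % 2 = n % 2

/-- `U_{n-1} U_{n-3} ⋯ U_{n-2j+1}`, which is `0` if `2 j > n`. Up to the factor `[2]^j` this is the
idempotent by which the `j`-fold iterate of the localisation `M ↦ ε M` is defined. -/
noncomputable def loc (k : Type u) [Field k] (q : k) (n : ℕ) : ℕ → Alg k q n
  | 0 => 1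
  | j + 1 => loc k q n j * U k q n (n - 1 - 2 * j)

/-- `L` is the simple `T_n`-module `L_n(lam)`: for `lam = n - 2 j`, the simple module whose `j`-fold
localisation is the trivial `T_lam`-module, that is, is non-zero and is killed by a further
localisation. -/
def IsSimpleOfWeight (k : Type u) [Field k] (q : k) (n lam : ℕ)
    (L : Type v) [AddCommGroup L] [Module (Alg k q n) L] : Prop :=
  lam ∈ weights n ∧ IsSimpleModule (Alg k q n) L ∧
    (∃ v : L, loc k q n ((n - lam) / 2) • v ≠ 0) ∧
    (∀ v : L, loc k q n ((n - lam) / 2 + 1) • v = 0)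

/-- `D` is the standard module `Δ_n(lam)`. The heredity order is the reverse of the natural
order on `Λ_n`. -/
def IsStandard (k : Type u) [Field k] (q : k) (n lam : ℕ)
    (D : Type v) [AddCommGroup D] [Module (Alg k q n) D] : Prop :=
  IsStandardModule (A := Alg k q n) (fun μ l => l ≤ μ)
    (fun μ L _ _ => IsSimpleOfWeight k q n μ L) lam D

/-- Filtrations of a `T_n`-module by standard modules. -/
abbrev Filtration (k : Type u) [Field k] (q : k) (n : ℕ)
    (M : Type v) [AddCommGroup M] [Module (Alg k q n) M] : Type v :=
  StandardFiltration (A := Alg k q n) (fun μ D _ _ => IsStandard k q n μ D) M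

end TL

/-! ## The blob algebra -/

namespace Blob

/-- The generators `e, U_1, …, U_{n-1}` of `b_n`; there is none for `n = 0`. -/
inductive Gen (n : ℕ) : Type
  | e (h : 0 < n) : Gen n
  | U (i : ℕ) (h : 1 ≤ i ∧ i < n) : Gen n

/-- The defining relations of `b_n`. -/
inductive Rel (k : Type u) [Field k] (q γ δ : k) (n : ℕ) :
    FreeAlgebra k (Gen n) → FreeAlgebra k (Gen n) → Prop
  | sq (i : ℕ) (hi : 1 ≤ i ∧ i < n) :
      Rel k q γ δ n (FreeAlgebra.ι k (.U i hi) * FreeAlgebra.ι k (.U i hi))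
        ((q + q⁻¹) • FreeAlgebra.ι k (.U i hi))
  | braid (i j : ℕ) (hi : 1 ≤ i ∧ i < n) (hj : 1 ≤ j ∧ j < n) (h : i = j + 1 ∨ j = i + 1) :
      Rel k q γ δ n
        (FreeAlgebra.ι k (.U i hi) * FreeAlgebra.ι k (.U j hj) * FreeAlgebra.ι k (.U i hi))
        (FreeAlgebra.ι k (.U i hi))
  | comm (i j : ℕ) (hi : 1 ≤ i ∧ i < n) (hj : 1 ≤ j ∧ j < n) (h : ¬ (i = j + 1 ∨ j = i + 1)) :
      Rel k q γ δ n (FreeAlgebra.ι k (.U i hi) * FreeAlgebra.ι k (.U j hj))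
        (FreeAlgebra.ι k (.U j hj) * FreeAlgebra.ι k (.U i hi))
  | UeU (he : 0 < n) (h1 : 1 ≤ 1 ∧ 1 < n) :
      Rel k q γ δ n
        (FreeAlgebra.ι k (.U 1 h1) * FreeAlgebra.ι k (.e he) * FreeAlgebra.ι k (.U 1 h1))
        (γ • FreeAlgebra.ι k (.U 1 h1))
  | ee (he : 0 < n) :
      Rel k q γ δ n (FreeAlgebra.ι k (.e he) * FreeAlgebra.ι k (.e he))
        (δ • FreeAlgebra.ι k (.e he))
  | Ue (he : 0 < n) (i : ℕ) (hi : 1 ≤ i ∧ i < n) (h : i ≠ 1) :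
      Rel k q γ δ n (FreeAlgebra.ι k (.U i hi) * FreeAlgebra.ι k (.e he))
        (FreeAlgebra.ι k (.e he) * FreeAlgebra.ι k (.U i hi))

/-- The blob algebra `b_n` with parameters `q`, `γ`, `δ`. -/
abbrev Alg (k : Type u) [Field k] (q γ δ : k) (n : ℕ) : Type u := RingQuot (Rel k q γ δ n)

variable {k : Type u} [Field k] {q γ δ : k}

/-- The generator `U_i` of `b_n` for `1 ≤ i < n`; by convention `0` for other `i`. -/
noncomputable def U (k : Type u) [Field k] (q γ δ : k) (n i : ℕ) : Alg k q γ δ n :=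
  if h : 1 ≤ i ∧ i < n then RingQuot.mkAlgHom k (Rel k q γ δ n) (FreeAlgebra.ι k (.U i h)) else 0

/-- The generator `e` of `b_n` for `n ≥ 1`; by convention `0` for `n = 0`. -/
noncomputable def e (k : Type u) [Field k] (q γ δ : k) (n : ℕ) : Alg k q γ δ n :=
  if h : 0 < n then RingQuot.mkAlgHom k (Rel k q γ δ n) (FreeAlgebra.ι k (.e h)) else 0

theorem U_sq (n i : ℕ) : U k q γ δ n i * U k q γ δ n i = (q + q⁻¹) • U k q γ δ n i := by
  unfold U
  split_ifs with h
  · rw [← map_mul, RingQuot.mkAlgHom_rel k (Rel.sq _ _), map_smul]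
  · simp

theorem U_braid (n : ℕ) {i j : ℕ} (hj : 1 ≤ j ∧ j < n) (h : i = j + 1 ∨ j = i + 1) :
    U k q γ δ n i * U k q γ δ n j * U k q γ δ n i = U k q γ δ n i := by
  by_cases hi : 1 ≤ i ∧ i < n
  · simp only [U, dif_pos hi, dif_pos hj]
    rw [← map_mul, ← map_mul]
    exact RingQuot.mkAlgHom_rel k (Rel.braid _ _ _ _ h)
  · simp [U, dif_neg hi]

theorem U_comm (n : ℕ) {i j : ℕ} (h : ¬ (i = j + 1 ∨ j = i + 1)) :
    U k q γ δ n i * U k q γ δ n j = U k q γ δ n j * U k q γ δ n i := by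
  by_cases hi : 1 ≤ i ∧ i < n
  · by_cases hj : 1 ≤ j ∧ j < n
    · simp only [U, dif_pos hi, dif_pos hj]
      rw [← map_mul, ← map_mul]
      exact RingQuot.mkAlgHom_rel k (Rel.comm _ _ _ _ h)
    · simp [U, dif_neg hj]
  · simp [U, dif_neg hi]

theorem U_e_U (n : ℕ) :
    U k q γ δ n 1 * e k q γ δ n * U k q γ δ n 1 = γ • U k q γ δ n 1 := by
  by_cases h1 : 1 ≤ 1 ∧ 1 < n
  · have he : 0 < n := by omega
    simp only [U, e, dif_pos h1, dif_pos he]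
    rw [← map_mul, ← map_mul, RingQuot.mkAlgHom_rel k (Rel.UeU he h1), map_smul]
  · have hU : U k q γ δ n 1 = 0 := dif_neg h1
    rw [hU, mul_zero, smul_zero]

theorem e_e (n : ℕ) : e k q γ δ n * e k q γ δ n = δ • e k q γ δ n := by
  unfold e
  split_ifs with h
  · rw [← map_mul, RingQuot.mkAlgHom_rel k (Rel.ee h), map_smul]
  · simp

theorem U_e (n : ℕ) {i : ℕ} (h : i ≠ 1) :
    U k q γ δ n i * e k q γ δ n = e k q γ δ n * U k q γ δ n i := by
  by_cases hi : 1 ≤ i ∧ i < n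
  · have he : 0 < n := by omega
    simp only [U, e, dif_pos hi, dif_pos he]
    rw [← map_mul, ← map_mul]
    exact RingQuot.mkAlgHom_rel k (Rel.Ue he _ _ h)
  · simp [U, dif_neg hi]

/-- The image in `b_{n+2}` of a generator of `b_n`. -/
noncomputable def inclGen (k : Type u) [Field k] (q γ δ : k) (n : ℕ) :
    Gen n → Alg k q γ δ (n + 2)
  | .e _ => e k q γ δ (n + 2)
  | .U i _ => U k q γ δ (n + 2) i

/-- The homomorphism `b_n → b_{n+2}`, `e ↦ e`, `U_i ↦ U_i`. -/
noncomputable def incl (k : Type u) [Field k] (q γ δ : k) (n : ℕ) :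
    Alg k q γ δ n →ₐ[k] Alg k q γ δ (n + 2) :=
  RingQuot.liftAlgHom k ⟨FreeAlgebra.lift k (inclGen k q γ δ n), by
    intro x y hxy
    cases hxy with
    | sq i hi =>
      simpa only [map_mul, map_smul, FreeAlgebra.lift_ι_apply, inclGen] using
        U_sq (n + 2) i
    | braid i j hi hj h =>
      simpa only [map_mul, map_smul, FreeAlgebra.lift_ι_apply, inclGen] using
        U_braid (n + 2) ⟨hj.1, by omega⟩ h
    | comm i j hi hj h =>
      simpa only [map_mul, map_smul, FreeAlgebra.lift_ι_apply, inclGen] using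
        U_comm (n + 2) h
    | UeU he h1 =>
      simpa only [map_mul, map_smul, FreeAlgebra.lift_ι_apply, inclGen] using
        U_e_U (n + 2)
    | ee he =>
      simpa only [map_mul, map_smul, FreeAlgebra.lift_ι_apply, inclGen] using
        e_e (n + 2)
    | Ue he i hi h =>
      simpa only [map_mul, map_smul, FreeAlgebra.lift_ι_apply, inclGen] using
        U_e (n + 2) h⟩

/-- The idempotent `ε = U_{n+1} / [2]` of `b_{n+2}`. -/
noncomputable def eps (k : Type u) [Field k] (q γ δ : k) (n : ℕ) : Alg k q γ δ (n + 2) :=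
  (q + q⁻¹)⁻¹ • U k q γ δ (n + 2) (n + 1)

theorem incl_commute_eps (n : ℕ) (b : Alg k q γ δ n) :
    Commute (incl k q γ δ n b) (eps k q γ δ n) := by
  obtain ⟨x, rfl⟩ := RingQuot.mkAlgHom_surjective k (Rel k q γ δ n) b
  rw [incl, RingQuot.liftAlgHom_mkAlgHom_apply]
  refine Commute.smul_right ?_ _
  induction x using FreeAlgebra.induction with
  | grade0 r => rw [AlgHom.commutes]; exact Algebra.commute_algebraMap_left r _
  | grade1 i =>
    rw [FreeAlgebra.lift_ι_apply]
    cases i with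
    | e h => exact (U_e (n + 2) (by omega)).symm
    | U i h => exact U_comm _ (by omega)
  | mul a b ha hb => rw [map_mul]; exact ha.mul_left hb
  | add a b ha hb => rw [map_add]; exact ha.add_left hb

/-- The globalisation functor on objects: `G M = b_{n+2} ε ⊗_{b_n} M`. -/
abbrev G (k : Type u) [Field k] (q γ δ : k) (n : ℕ) (M : Type v) [AddCommGroup M] [Module k M]
    [Module (Alg k q γ δ n) M] : Type (max u v) :=
  Globalise (incl k q γ δ n) (eps k q γ δ n) (incl_commute_eps n) M

/-- The weight set `Γ_n = {-n, -n + 2, …, n - 2, n}`. -/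
noncomputable def weights (n : ℕ) : Finset ℤ :=
  (Finset.Icc (-(n : ℤ)) n).filter fun l => (2 : ℤ) ∣ (n : ℤ) - l

/-- `U_{n-1} U_{n-3} ⋯ U_{n-2j+1}`, which is `0` if `2 j > n`. Up to the factor `[2]^j` this is the
idempotent by which the `j`-fold iterate of the localisation `M ↦ ε M` is defined. -/
noncomputable def loc (k : Type u) [Field k] (q γ δ : k) (n : ℕ) : ℕ → Alg k q γ δ n
  | 0 => 1
  | j + 1 => loc k q γ δ n j * U k q γ δ n (n - 1 - 2 * j)

/-- `L` is the simple `b_n`-module `L_n(lam)`: for `|lam| = n - 2 j`, the simple module whose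
`j`-fold localisation is the one-dimensional `b_{|lam|}`-module on which all `U_i` act as `0` and on
which `e` acts as `δ` if `lam > 0` and as `0` if `lam < 0`. -/
def IsSimpleOfWeight (k : Type u) [Field k] (q γ δ : k) (n : ℕ) (lam : ℤ)
    (L : Type v) [AddCommGroup L] [Module (Alg k q γ δ n) L] : Prop :=
  lam ∈ weights n ∧ IsSimpleModule (Alg k q γ δ n) L ∧
    (∃ v : L, loc k q γ δ n ((n - lam.natAbs) / 2) • v ≠ 0) ∧
    (∀ v : L, loc k q γ δ n ((n - lam.natAbs) / 2 + 1) • v = 0) ∧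
    (0 < lam → ∀ v : L, (e k q γ δ n * loc k q γ δ n ((n - lam.natAbs) / 2)) • v =
      (algebraMap k (Alg k q γ δ n) δ * loc k q γ δ n ((n - lam.natAbs) / 2)) • v) ∧
    (lam < 0 → ∀ v : L, (e k q γ δ n * loc k q γ δ n ((n - lam.natAbs) / 2)) • v = 0)

/-- `D` is the standard module `Δ_n(lam)`. In the heredity order `μ` is strictly below `lam` if
and only if `|μ| > |lam|`. -/
def IsStandard (k : Type u) [Field k] (q γ δ : k) (n : ℕ) (lam : ℤ)
    (D : Type v) [AddCommGroup D] [Module (Alg k q γ δ n) D] : Prop :=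
  IsStandardModule (A := Alg k q γ δ n) (fun μ l => μ = l ∨ |l| < |μ|)
    (fun μ L _ _ => IsSimpleOfWeight k q γ δ n μ L) lam D

/-- Filtrations of a `b_n`-module by standard modules. -/
abbrev Filtration (k : Type u) [Field k] (q γ δ : k) (n : ℕ)
    (M : Type v) [AddCommGroup M] [Module (Alg k q γ δ n) M] : Type v :=
  StandardFiltration (A := Alg k q γ δ n) (fun μ D _ _ => IsStandard k q γ δ n μ D) M

end Blob

-- The proposition rests on three facts. Globalisation preserves injectivity of maps whose cokernel
-- has a standard filtration factor as its value; it sends standard modules to standard modules with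
-- the same label; and the multiplicities of a filtration are determined by the module. No diagram
-- basis is used. Both families of algebras are treated at once as a `Tower`, in which each algebra
-- arises from the previous one by adjoining an element `u`, and `Labels` records what is needed
-- about simple modules. Below, `ε` is `u / d`, `res` is restriction one step down the tower, and
-- `Glob` raises the level by two.
--
-- Exact sequence. From `u A(n+2) u = A(n) u` and `A(n+2) u = A(n+1) u` one gets, for a module `V`
-- over `A(n+1)`, a complex `Glob(εV) → V ⊕ Glob(res V) → Glob V → 0`, where `V` sits in `Glob V` as
-- `1 ⊗ V`. Its exactness is the heart of the matter. It is proved by letting `A(n+3)` act on the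
-- cokernel of the first map (`exists_pushAct`): the presentation of the tower reduces this to
-- checking Temperley–Lieb relations for two explicit operators. The same construction shows that `V
-- → Glob V` is injective, so that `ε Glob V = V`. For `V` over `A 1` there is no `εV`, and the
-- relations vanish.
--
-- Exactness of globalisation. Right exactness is formal. A diagram chase in the sequence above
-- gives injectivity as soon as the cokernel is `Acyclic`: the counit `Glob(εY) → Y` is injective
-- for it and for all its restrictions (`globMap_injective`). A standard module is acyclic because
-- either `u` kills it, or it is the globalisation of a standard module, and globalisation preserves
-- acyclicity.
--
-- Standard modules. For each label there are two elements `y` and `z`, idempotent up to non-zero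
-- scalars, such that `L(μ)` is killed by both exactly when `μ` lies below the label. Hence all
-- composition factors of a module are below the label if and only if `y` and `z` act as zero, and
-- the standard module is the projective cover modulo the submodule generated by the images of `y`
-- and `z`. Globalisation carries the cover to the cover (`IsStd.glob`) and, by right exactness,
-- that submodule to the corresponding one.
--
-- Multiplicities. Given a label, localise until it is a top label, then take the dimension of the
-- quotient by the images of `y` and `z`. This number (`count`) is additive along standard
-- filtrations, is `1` on the standard module with that label and `0` on the others. Since `ε Glob M
-- = M`, it does not change under globalisation for an old label; for a new label it vanishes,
-- because `Glob M` is generated by `ε Glob M`.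

universe w w' w''

/-! ## Representations of algebras -/

/-- A representation of the `k`-algebra `R` on the vector space `V`. -/
abbrev AlgRep (k : Type u) [Field k] (R : Type v) [Ring R] [Algebra k R] (V : Type w)
    [AddCommGroup V] [Module k V] := R →ₐ[k] Module.End k V

namespace AlgRep

variable {k : Type u} [Field k] {R : Type v} [Ring R] [Algebra k R]
variable {V : Type w} [AddCommGroup V] [Module k V] {W : Type w'} [AddCommGroup W] [Module k W]

/-- Intertwining maps between two representations. -/
def IsHom (ρ : AlgRep k R V) (σ : AlgRep k R W) (f : V →ₗ[k] W) : Prop :=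
  ∀ a v, f (ρ a v) = σ a (f v)

theorem mul_act (ρ : AlgRep k R V) (a b : R) (v : V) : ρ (a * b) v = ρ a (ρ b v) := by
  rw [map_mul]; rfl

theorem one_act (ρ : AlgRep k R V) (v : V) : ρ 1 v = v := by
  rw [map_one]; rfl

theorem smul_act (ρ : AlgRep k R V) (c : k) (a : R) (v : V) : ρ (c • a) v = c • ρ a v := by
  rw [map_smul]; rfl

theorem add_act (ρ : AlgRep k R V) (a b : R) (v : V) : ρ (a + b) v = ρ a v + ρ b v := by
  rw [map_add]; rfl

theorem sub_act (ρ : AlgRep k R V) (a b : R) (v : V) : ρ (a - b) v = ρ a v - ρ b v := by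
  rw [map_sub]; rfl

theorem zero_act (ρ : AlgRep k R V) (v : V) : ρ 0 v = 0 := by
  rw [map_zero]; rfl

theorem algebraMap_act (ρ : AlgRep k R V) (c : k) (v : V) : ρ (algebraMap k R c) v = c • v := by
  rw [AlgHom.commutes]; rfl

/-- The representation on the quotient by an invariant subspace. -/
def quot (ρ : AlgRep k R V) (N : Submodule k V) (h : ∀ a, N ≤ N.comap (ρ a)) :
    AlgRep k R (V ⧸ N) :=
  AlgHom.ofLinearMap
    { toFun := fun a => N.mapQ N (ρ a) (h a)
      map_add' := fun a b => by
        ext v; simp [map_add]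
      map_smul' := fun c a => by
        ext v; simp [map_smul] }
    (by ext v; simp)
    (fun a b => by ext v; simp)

/-- The representation on an invariant subspace. -/
def sub (ρ : AlgRep k R V) (N : Submodule k V) (h : ∀ a, ∀ v ∈ N, ρ a v ∈ N) :
    AlgRep k R N :=
  AlgHom.ofLinearMap
    { toFun := fun a => (ρ a).restrict (h a)
      map_add' := fun a b => by
        ext v; simp [map_add]
      map_smul' := fun c a => by
        ext v; simp [map_smul] }
    (by ext v; simp)
    (fun a b => by ext v; simp)

/-- The representation `R ⊗ V` induced from the ground field. -/
noncomputable def free (k : Type u) [Field k] (R : Type v) [Ring R] [Algebra k R]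
    (V : Type w) [AddCommGroup V] [Module k V] : AlgRep k R (R ⊗[k] V) :=
  AlgHom.ofLinearMap
    { toFun := fun a => LinearMap.rTensor V (LinearMap.mulLeft k a)
      map_add' := fun a b => by
        ext x v; simp [add_mul, TensorProduct.add_tmul]
      map_smul' := fun c a => by
        ext x v; simp [TensorProduct.smul_tmul'] }
    (by ext x v; simp)
    (fun a b => by ext x v; simp)

@[simp] theorem free_tmul (a x : R) (v : V) : free k R V a (x ⊗ₜ v) = (a * x) ⊗ₜ v := rfl

/-- The representation on a direct sum. -/
def prod (ρ : AlgRep k R V) (σ : AlgRep k R W) : AlgRep k R (V × W) :=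
  AlgHom.ofLinearMap
    { toFun := fun a => (ρ a).prodMap (σ a)
      map_add' := fun a b => by ext v <;> simp
      map_smul' := fun c a => by ext v <;> simp }
    (by ext v <;> simp)
    (fun a b => by ext v <;> simp)

end AlgRep

/-! ## Towers of algebras -/

/-- A tower of algebras `A 0 = k → A 1 → A 2 → ⋯` in which `A (n + 2)` is obtained from `A (n + 1)`
by adjoining an element `u (n + 1)` subject to Temperley–Lieb relations; `A 1` is arbitrary. -/
structure Tower (k : Type u) [Field k] (A : ℕ → Type u) [∀ n, Ring (A n)]
    [∀ n, Algebra k (A n)] (d : k) where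
  inc : ∀ n, A n →ₐ[k] A (n + 1)
  u : ∀ n, A (n + 1)
  cap : A 1 →ₗ[k] k
  d_ne : d ≠ 0
  scalar : ∀ a : A 0, ∃ c, a = algebraMap k (A 0) c
  cap_one : cap 1 = d
  u_zero : u 0 = 0
  u_sq : ∀ n, u n * u n = d • u n
  u_comm : ∀ n b, u (n + 1) * inc (n + 1) (inc n b) = inc (n + 1) (inc n b) * u (n + 1)
  u_cap : ∀ x, u 1 * inc 1 x * u 1 = cap x • u 1
  braid_up : ∀ n, u (n + 2) * inc (n + 2) (u (n + 1)) * u (n + 2) = u (n + 2)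
  braid_down : ∀ n, inc (n + 1) (u n) * u (n + 1) * inc (n + 1) (u n) = inc (n + 1) (u n)
  adjoin : ∀ n, Algebra.adjoin k (Set.range (inc (n + 1)) ∪ {u (n + 1)}) = ⊤
  -- The universal properties take the place of a basis: whenever something must be shown not to
  -- collapse, a representation is constructed.
  lift_one : ∀ (S : Type u) [Ring S] [Algebra k S] (φ : A 1 →ₐ[k] S) (s : S),
    (∀ x, s * φ x * s = cap x • s) → ∃ Φ : A 2 →ₐ[k] S, (∀ x, Φ (inc 1 x) = φ x) ∧ Φ (u 1) = s
  lift_succ : ∀ (n : ℕ) (S : Type u) [Ring S] [Algebra k S] (φ : A (n + 2) →ₐ[k] S) (s : S),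
    s * s = d • s → (∀ b, s * φ (inc (n + 1) b) = φ (inc (n + 1) b) * s) →
    s * φ (u (n + 1)) * s = s → φ (u (n + 1)) * s * φ (u (n + 1)) = φ (u (n + 1)) →
    ∃ Φ : A (n + 3) →ₐ[k] S, (∀ x, Φ (inc (n + 2) x) = φ x) ∧ Φ (u (n + 2)) = s

/-! ### Multiplication in the algebras of a tower -/

namespace Tower

variable {k : Type u} [Field k] {A : ℕ → Type u} [∀ n, Ring (A n)] [∀ n, Algebra k (A n)] {d : k}
variable (T : Tower k A d)

/-- The inclusion of `A n` into `A (n + 2)`. -/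
def inc2 (n : ℕ) : A n →ₐ[k] A (n + 2) := (T.inc (n + 1)).comp (T.inc n)

theorem inc2_apply (n : ℕ) (b : A n) : T.inc2 n b = T.inc (n + 1) (T.inc n b) := rfl

theorem u_inc2 (n : ℕ) (b : A n) : T.u (n + 1) * T.inc2 n b = T.inc2 n b * T.u (n + 1) :=
  T.u_comm n b

theorem left_induction {n : ℕ} {X : Submodule k (A (n + 2))}
    (h1 : ∀ a, ∀ x ∈ X, T.inc (n + 1) a * x ∈ X) (h2 : ∀ x ∈ X, T.u (n + 1) * x ∈ X)
    (t : A (n + 2)) : ∀ x ∈ X, t * x ∈ X := by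
  have ht : t ∈ Algebra.adjoin k (Set.range (T.inc (n + 1)) ∪ {T.u (n + 1)}) := by
    rw [T.adjoin]; trivial
  induction ht using Algebra.adjoin_induction with
  | mem y hy =>
    rcases hy with ⟨a, rfl⟩ | rfl
    · exact h1 a
    · exact h2
  | algebraMap r =>
    intro x hx
    rw [← Algebra.smul_def]
    exact X.smul_mem _ hx
  | add a b _ _ ha hb =>
    intro x hx
    rw [add_mul]
    exact X.add_mem (ha x hx) (hb x hx)
  | mul a b _ _ ha hb =>
    intro x hx
    rw [mul_assoc]
    exact ha _ (hb x hx)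

/-- The span of `A (n + 1)` and of `A (n + 1) u A (n + 1)`. -/
def spanU (n : ℕ) : Submodule k (A (n + 2)) :=
  LinearMap.range (T.inc (n + 1)).toLinearMap ⊔
    Submodule.span k {t | ∃ a b, t = T.inc (n + 1) a * T.u (n + 1) * T.inc (n + 1) b}

/-- The hypothesis moves `u x u` into `A(n) u`, so the span is stable under left multiplication by
`u` as well as by `A(n+1)`; it is a left ideal containing `1`. -/
theorem spanU_eq_top {n : ℕ}
    (h : ∀ x : A (n + 1), ∃ y : A n, T.u (n + 1) * T.inc (n + 1) x * T.u (n + 1) =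
      T.inc2 n y * T.u (n + 1)) (t : A (n + 2)) : t ∈ T.spanU n := by
  have hs : ∀ a b, T.inc (n + 1) a * T.u (n + 1) * T.inc (n + 1) b ∈ T.spanU n := fun a b =>
    Submodule.mem_sup_right (Submodule.subset_span ⟨a, b, rfl⟩)
  have hr : ∀ a, T.inc (n + 1) a ∈ T.spanU n := fun a => Submodule.mem_sup_left ⟨a, rfl⟩
  rw [← mul_one t]
  refine T.left_induction (X := T.spanU n) ?_ ?_ t 1 (by simpa using hr 1)
  · intro a x hx
    refine (sup_le (?_ : _ ≤ (T.spanU n).comap (LinearMap.mulLeft k (T.inc (n + 1) a))) ?_ :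
      T.spanU n ≤ (T.spanU n).comap (LinearMap.mulLeft k (T.inc (n + 1) a))) hx
    · rintro _ ⟨b, rfl⟩
      simpa using hr (a * b)
    · refine Submodule.span_le.2 ?_
      rintro _ ⟨b, c, rfl⟩
      simpa [mul_assoc] using hs (a * b) c
  · intro x hx
    refine (sup_le (?_ : _ ≤ (T.spanU n).comap (LinearMap.mulLeft k (T.u (n + 1)))) ?_ :
      T.spanU n ≤ (T.spanU n).comap (LinearMap.mulLeft k (T.u (n + 1)))) hx
    · rintro _ ⟨b, rfl⟩
      simpa using hs 1 b
    · refine Submodule.span_le.2 ?_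
      rintro _ ⟨b, c, rfl⟩
      obtain ⟨y, hy⟩ := h b
      have := hs (T.inc n y) c
      rw [← T.inc2_apply, ← hy] at this
      simpa [mul_assoc] using this

theorem conj_eq {R : Type w} [Ring R] {u b c x : R} (hb : u * b = b * u) (hc : u * c = c * u)
    (hx : u * x * u = u) : u * (b * x * c) * u = b * c * u := by
  calc u * (b * x * c) * u = u * b * x * (c * u) := by noncomm_ring
    _ = b * (u * x * u) * c := by rw [hb, ← hc]; noncomm_ring
    _ = b * c * u := by rw [hx, mul_assoc, hc, mul_assoc]

/-- Induction through `spanU_eq_top`. On the summand `A(n+1)` of `A(n+2)` the next `u` commutes and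
`u² = d u` applies; on `b u' c` the braid relation contracts `u u' u` to `u`. -/
theorem exists_u_mul_u : ∀ (n : ℕ) (x : A (n + 1)), ∃ y : A n,
    T.u (n + 1) * T.inc (n + 1) x * T.u (n + 1) = T.inc2 n y * T.u (n + 1)
  | 0, x => ⟨algebraMap k _ (T.cap x), by
      rw [T.u_cap, AlgHom.commutes, Algebra.smul_def]⟩
  | n + 1, x => by
    have hx := T.spanU_eq_top (exists_u_mul_u n) x
    have key : T.spanU n ≤ (LinearMap.range ((LinearMap.mulRight k (T.u (n + 2))).comp
        (T.inc2 (n + 1)).toLinearMap)).comap ((LinearMap.mulRight k (T.u (n + 2))).comp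
        ((LinearMap.mulLeft k (T.u (n + 2))).comp (T.inc (n + 2)).toLinearMap)) := by
      refine sup_le ?_ (Submodule.span_le.2 ?_)
      · rintro _ ⟨b, rfl⟩
        refine ⟨d • b, ?_⟩
        have := T.u_comm (n + 1) b
        simp only [LinearMap.comp_apply, AlgHom.toLinearMap_apply, LinearMap.mulRight_apply,
          LinearMap.mulLeft_apply, map_smul, inc2_apply]
        rw [this, mul_assoc, T.u_sq]
        simp
      · rintro _ ⟨b, c, rfl⟩
        refine ⟨b * c, ?_⟩
        have h1 := T.u_comm (n + 1) b
        have h2 := T.u_comm (n + 1) c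
        simp only [LinearMap.comp_apply, AlgHom.toLinearMap_apply, LinearMap.mulRight_apply,
          LinearMap.mulLeft_apply, map_mul, inc2_apply]
        exact (conj_eq h1 h2 (T.braid_up n)).symm
    obtain ⟨y, hy⟩ := key hx
    exact ⟨y, hy.symm⟩

/-- By the preceding contraction `A(n+1) u` is stable under left multiplication by `u`, hence is the
whole left ideal of `u`. -/
theorem exists_mul_u (n : ℕ) (t : A (n + 2)) : ∃ x : A (n + 1),
    t * T.u (n + 1) = T.inc (n + 1) x * T.u (n + 1) := by
  have := T.left_induction (X := LinearMap.range ((LinearMap.mulRight k (T.u (n + 1))).comp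
    (T.inc (n + 1)).toLinearMap)) ?_ ?_ t (T.u (n + 1)) ⟨1, by simp⟩
  · obtain ⟨x, hx⟩ := this
    exact ⟨x, hx.symm⟩
  · rintro a _ ⟨x, rfl⟩
    exact ⟨a * x, by simp [mul_assoc]⟩
  · rintro _ ⟨x, rfl⟩
    obtain ⟨y, hy⟩ := T.exists_u_mul_u n x
    exact ⟨T.inc n y, by simpa [mul_assoc, inc2_apply] using hy.symm⟩

/-- `u A u = A' u`, where `A'` is the algebra two levels below. -/
theorem exists_u_mul_mul_u (n : ℕ) (t : A (n + 2)) : ∃ y : A n,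
    T.u (n + 1) * t * T.u (n + 1) = T.inc2 n y * T.u (n + 1) := by
  obtain ⟨x, hx⟩ := T.exists_mul_u n t
  obtain ⟨y, hy⟩ := T.exists_u_mul_u n x
  exact ⟨y, by rw [mul_assoc, hx, ← mul_assoc, hy]⟩

/-! ### Lifting to algebras in an arbitrary universe -/

/-- The tower provides lifts only to algebras in `Type u`. The subalgebra of `S` generated by `φ`
and `s` has a copy there, namely a free algebra modulo the relation of having equal values in `S`;
the lift is made into that copy. -/
theorem exists_lift_one {S : Type w} [Ring S] [Algebra k S] (φ : A 1 →ₐ[k] S) (s : S)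
    (h : ∀ x, s * φ x * s = T.cap x • s) :
    ∃ Φ : A 2 →ₐ[k] S, (∀ x, Φ (T.inc 1 x) = φ x) ∧ Φ (T.u 1) = s := by
  let f : FreeAlgebra k (A 1 ⊕ Unit) →ₐ[k] S :=
    FreeAlgebra.lift k (Sum.elim (fun a => φ a) (fun _ => s))
  let r : FreeAlgebra k (A 1 ⊕ Unit) → FreeAlgebra k (A 1 ⊕ Unit) → Prop := fun x y => f x = f y
  let p := RingQuot.mkAlgHom k r
  have hp : ∀ x y, f x = f y → p x = p y := fun x y hxy => RingQuot.mkAlgHom_rel k hxy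
  let g : RingQuot r →ₐ[k] S := RingQuot.liftAlgHom k ⟨f, fun _ _ h => h⟩
  have hg : ∀ x, g (p x) = f x := fun x => RingQuot.liftAlgHom_mkAlgHom_apply k f _ x
  let φ' : A 1 →ₐ[k] RingQuot r := AlgHom.ofLinearMap
    { toFun := fun a => p (FreeAlgebra.ι k (Sum.inl a))
      map_add' := fun a b => by rw [← map_add]; exact hp _ _ (by simp [f])
      map_smul' := fun a b => by
        rw [RingHom.id_apply, ← map_smul]; exact hp _ _ (by simp [f]) }
    (by rw [← map_one p]; exact hp _ _ (by simp [f]))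
    (fun a b => by
      change p _ = p _ * p _
      rw [← map_mul]; exact hp _ _ (by simp [f]))
  obtain ⟨Φ, h1, h2⟩ := T.lift_one (RingQuot r) φ' (p (FreeAlgebra.ι k (Sum.inr ()))) (fun x => by
    change p _ * p _ * p _ = _ • p _
    rw [← map_mul, ← map_mul, ← map_smul]
    exact hp _ _ (by simpa [f] using h x))
  refine ⟨g.comp Φ, fun x => ?_, ?_⟩
  · rw [AlgHom.comp_apply, h1]
    exact (hg _).trans (by simp [f])
  · rw [AlgHom.comp_apply, h2, hg]
    simp [f]

theorem exists_lift_succ (n : ℕ) {S : Type w} [Ring S] [Algebra k S] (φ : A (n + 2) →ₐ[k] S)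
    (s : S) (hs : s * s = d • s)
    (hc : ∀ b, s * φ (T.inc (n + 1) b) = φ (T.inc (n + 1) b) * s)
    (h1 : s * φ (T.u (n + 1)) * s = s)
    (h2 : φ (T.u (n + 1)) * s * φ (T.u (n + 1)) = φ (T.u (n + 1))) :
    ∃ Φ : A (n + 3) →ₐ[k] S, (∀ x, Φ (T.inc (n + 2) x) = φ x) ∧ Φ (T.u (n + 2)) = s := by
  let f : FreeAlgebra k (A (n + 2) ⊕ Unit) →ₐ[k] S :=
    FreeAlgebra.lift k (Sum.elim (fun a => φ a) (fun _ => s))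
  let r : FreeAlgebra k (A (n + 2) ⊕ Unit) → FreeAlgebra k (A (n + 2) ⊕ Unit) → Prop :=
    fun x y => f x = f y
  let p := RingQuot.mkAlgHom k r
  have hp : ∀ x y, f x = f y → p x = p y := fun x y hxy => RingQuot.mkAlgHom_rel k hxy
  let g : RingQuot r →ₐ[k] S := RingQuot.liftAlgHom k ⟨f, fun _ _ h => h⟩
  have hg : ∀ x, g (p x) = f x := fun x => RingQuot.liftAlgHom_mkAlgHom_apply k f _ x
  let φ' : A (n + 2) →ₐ[k] RingQuot r := AlgHom.ofLinearMap
    { toFun := fun a => p (FreeAlgebra.ι k (Sum.inl a))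
      map_add' := fun a b => by rw [← map_add]; exact hp _ _ (by simp [f])
      map_smul' := fun a b => by
        rw [RingHom.id_apply, ← map_smul]; exact hp _ _ (by simp [f]) }
    (by rw [← map_one p]; exact hp _ _ (by simp [f]))
    (fun a b => by
      change p _ = p _ * p _
      rw [← map_mul]; exact hp _ _ (by simp [f]))
  obtain ⟨Φ, h1, h2⟩ := T.lift_succ n (RingQuot r) φ' (p (FreeAlgebra.ι k (Sum.inr ())))
    (by rw [← map_mul, ← map_smul]; exact hp _ _ (by simpa [f] using hs))
    (fun b => by
      change p _ * p _ = p _ * p _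
      rw [← map_mul, ← map_mul]; exact hp _ _ (by simpa [f] using hc b))
    (by
      change p _ * p _ * p _ = p _
      rw [← map_mul, ← map_mul]; exact hp _ _ (by simpa [f] using h1))
    (by
      change p _ * p _ * p _ = p _
      rw [← map_mul, ← map_mul]; exact hp _ _ (by simpa [f] using h2))
  refine ⟨g.comp Φ, fun x => ?_, ?_⟩
  · rw [AlgHom.comp_apply, h1]
    exact (hg _).trans (by simp [f])
  · rw [AlgHom.comp_apply, h2, hg]
    simp [f]

end Tower

namespace Tower

variable {k : Type u} [Field k] {A : ℕ → Type u} [∀ n, Ring (A n)] [∀ n, Algebra k (A n)] {d : k}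
variable (T : Tower k A d)
variable {V : Type w} [AddCommGroup V] [Module k V] {W : Type w'} [AddCommGroup W] [Module k W]
variable {Y : Type w''} [AddCommGroup Y] [Module k Y]

/-! ### Globalisation of representations -/

/-- The relations defining `A (n + 2) ε ⊗ V` as a quotient of `A (n + 2) ⊗ V`. -/
def globRel {n : ℕ} (ρ : AlgRep k (A n) V) : Submodule k (A (n + 2) ⊗[k] V) :=
  Submodule.span k ({t | ∃ a b v, t = (a * T.inc2 n b) ⊗ₜ[k] v - a ⊗ₜ[k] ρ b v} ∪
    {t | ∃ a v, t = (a * T.u (n + 1)) ⊗ₜ[k] v - d • a ⊗ₜ[k] v})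

/-- The globalisation of a representation of `A n`, as a vector space. -/
def Glob {n : ℕ} (ρ : AlgRep k (A n) V) : Type (max u w) := (A (n + 2) ⊗[k] V) ⧸ T.globRel ρ

noncomputable instance {n : ℕ} (ρ : AlgRep k (A n) V) : AddCommGroup (T.Glob ρ) :=
  inferInstanceAs (AddCommGroup ((A (n + 2) ⊗[k] V) ⧸ T.globRel ρ))

noncomputable instance {n : ℕ} (ρ : AlgRep k (A n) V) : Module k (T.Glob ρ) :=
  inferInstanceAs (Module k ((A (n + 2) ⊗[k] V) ⧸ T.globRel ρ))

variable {n : ℕ} (ρ : AlgRep k (A n) V) (σ : AlgRep k (A n) W) (τ : AlgRep k (A n) Y)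

theorem globRel_invariant (a : A (n + 2)) :
    T.globRel ρ ≤ (T.globRel ρ).comap (AlgRep.free k (A (n + 2)) V a) := by
  refine Submodule.span_le.2 ?_
  rintro _ (⟨x, b, v, rfl⟩ | ⟨x, v, rfl⟩)
  · refine Submodule.subset_span (Or.inl ⟨a * x, b, v, ?_⟩)
    simp [mul_assoc]
  · refine Submodule.subset_span (Or.inr ⟨a * x, v, ?_⟩)
    simp [mul_assoc]

/-- The action of `A (n + 2)` on the globalisation. -/
noncomputable def globAct : AlgRep k (A (n + 2)) (T.Glob ρ) :=
  (AlgRep.free k (A (n + 2)) V).quot (T.globRel ρ) (T.globRel_invariant ρ)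

/-- The canonical map `v ↦ ε ⊗ v` into the globalisation. -/
noncomputable def globIn : V →ₗ[k] T.Glob ρ :=
  (T.globRel ρ).mkQ.comp (TensorProduct.mk k (A (n + 2)) V 1)

theorem globAct_globIn (a : A (n + 2)) (v : V) :
    T.globAct ρ a (T.globIn ρ v) = (T.globRel ρ).mkQ (a ⊗ₜ v) := by
  change (T.globRel ρ).mkQ ((a * 1) ⊗ₜ v) = _
  rw [mul_one]

theorem globIn_act (b : A n) (v : V) :
    T.globAct ρ (T.inc2 n b) (T.globIn ρ v) = T.globIn ρ (ρ b v) := by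
  rw [globAct_globIn]
  refine (Submodule.Quotient.eq _).2 (Submodule.subset_span (Or.inl ⟨1, b, v, ?_⟩))
  simp

theorem globIn_u (v : V) :
    T.globAct ρ (T.u (n + 1)) (T.globIn ρ v) = d • T.globIn ρ v := by
  rw [globAct_globIn]
  refine (Submodule.Quotient.eq _).2 (Submodule.subset_span (Or.inr ⟨1, v, ?_⟩))
  simp

theorem globIn_eq (v : V) :
    T.globIn ρ v = d⁻¹ • T.globAct ρ (T.u (n + 1)) (T.globIn ρ v) := by
  rw [globIn_u, smul_smul, inv_mul_cancel₀ T.d_ne, one_smul]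

variable {T ρ}

theorem glob_induction' {X : Submodule k (T.Glob ρ)}
    (h : ∀ a v, T.globAct ρ a (T.globIn ρ v) ∈ X) (y : T.Glob ρ) : y ∈ X := by
  obtain ⟨t, rfl⟩ := (T.globRel ρ).mkQ_surjective y
  induction t using TensorProduct.induction_on with
  | zero => rw [map_zero]; exact X.zero_mem
  | tmul a v => rw [← globAct_globIn]; exact h a v
  | add x y hx hy => rw [map_add]; exact X.add_mem hx hy

/-- Coefficients in `A(n+1)` suffice: `1 ⊗ v` equals `d⁻¹ u ⊗ v`, and `A(n+2) u = A(n+1) u`. -/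
theorem glob_induction {X : Submodule k (T.Glob ρ)}
    (h : ∀ x v, T.globAct ρ (T.inc (n + 1) x) (T.globIn ρ v) ∈ X) (y : T.Glob ρ) : y ∈ X := by
  refine glob_induction' (fun a v => ?_) y
  obtain ⟨x, hx⟩ := T.exists_mul_u n a
  rw [globIn_eq, map_smul, ← AlgRep.mul_act, hx, AlgRep.mul_act, ← map_smul, ← globIn_eq]
  exact h x v

theorem glob_hom_ext {n' : ℕ} {ψ : A n' → A (n + 2)} (hψ : ∀ x, ∃ y, ψ y = T.inc (n + 1) x)
    {s : A n' → Module.End k Y} {f f' : T.Glob ρ →ₗ[k] Y}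
    (hf : ∀ a y, f (T.globAct ρ (ψ a) y) = s a (f y))
    (hf' : ∀ a y, f' (T.globAct ρ (ψ a) y) = s a (f' y))
    (h : ∀ v, f (T.globIn ρ v) = f' (T.globIn ρ v)) (y : T.Glob ρ) : f y = f' y := by
  refine glob_induction (X := LinearMap.eqLocus f f') (fun x v => ?_) y
  obtain ⟨a, ha⟩ := hψ x
  rw [LinearMap.mem_eqLocus, ← ha, hf, hf', h]

theorem glob_ext {s : AlgRep k (A (n + 2)) Y} {f f' : T.Glob ρ →ₗ[k] Y}
    (hf : AlgRep.IsHom (T.globAct ρ) s f) (hf' : AlgRep.IsHom (T.globAct ρ) s f')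
    (h : ∀ v, f (T.globIn ρ v) = f' (T.globIn ρ v)) (y : T.Glob ρ) : f y = f' y :=
  glob_hom_ext (ψ := id) (s := s) (fun _ => ⟨_, rfl⟩) hf hf' h y

/-- Since `a ⊗ v = d⁻¹ a u ⊗ v` and `u a u` lies in `A(n) u`, the image of `ε` in the globalisation
is no larger than `V`. -/
theorem glob_u_mem (y : T.Glob ρ) : ∃ v, T.globAct ρ (T.u (n + 1)) y = T.globIn ρ v := by
  have := glob_induction' (X := (LinearMap.range (T.globIn ρ)).comap (T.globAct ρ (T.u (n + 1))))
    (fun a v => ?_) y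
  · obtain ⟨v, hv⟩ := this
    exact ⟨v, hv.symm⟩
  · obtain ⟨b, hb⟩ := T.exists_u_mul_mul_u n a
    refine ⟨ρ b v, ?_⟩
    rw [← globIn_act]
    conv_rhs => rw [globIn_eq, map_smul, map_smul, ← AlgRep.mul_act, ← AlgRep.mul_act, hb,
      AlgRep.mul_act, globIn_u, map_smul, smul_smul, inv_mul_cancel₀ T.d_ne, one_smul]

variable (T) in
/-- The universal property of the globalisation. -/
theorem exists_globLift (ρ : AlgRep k (A n) V) (s : AlgRep k (A (n + 2)) Y) (φ : V →ₗ[k] Y)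
    (h1 : ∀ b v, φ (ρ b v) = s (T.inc2 n b) (φ v)) (h2 : ∀ v, s (T.u (n + 1)) (φ v) = d • φ v) :
    ∃ f : T.Glob ρ →ₗ[k] Y, AlgRep.IsHom (T.globAct ρ) s f ∧ ∀ v, f (T.globIn ρ v) = φ v := by
  let F : A (n + 2) ⊗[k] V →ₗ[k] Y := TensorProduct.lift ((LinearMap.lcomp k Y φ).comp
    s.toLinearMap)
  have hF : ∀ a v, F (a ⊗ₜ v) = s a (φ v) := fun a v => by simp [F]
  have hle : T.globRel ρ ≤ LinearMap.ker F := by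
    refine Submodule.span_le.2 ?_
    rintro _ (⟨x, b, v, rfl⟩ | ⟨x, v, rfl⟩)
    · simp [hF, h1]
    · simp [hF, h2]
  let f : T.Glob ρ →ₗ[k] Y := (T.globRel ρ).liftQ F hle
  have hf : ∀ t, f ((T.globRel ρ).mkQ t) = F t := fun t => rfl
  refine ⟨f, fun a y => ?_, fun v => ?_⟩
  · refine glob_induction' (X := LinearMap.eqLocus (f ∘ₗ T.globAct ρ a) (s a ∘ₗ f))
      (fun x v => ?_) y
    simp only [LinearMap.mem_eqLocus, LinearMap.comp_apply]
    rw [← AlgRep.mul_act, globAct_globIn, globAct_globIn, hf, hf, hF, hF, AlgRep.mul_act]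
  · refine (hf _).trans ?_
    rw [TensorProduct.mk_apply, hF, AlgRep.one_act]

variable {σ τ}

theorem exists_globMap {f : V →ₗ[k] W} (hf : AlgRep.IsHom ρ σ f) :
    ∃ F : T.Glob ρ →ₗ[k] T.Glob σ, AlgRep.IsHom (T.globAct ρ) (T.globAct σ) F ∧
      ∀ v, F (T.globIn ρ v) = T.globIn σ (f v) :=
  T.exists_globLift ρ (T.globAct σ) ((T.globIn σ).comp f)
    (fun b v => by simp [hf b v, globIn_act]) (fun v => by simp [globIn_u])

/-- The map induced by an intertwining map on globalisations. -/
noncomputable def globMap (T : Tower k A d) {f : V →ₗ[k] W} (hf : AlgRep.IsHom ρ σ f) :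
    T.Glob ρ →ₗ[k] T.Glob σ := (exists_globMap hf).choose

theorem globMap_isHom {f : V →ₗ[k] W} (hf : AlgRep.IsHom ρ σ f) :
    AlgRep.IsHom (T.globAct ρ) (T.globAct σ) (T.globMap hf) :=
  (exists_globMap hf).choose_spec.1

theorem globMap_globIn {f : V →ₗ[k] W} (hf : AlgRep.IsHom ρ σ f) (v : V) :
    T.globMap hf (T.globIn ρ v) = T.globIn σ (f v) :=
  (exists_globMap hf).choose_spec.2 v

theorem globMap_surjective {f : V →ₗ[k] W} (hf : AlgRep.IsHom ρ σ f)
    (h : Function.Surjective f) : Function.Surjective (T.globMap hf) := by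
  intro y
  refine glob_induction' (X := LinearMap.range (T.globMap hf)) (fun a v => ?_) y
  obtain ⟨x, rfl⟩ := h v
  exact ⟨T.globAct ρ a (T.globIn ρ x), by rw [globMap_isHom, globMap_globIn]⟩

theorem globMap_comp {f : V →ₗ[k] W} (hf : AlgRep.IsHom ρ σ f) {f' : W →ₗ[k] Y}
    (hf' : AlgRep.IsHom σ τ f') {f'' : V →ₗ[k] Y} (hf'' : AlgRep.IsHom ρ τ f'')
    (h : ∀ v, f' (f v) = f'' v) (y : T.Glob ρ) :
    T.globMap hf' (T.globMap hf y) = T.globMap hf'' y := by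
  refine glob_ext (f := T.globMap hf' ∘ₗ T.globMap hf) (s := T.globAct τ) (fun a y => ?_)
    (globMap_isHom hf'') (fun v => ?_) y
  · simp [globMap_isHom hf a, globMap_isHom hf' a]
  · simp [globMap_globIn, h]

theorem globMap_id {f : V →ₗ[k] V} (hf : AlgRep.IsHom ρ ρ f) (h : ∀ v, f v = v)
    (y : T.Glob ρ) : T.globMap hf y = y :=
  glob_ext (f' := LinearMap.id) (globMap_isHom hf) (fun _ _ => rfl)
    (fun v => by rw [globMap_globIn, h]; rfl) y

/-- The submodule of the globalisation generated by the image of a subspace. -/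
noncomputable def globSpan (T : Tower k A d) (ρ : AlgRep k (A n) V) (N : Set V) : Submodule k (T.Glob ρ) :=
  Submodule.span k {t | ∃ a, ∃ v ∈ N, t = T.globAct ρ a (T.globIn ρ v)}

theorem act_mem_globSpan (N : Set V) (a : A (n + 2)) {y : T.Glob ρ} (hy : y ∈ T.globSpan ρ N) :
    T.globAct ρ a y ∈ T.globSpan ρ N := by
  refine (Submodule.span_le.2 ?_ : T.globSpan ρ N ≤ (T.globSpan ρ N).comap (T.globAct ρ a)) hy
  rintro _ ⟨b, v, hv, rfl⟩
  exact Submodule.subset_span ⟨a * b, v, hv, by rw [AlgRep.mul_act]⟩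

/-- Right exactness of globalisation. -/
theorem ker_globMap_le {f : V →ₗ[k] W} (hf : AlgRep.IsHom ρ σ f)
    (h : Function.Surjective f) {N : Set V} (hN : ∀ v, f v = 0 → v ∈ N) {y : T.Glob ρ}
    (hy : T.globMap hf y = 0) : y ∈ T.globSpan ρ N := by
  let S := T.globSpan ρ N
  let Q := (T.globAct ρ).quot S (fun a y hy => act_mem_globSpan N a hy)
  -- A merely set-theoretic section. Modulo `S` the class of `1 ⊗ r w` does not depend on the
  -- choice, so it is linear in `w` and extends to `Glob W`; this extension recovers the class of
  -- `y` from its image.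
  let r : W → V := Function.surjInv h
  have hr : ∀ w, f (r w) = w := Function.surjInv_eq h
  have key : ∀ v v', f v = f v' → S.mkQ (T.globIn ρ v) = S.mkQ (T.globIn ρ v') := fun v v' hv => by
    refine (Submodule.Quotient.eq _).2 (Submodule.subset_span ⟨1, v - v', hN _ ?_, ?_⟩)
    · rw [map_sub, hv, sub_self]
    · rw [AlgRep.one_act, map_sub]
  let φ : W →ₗ[k] (T.Glob ρ ⧸ S) :=
    { toFun := fun w => S.mkQ (T.globIn ρ (r w))
      map_add' := fun x y => by
        rw [← map_add, ← map_add]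
        exact key _ _ (by simp [hr])
      map_smul' := fun c x => by
        rw [RingHom.id_apply, ← map_smul, ← map_smul]
        exact key _ _ (by simp [hr]) }
  obtain ⟨F, hF1, hF2⟩ := T.exists_globLift σ Q φ
    (fun b w => by
      change S.mkQ _ = S.mkQ (T.globAct ρ _ (T.globIn ρ _))
      rw [globIn_act]
      exact key _ _ (by rw [hr, hf, hr]))
    (fun w => by
      change S.mkQ (T.globAct ρ _ (T.globIn ρ _)) = d • S.mkQ _
      rw [globIn_u, map_smul])
  have : F (T.globMap hf y) = S.mkQ y := by
    refine glob_ext (f := F ∘ₗ T.globMap hf) (s := Q) (fun a y => ?_) (fun _ _ => rfl)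
      (fun v => ?_) y
    · simp [globMap_isHom hf a, hF1 a]
    · simp only [LinearMap.comp_apply, globMap_globIn, hF2]
      exact key _ _ (hr _)
  rw [hy, map_zero] at this
  exact (Submodule.Quotient.mk_eq_zero _).1 this.symm

theorem exists_of_globMap_eq_zero {f : V →ₗ[k] W} (hf : AlgRep.IsHom ρ σ f) {g : W →ₗ[k] Y}
    (hg : AlgRep.IsHom σ τ g) (h : Function.Surjective g) (hfg : ∀ w, g w = 0 → ∃ v, f v = w)
    {y : T.Glob σ} (hy : T.globMap hg y = 0) : ∃ x, T.globMap hf x = y := by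
  have := ker_globMap_le hg h (N := Set.range f) hfg hy
  refine (Submodule.span_le.2 ?_ : _ ≤ LinearMap.range (T.globMap hf)) this
  rintro _ ⟨a, _, ⟨v, rfl⟩, rfl⟩
  exact ⟨T.globAct ρ a (T.globIn ρ v), by rw [globMap_isHom, globMap_globIn]⟩

end Tower

namespace Tower

variable {k : Type u} [Field k] {A : ℕ → Type u} [∀ n, Ring (A n)] [∀ n, Algebra k (A n)] {d : k}
variable (T : Tower k A d)
variable {V : Type w} [AddCommGroup V] [Module k V] {W : Type w'} [AddCommGroup W] [Module k W]
variable {Y : Type w''} [AddCommGroup Y] [Module k Y] {n : ℕ}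

/-! ### Restriction of the globalisation to `A (n + 1)` -/

/-- The restriction of a representation to the preceding algebra of the tower. -/
def res (ρ : AlgRep k (A (n + 1)) V) : AlgRep k (A n) V := ρ.comp (T.inc n)

theorem res_apply (ρ : AlgRep k (A (n + 1)) V) (b : A n) : T.res ρ b = ρ (T.inc n b) := rfl

/-- The pairs `(x u v, - x u ⊗ u v)`, for a representation `V` of `A (n + 1)`. -/
noncomputable def pushRel (ρ : AlgRep k (A (n + 1)) V) : Submodule k (V × T.Glob (T.res ρ)) :=
  Submodule.span k {t | ∃ x v, t = (ρ (x * T.u n) v,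
    - T.globAct (T.res ρ) (T.inc (n + 1) (x * T.u n)) (T.globIn (T.res ρ) (ρ (T.u n) v)))}

variable {T}

theorem mem_pushRel (ρ : AlgRep k (A (n + 1)) V) (x : A (n + 1)) (v : V) :
    (ρ (x * T.u n) v, - T.globAct (T.res ρ) (T.inc (n + 1) (x * T.u n))
      (T.globIn (T.res ρ) (ρ (T.u n) v))) ∈ T.pushRel ρ :=
  Submodule.subset_span ⟨x, v, rfl⟩

/-- The braid relation, applied to a vector on which `u(n+1)` is the scalar `d`. It fails for `n =
0`, where the lower generator is the placeholder `0`. -/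
theorem u_inc_u_act {s : AlgRep k (A (n + 2)) Y} {y : Y} (hy : s (T.u (n + 1)) y = d • y) :
    n ≠ 0 → s (T.u (n + 1)) (s (T.inc (n + 1) (T.u n)) y) = y := by
  intro hn
  obtain ⟨m, rfl⟩ := Nat.exists_eq_succ_of_ne_zero hn
  have h := congrArg (fun a => s a y) (T.braid_up m)
  simp only [AlgRep.mul_act] at h
  rw [hy, map_smul, map_smul] at h
  exact smul_right_injective _ T.d_ne h

theorem exists_mul_u' (x : A (n + 1)) : ∃ y, x * T.u n = T.inc n y * T.u n := by
  cases n with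
  | zero => exact ⟨0, by simp [T.u_zero]⟩
  | succ n => exact T.exists_mul_u n x

theorem pushRel_eq_bot {ρ : AlgRep k (A 1) V} {t : V × T.Glob (T.res ρ)}
    (ht : t ∈ T.pushRel ρ) : t = 0 := by
  refine (Submodule.span_le.2 ?_ : _ ≤ (⊥ : Submodule k _)) ht
  rintro _ ⟨x, v, rfl⟩
  simp [T.u_zero]

variable (ρ : AlgRep k (A (n + 1)) V)

/-- `A (n + 3)` acts on the quotient of `V ⊕ Glob (res V)` by the relations `pushRel`. -/
theorem exists_pushAct {e : T.Glob (T.res ρ) →ₗ[k] V}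
    (he : ∀ x y, e (T.globAct (T.res ρ) (T.inc (n + 1) x) y) = ρ x (e y))
    (heg : ∀ v, e (T.globIn (T.res ρ) v) = v) :
    ∃ Φ : AlgRep k (A (n + 3)) ((V × T.Glob (T.res ρ)) ⧸ T.pushRel ρ),
      (∀ x t, Φ (T.inc2 (n + 1) x) ((T.pushRel ρ).mkQ t) = (T.pushRel ρ).mkQ
        (ρ x t.1, T.globAct (T.res ρ) (T.inc (n + 1) x) t.2)) ∧
      (∀ t, Φ (T.inc (n + 2) (T.u (n + 1))) ((T.pushRel ρ).mkQ t) = (T.pushRel ρ).mkQ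
        (0, T.globIn (T.res ρ) t.1 + T.globAct (T.res ρ) (T.u (n + 1)) t.2)) ∧
      (∀ t, Φ (T.u (n + 2)) ((T.pushRel ρ).mkQ t) = (T.pushRel ρ).mkQ (d • t.1 + e t.2, 0)) := by
  set N := T.pushRel ρ with hN
  set gA := T.globAct (T.res ρ) with hgA
  set g := T.globIn (T.res ρ) with hg
  let ψ := ρ.prod (gA.comp (T.inc (n + 1)))
  have hψ : ∀ x t, ψ x t = (ρ x t.1, gA (T.inc (n + 1) x) t.2) := fun x t => rfl
  have hψN : ∀ x, N ≤ N.comap (ψ x) := by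
    intro x
    refine Submodule.span_le.2 ?_
    rintro _ ⟨y, v, rfl⟩
    have := mem_pushRel (T := T) ρ (x * y) v
    rw [mul_assoc, AlgRep.mul_act ρ x, map_mul (T.inc (n + 1)) x, AlgRep.mul_act _ (T.inc _ x),
      ← map_neg] at this
    exact this
  let φ := ψ.quot N hψN
  have hφ : ∀ x t, φ x (N.mkQ t) = N.mkQ (ρ x t.1, gA (T.inc (n + 1) x) t.2) := fun x t => rfl
  -- the operator by which `u (n + 1)` acts
  let s₀ : V × T.Glob (T.res ρ) →ₗ[k] V × T.Glob (T.res ρ) :=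
    LinearMap.prod 0 (g.coprod (gA (T.u (n + 1))))
  have hs₀ : ∀ t, s₀ t = (0, g t.1 + gA (T.u (n + 1)) t.2) := fun t => rfl
  have hgfix : ∀ v, gA (T.u (n + 1)) (g v) = d • g v := T.globIn_u _
  have hfix : ∀ t : V × T.Glob (T.res ρ), ∃ v, g t.1 + gA (T.u (n + 1)) t.2 = g v := fun t => by
    obtain ⟨v, hv⟩ := glob_u_mem t.2
    exact ⟨t.1 + v, by rw [map_add, ← hv]⟩
  have hgb : ∀ b v, gA (T.inc2 n b) (g v) = g (ρ (T.inc n b) v) := T.globIn_act _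
  have hs₀N : N ≤ N.comap s₀ := by
    refine Submodule.span_le.2 ?_
    rintro _ ⟨x, v, rfl⟩
    obtain ⟨y, hy⟩ := exists_mul_u' (T := T) x
    -- The operator kills each generator of `N`: the factor `x u` may be replaced by `y u` with `y`
    -- from `A n`, which passes `u(n+1)`, and `u(n+1) u(n)` fixes the image of `g`. For `n = 0` all
    -- terms vanish.
    have : s₀ (ρ (x * T.u n) v, - gA (T.inc (n + 1) (x * T.u n)) (g (ρ (T.u n) v))) = 0 := by
      rw [hs₀]
      refine Prod.ext rfl ?_
      change g _ + gA _ (- _) = 0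
      rw [map_neg, add_neg_eq_zero]
      by_cases hn : n = 0
      · subst hn
        simp [T.u_zero]
      · have h1 : gA (T.u (n + 1)) (gA (T.inc (n + 1) (T.inc n y * T.u n)) (g (ρ (T.u n) v))) =
            gA (T.inc2 n y) (g (ρ (T.u n) v)) := by
          rw [← AlgRep.mul_act, map_mul (T.inc (n + 1)), ← T.inc2_apply, ← mul_assoc, T.u_inc2, mul_assoc,
            AlgRep.mul_act, AlgRep.mul_act, u_inc_u_act (hgfix _) hn]
        rw [hy, h1, hgb, ← AlgRep.mul_act]
    change s₀ _ ∈ N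
    rw [this]
    exact N.zero_mem
  let s : Module.End k ((V × T.Glob (T.res ρ)) ⧸ N) := N.mapQ N s₀ hs₀N
  have hs : ∀ t, s (N.mkQ t) = N.mkQ (0, g t.1 + gA (T.u (n + 1)) t.2) := fun t => rfl
  have hmk : ∀ (c : k) y, N.mkQ (0, c • y) = c • N.mkQ (0, y) := fun c y => by
    rw [← map_smul N.mkQ, Prod.smul_mk, smul_zero]
  have hext : ∀ f f' : Module.End k ((V × T.Glob (T.res ρ)) ⧸ N),
      (∀ t, f (N.mkQ t) = f' (N.mkQ t)) → f = f' := fun f f' h => by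
    refine LinearMap.ext fun y => ?_
    obtain ⟨t, rfl⟩ := N.mkQ_surjective y
    exact h t
  -- The relation that forces the passage to the quotient by `N`: on the direct sum the two sides
  -- differ by the generator of `N` with `x = 1` and `v = t.1`.
  have hdown : ∀ t, φ (T.u n) (s (φ (T.u n) (N.mkQ t))) = φ (T.u n) (N.mkQ t) := by
    intro t
    rw [hφ, hs, hφ]
    refine ((Submodule.Quotient.eq N).2 ?_).symm
    have := mem_pushRel (T := T) ρ 1 t.1
    rw [one_mul] at this
    convert this using 1
    refine Prod.ext (by simp) ?_
    have hb : gA (T.inc (n + 1) (T.u n)) (gA (T.u (n + 1)) (gA (T.inc (n + 1) (T.u n)) t.2)) =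
        gA (T.inc (n + 1) (T.u n)) t.2 := by
      rw [← AlgRep.mul_act, ← AlgRep.mul_act, T.braid_down]
    simp [hb, ← hgA, ← hg]
  obtain ⟨Φ, hΦ1, hΦ2⟩ : ∃ Φ : AlgRep k (A (n + 2)) ((V × T.Glob (T.res ρ)) ⧸ N),
      (∀ x, Φ (T.inc (n + 1) x) = φ x) ∧ Φ (T.u (n + 1)) = s := by
    have hss : s * s = d • s := hext _ _ fun t => by
      obtain ⟨v, hv⟩ := hfix t
      simp only [Module.End.mul_apply, LinearMap.smul_apply, hs, hv, map_zero, zero_add, hgfix, hmk]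
    have hcomm : ∀ b, s * φ (T.inc n b) = φ (T.inc n b) * s := fun b => hext _ _ fun t => by
      simp only [Module.End.mul_apply, hφ, hs, map_add, map_zero]
      rw [← T.inc2_apply, hgb, ← AlgRep.mul_act, T.u_inc2, AlgRep.mul_act]
    -- `A 2` is presented over `A 1` by means of `cap`; all later algebras are presented by braid
    -- relations.
    rcases n with _ | m
    · refine T.exists_lift_one φ s fun x => hext _ _ fun t => ?_
      obtain ⟨v, hv⟩ := hfix t
      simp only [Module.End.mul_apply, LinearMap.smul_apply, hs, hφ, hv, map_zero, zero_add]
      have h := congrArg (fun a => gA a (g v)) (T.u_cap x)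
      simp only [AlgRep.mul_act, AlgRep.smul_act] at h
      rw [hgfix, map_smul, map_smul, smul_comm] at h
      rw [← hmk]
      exact congrArg (fun y => N.mkQ (0, y)) (smul_right_injective _ T.d_ne h)
    · refine T.exists_lift_succ m φ s hss hcomm (hext _ _ fun t => ?_) (hext _ _ fun t => ?_)
      · obtain ⟨v, hv⟩ := hfix t
        simp only [Module.End.mul_apply, hs, hφ, hv, map_zero, zero_add]
        rw [u_inc_u_act (hgfix _) (Nat.succ_ne_zero m)]
      · exact hdown t
  -- the operator by which `u (n + 2)` acts
  let r₀ : V × T.Glob (T.res ρ) →ₗ[k] V × T.Glob (T.res ρ) :=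
    LinearMap.prod ((d • LinearMap.id).coprod e) 0
  have hr₀ : ∀ t, r₀ t = (d • t.1 + e t.2, 0) := fun t => rfl
  -- On a generator of `N` the two contributions `d x u v` and `x u u v` cancel because `u² = d u`.
  have hr₀N : N ≤ N.comap r₀ := by
    refine Submodule.span_le.2 ?_
    rintro _ ⟨x, v, rfl⟩
    have : r₀ (ρ (x * T.u n) v, - gA (T.inc (n + 1) (x * T.u n)) (g (ρ (T.u n) v))) = 0 := by
      rw [hr₀]
      refine Prod.ext ?_ rfl
      simp only [Prod.fst_zero]
      rw [map_neg, he, heg, add_neg_eq_zero, ← AlgRep.mul_act, mul_assoc, T.u_sq, mul_smul_comm,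
        AlgRep.smul_act]
    change r₀ _ ∈ N
    rw [this]
    exact N.zero_mem
  let r : Module.End k ((V × T.Glob (T.res ρ)) ⧸ N) := N.mapQ N r₀ hr₀N
  have hr : ∀ t, r (N.mkQ t) = N.mkQ (d • t.1 + e t.2, 0) := fun t => rfl
  obtain ⟨Ψ, hΨ1, hΨ2⟩ := T.exists_lift_succ n Φ r
    (hext _ _ fun t => by
      simp only [Module.End.mul_apply, LinearMap.smul_apply, hr, map_zero, add_zero]
      rw [← map_smul, Prod.smul_mk, smul_zero])
    (fun b => hext _ _ fun t => by
      simp only [Module.End.mul_apply, hΦ1, hr, hφ, map_zero, he, map_add, map_smul])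
    (hext _ _ fun t => by
      simp only [Module.End.mul_apply, hΦ2, hr, hs, map_zero, smul_zero, zero_add, add_zero, heg])
    (hext _ _ fun t => by
      obtain ⟨v, hv⟩ := hfix t
      simp only [Module.End.mul_apply, hΦ2, hr, hs, map_zero, smul_zero, zero_add, add_zero, hv,
        heg])
  exact ⟨Ψ, fun x t => by rw [T.inc2_apply, hΨ1, hΦ1, hφ], fun t => by rw [hΨ1, hΦ2, hs],
    fun t => by rw [hΨ2, hr]⟩

variable (T) in
theorem exists_theta :
    ∃ f : T.Glob (T.res ρ) →ₗ[k] T.Glob ρ,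
      AlgRep.IsHom (T.globAct (T.res ρ)) (T.res (T.globAct ρ)) f ∧
      ∀ v, f (T.globIn (T.res ρ) v) = T.globAct ρ (T.inc (n + 2) (T.u (n + 1))) (T.globIn ρ v) := by
  refine T.exists_globLift (T.res ρ) (T.res (T.globAct ρ))
    ((T.globAct ρ (T.inc (n + 2) (T.u (n + 1)))).comp (T.globIn ρ)) (fun b v => ?_) (fun v => ?_)
  · simp only [LinearMap.comp_apply, T.res_apply]
    rw [← globIn_act, ← AlgRep.mul_act, ← AlgRep.mul_act, T.inc2_apply, ← map_mul, ← map_mul,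
      T.inc2_apply, T.u_comm]
  · simp only [LinearMap.comp_apply, T.res_apply]
    rw [← AlgRep.mul_act, ← map_mul, T.u_sq, map_smul, AlgRep.smul_act]

/-- The map `Glob (res V) → Glob V`, `v ↦ u v`. -/
noncomputable def theta (T : Tower k A d) (ρ : AlgRep k (A (n + 1)) V) :
    T.Glob (T.res ρ) →ₗ[k] T.Glob ρ := (T.exists_theta ρ).choose

theorem theta_act (a : A (n + 2)) (y : T.Glob (T.res ρ)) :
    T.theta ρ (T.globAct (T.res ρ) a y) = T.globAct ρ (T.inc (n + 2) a) (T.theta ρ y) :=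
  (T.exists_theta ρ).choose_spec.1 a y

theorem theta_globIn (v : V) : T.theta ρ (T.globIn (T.res ρ) v) =
    T.globAct ρ (T.inc (n + 2) (T.u (n + 1))) (T.globIn ρ v) :=
  (T.exists_theta ρ).choose_spec.2 v

/-- Extension of maps from `V`, regarded over `A (n + 2)`, to the pushout. -/
theorem exists_push_lift (s : AlgRep k (A (n + 2)) Y) (φ : V →ₗ[k] Y)
    (h : ∀ b v, φ (ρ b v) = s (T.inc (n + 1) b) (φ v)) :
    ∃ F : ((V × T.Glob (T.res ρ)) ⧸ T.pushRel ρ) →ₗ[k] Y,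
      (∀ x t, F ((T.pushRel ρ).mkQ (ρ x t.1, T.globAct (T.res ρ) (T.inc (n + 1) x) t.2)) =
        s (T.inc (n + 1) x) (F ((T.pushRel ρ).mkQ t))) ∧
      (∀ t, F ((T.pushRel ρ).mkQ (0, T.globIn (T.res ρ) t.1 +
        T.globAct (T.res ρ) (T.u (n + 1)) t.2)) = s (T.u (n + 1)) (F ((T.pushRel ρ).mkQ t))) ∧
      (∀ v, F ((T.pushRel ρ).mkQ (v, 0)) = φ v) := by
  -- In the pushout `(0, 1 ⊗ v)` is `u` applied to `(v, 0)`, so on the second summand the extension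
  -- has to be `a ⊗ v ↦ a u φ(v)`.
  obtain ⟨L, hL1, hL2⟩ := T.exists_globLift (T.res ρ) s ((s (T.u (n + 1))).comp φ)
    (fun b v => by
      simp only [LinearMap.comp_apply, T.res_apply, h]
      rw [← AlgRep.mul_act, ← AlgRep.mul_act, T.u_comm, T.inc2_apply])
    (fun v => by
      simp only [LinearMap.comp_apply]
      rw [← AlgRep.mul_act, T.u_sq, AlgRep.smul_act])
  have hle : T.pushRel ρ ≤ LinearMap.ker (φ.coprod L) := by
    refine Submodule.span_le.2 ?_
    rintro _ ⟨x, v, rfl⟩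
    rw [SetLike.mem_coe, LinearMap.mem_ker, LinearMap.coprod_apply]
    simp only
    rw [map_neg, hL1, hL2, add_neg_eq_zero, LinearMap.comp_apply, h, h, ← AlgRep.mul_act,
      ← AlgRep.mul_act, map_mul, mul_assoc, mul_assoc, ← mul_assoc _ (T.u (n + 1)), T.braid_down]
  let F := (T.pushRel ρ).liftQ (φ.coprod L) hle
  have hF : ∀ t, F ((T.pushRel ρ).mkQ t) = φ t.1 + L t.2 := fun t => rfl
  refine ⟨F, fun x t => ?_, fun t => ?_, fun v => ?_⟩
  · rw [hF, hF, map_add, h, hL1]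
  · simp only [hF]
    rw [map_zero, zero_add, map_add, map_add, hL1, hL2, LinearMap.comp_apply]
  · rw [hF, map_zero, add_zero]

theorem isHom_of_generators {Y' : Type w'} [AddCommGroup Y'] [Module k Y']
    {s : AlgRep k (A (n + 2)) Y} {s' : AlgRep k (A (n + 2)) Y'} {f : Y →ₗ[k] Y'}
    (h1 : ∀ x y, f (s (T.inc (n + 1) x) y) = s' (T.inc (n + 1) x) (f y))
    (h2 : ∀ y, f (s (T.u (n + 1)) y) = s' (T.u (n + 1)) (f y)) : AlgRep.IsHom s s' f := by
  intro a
  have ha : a ∈ Algebra.adjoin k (Set.range (T.inc (n + 1)) ∪ {T.u (n + 1)}) := by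
    rw [T.adjoin]; trivial
  induction ha using Algebra.adjoin_induction with
  | mem y hy =>
    rcases hy with ⟨a, rfl⟩ | rfl
    · exact h1 a
    · exact h2
  | algebraMap r => intro y; rw [AlgRep.algebraMap_act, AlgRep.algebraMap_act, map_smul]
  | add a b _ _ ha hb => intro y; rw [AlgRep.add_act, AlgRep.add_act, map_add, ha, hb]
  | mul a b _ _ ha hb => intro y; rw [AlgRep.mul_act, AlgRep.mul_act, ha, hb]

end Tower

/-! ### Globalisation as induction, and the exact sequence -/

namespace Tower

variable {k : Type u} [Field k] {A : ℕ → Type u} [∀ n, Ring (A n)] [∀ n, Algebra k (A n)] {d : k}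
variable {T : Tower k A d}
variable {V : Type w} [AddCommGroup V] [Module k V] {W : Type w'} [AddCommGroup W] [Module k W]
variable {Y : Type w''} [AddCommGroup Y] [Module k Y] {n : ℕ}

theorem zero_act_eq (T : Tower k A d) (b : A 0) : ∃ c : k, b = algebraMap k _ c ∧
    ∀ {X : Type w} [AddCommGroup X] [Module k X] (ρ : AlgRep k (A 0) X) v, ρ b v = c • v := by
  obtain ⟨c, rfl⟩ := T.scalar b
  exact ⟨c, rfl, fun ρ v => by rw [AlgRep.algebraMap_act]⟩

/-- The operator `x ⊗ v ↦ 1 ⊗ cap(x) v` makes `A 1 ⊗ V` a module over `A 2` in which `u` acts on `1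
⊗ v` as the scalar `d`; the universal property of the globalisation then applies. -/
theorem exists_baseHom (ρ : AlgRep k (A 0) V) :
    ∃ F : T.Glob ρ →ₗ[k] A 1 ⊗[k] V,
      (∀ x y, F (T.globAct ρ (T.inc 1 x) y) = AlgRep.free k (A 1) V x (F y)) ∧
      ∀ v, F (T.globIn ρ v) = 1 ⊗ₜ v := by
  let s : Module.End k (A 1 ⊗[k] V) :=
    TensorProduct.mk k (A 1) V 1 ∘ₗ TensorProduct.lid k V ∘ₗ LinearMap.rTensor V T.cap
  have hs : ∀ x v, s (x ⊗ₜ v) = 1 ⊗ₜ (T.cap x • v) := fun x v => by simp [s]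
  obtain ⟨Φ, h1, h2⟩ := T.exists_lift_one (AlgRep.free k (A 1) V) s (fun x => by
    refine TensorProduct.ext' fun y v => ?_
    simp only [Module.End.mul_apply, LinearMap.smul_apply, hs, map_smul, AlgRep.free_tmul,
      mul_one, TensorProduct.tmul_smul]
    rw [smul_comm])
  obtain ⟨F, hF1, hF2⟩ := T.exists_globLift ρ Φ (TensorProduct.mk k (A 1) V 1)
    (fun b v => by
      obtain ⟨c, rfl, hc⟩ := T.zero_act_eq b
      rw [hc, AlgHom.commutes, AlgRep.algebraMap_act, map_smul])
    (fun v => by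
      have h2' : Φ (T.u (0 + 1)) = s := h2
      rw [h2', TensorProduct.mk_apply, hs, T.cap_one, TensorProduct.tmul_smul])
  exact ⟨F, fun x y => by rw [hF1, h1], hF2⟩

theorem exists_ind_zero (ρ : AlgRep k (A 0) V) (s : AlgRep k (A 1) Y) (φ : V →ₗ[k] Y) :
    ∃ f : T.Glob ρ →ₗ[k] Y, (∀ x y, f (T.globAct ρ (T.inc 1 x) y) = s x (f y)) ∧
      ∀ v, f (T.globIn ρ v) = φ v := by
  obtain ⟨F, hF1, hF2⟩ := T.exists_baseHom ρ
  let L : A 1 ⊗[k] V →ₗ[k] Y := TensorProduct.lift ((LinearMap.lcomp k Y φ).comp s.toLinearMap)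
  have hL : ∀ a v, L (a ⊗ₜ v) = s a (φ v) := fun a v => by simp [L]
  refine ⟨L ∘ₗ F, fun x y => ?_, fun v => ?_⟩
  · rw [LinearMap.comp_apply, hF1, LinearMap.comp_apply]
    induction F y using TensorProduct.induction_on with
    | zero => simp
    | tmul a v => rw [AlgRep.free_tmul, hL, hL, AlgRep.mul_act]
    | add a b ha hb => rw [map_add, map_add, map_add, map_add, ha, hb]
  · rw [LinearMap.comp_apply, hF2, hL, AlgRep.one_act]

/-- Restricted to `A(n+2)`, the globalisation behaves like the module induced from `A(n+1)`. The
extension of `φ` goes through the pushout, which receives a map from `Glob ρ` by its action of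
`A(n+3)` and maps to `Y` by `exists_push_lift`. -/
theorem exists_ind_succ (ρ : AlgRep k (A (n + 1)) V) {e : T.Glob (T.res ρ) →ₗ[k] V}
    (he : ∀ x y, e (T.globAct (T.res ρ) (T.inc (n + 1) x) y) = ρ x (e y))
    (heg : ∀ v, e (T.globIn (T.res ρ) v) = v)
    (s : AlgRep k (A (n + 2)) Y) (φ : V →ₗ[k] Y)
    (h : ∀ b v, φ (ρ b v) = s (T.inc (n + 1) b) (φ v)) :
    ∃ f : T.Glob ρ →ₗ[k] Y, (∀ x y, f (T.globAct ρ (T.inc (n + 2) x) y) = s x (f y)) ∧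
      ∀ v, f (T.globIn ρ v) = φ v := by
  obtain ⟨Φ, h1, h2, h3⟩ := exists_pushAct ρ he heg
  obtain ⟨F, hF1, hF2⟩ := T.exists_globLift ρ Φ ((T.pushRel ρ).mkQ ∘ₗ LinearMap.inl k _ _)
    (fun b v => by simp only [LinearMap.comp_apply, h1, LinearMap.inl_apply, map_zero])
    (fun v => by
      simp only [LinearMap.comp_apply, h3, LinearMap.inl_apply, map_zero, add_zero]
      rw [← map_smul, Prod.smul_mk, smul_zero])
  obtain ⟨L, hL1, hL2, hL3⟩ := exists_push_lift ρ s φ h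
  have hL : AlgRep.IsHom (T.res Φ) s L := by
    refine isHom_of_generators (T := T) (fun x y => ?_) (fun y => ?_)
    · obtain ⟨t, rfl⟩ := (T.pushRel ρ).mkQ_surjective y
      rw [T.res_apply, ← T.inc2_apply, h1, hL1]
    · obtain ⟨t, rfl⟩ := (T.pushRel ρ).mkQ_surjective y
      rw [T.res_apply, h2, hL2]
  refine ⟨L ∘ₗ F, fun x y => ?_, fun v => ?_⟩
  · rw [LinearMap.comp_apply, hF1, ← T.res_apply, hL, LinearMap.comp_apply]
  · rw [LinearMap.comp_apply, hF2, LinearMap.comp_apply, LinearMap.inl_apply, hL3]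

variable (T) in
-- The recursion feeds on itself: the counit for one level defines the action of the last generator
-- on the pushout, and that action yields the extension property giving the counit one level higher.
theorem exists_resCounit : ∀ {n : ℕ} (ρ : AlgRep k (A (n + 1)) V),
    ∃ e : T.Glob (T.res ρ) →ₗ[k] V,
      (∀ x y, e (T.globAct (T.res ρ) (T.inc (n + 1) x) y) = ρ x (e y)) ∧
      ∀ v, e (T.globIn (T.res ρ) v) = v
  | 0, ρ => exists_ind_zero (T.res ρ) ρ LinearMap.id
  | n + 1, ρ => by
    obtain ⟨e, h1, h2⟩ := exists_resCounit (T.res ρ)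
    exact exists_ind_succ (T.res ρ) h1 h2 ρ LinearMap.id (fun _ _ => rfl)

/-- A linear retraction of `V → Glob V`, up to the factor `d`. -/
theorem exists_retraction (ρ : AlgRep k (A n) V) : ∃ E : T.Glob ρ →ₗ[k] V,
    (∀ b y, E (T.globAct ρ (T.inc2 n b) y) = ρ b (E y)) ∧ ∀ v, E (T.globIn ρ v) = d • v := by
  cases n with
  | zero =>
    obtain ⟨F, hF1, hF2⟩ := T.exists_baseHom ρ
    let L : A 1 ⊗[k] V →ₗ[k] V := TensorProduct.lid k V ∘ₗ LinearMap.rTensor V T.cap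
    refine ⟨L ∘ₗ F, fun b y => ?_, fun v => ?_⟩
    · obtain ⟨c, rfl, hc⟩ := T.zero_act_eq b
      rw [hc, AlgHom.commutes, AlgRep.algebraMap_act, map_smul]
    · simp [L, hF2, T.cap_one]
  | succ n =>
    obtain ⟨e, he, heg⟩ := T.exists_resCounit ρ
    obtain ⟨Φ, h1, h2, h3⟩ := exists_pushAct ρ he heg
    obtain ⟨F, hF1, hF2⟩ := T.exists_globLift ρ Φ ((T.pushRel ρ).mkQ ∘ₗ LinearMap.inl k _ _)
      (fun b v => by simp only [LinearMap.comp_apply, h1, LinearMap.inl_apply, map_zero])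
      (fun v => by
        simp only [LinearMap.comp_apply, h3, LinearMap.inl_apply, map_zero, add_zero]
        rw [← map_smul, Prod.smul_mk, smul_zero])
    -- The first coordinate of the operator by which `u(n+2)` acts on the pushout; it kills the
    -- relations for the same reason.
    let L : ((V × T.Glob (T.res ρ)) ⧸ T.pushRel ρ) →ₗ[k] V :=
      (T.pushRel ρ).liftQ ((d • LinearMap.id).coprod e) (by
        refine Submodule.span_le.2 ?_
        rintro _ ⟨x, v, rfl⟩
        rw [SetLike.mem_coe, LinearMap.mem_ker, LinearMap.coprod_apply]
        simp only [LinearMap.smul_apply, LinearMap.id_apply]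
        rw [map_neg, he, heg, add_neg_eq_zero, ← AlgRep.mul_act, mul_assoc, T.u_sq,
          mul_smul_comm, AlgRep.smul_act])
    have hL : ∀ t, L ((T.pushRel ρ).mkQ t) = d • t.1 + e t.2 := fun t => rfl
    refine ⟨L ∘ₗ F, fun b y => ?_, fun v => ?_⟩
    · rw [LinearMap.comp_apply, hF1, LinearMap.comp_apply]
      obtain ⟨t, ht⟩ := (T.pushRel ρ).mkQ_surjective (F y)
      rw [← ht, h1, hL, hL, he, map_add, map_smul]
    · rw [LinearMap.comp_apply, hF2, LinearMap.comp_apply, LinearMap.inl_apply, hL, map_zero,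
        add_zero]

theorem globIn_injective (ρ : AlgRep k (A n) V) : Function.Injective (T.globIn ρ) := by
  obtain ⟨E, -, hE⟩ := T.exists_retraction ρ
  intro v w h
  have := congrArg E h
  rw [hE, hE] at this
  exact smul_right_injective _ T.d_ne this

/-- Exactness at `V ⊕ Glob(res V)`. The map from `Glob ρ` to the pushout sends the sum to the class
of `(v, h)`, so nothing beyond `pushRel` is identified in `Glob ρ`. -/
theorem mem_pushRel_of_eq_zero (ρ : AlgRep k (A (n + 1)) V) {v : V} {h : T.Glob (T.res ρ)}
    (hvh : T.globIn ρ v + T.theta ρ h = 0) : (v, h) ∈ T.pushRel ρ := by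
  obtain ⟨e, he, heg⟩ := T.exists_resCounit ρ
  obtain ⟨Φ, h1, h2, h3⟩ := exists_pushAct ρ he heg
  obtain ⟨F, hF1, hF2⟩ := T.exists_globLift ρ Φ ((T.pushRel ρ).mkQ ∘ₗ LinearMap.inl k _ _)
    (fun b v => by simp only [LinearMap.comp_apply, h1, LinearMap.inl_apply, map_zero])
    (fun v => by
      simp only [LinearMap.comp_apply, h3, LinearMap.inl_apply, map_zero, add_zero]
      rw [← map_smul, Prod.smul_mk, smul_zero])
  have hr : AlgRep.IsHom (T.globAct (T.res ρ)) (T.res Φ)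
      ((T.pushRel ρ).mkQ ∘ₗ LinearMap.inr k _ _) := by
    refine isHom_of_generators (T := T) (fun x y => ?_) (fun y => ?_)
    · simp only [LinearMap.comp_apply, T.res_apply]
      rw [← T.inc2_apply, h1]
      simp
    · simp only [LinearMap.comp_apply, T.res_apply]
      rw [h2]
      simp
  have key : F (T.theta ρ h) = (T.pushRel ρ).mkQ (0, h) := by
    refine glob_ext (f := F ∘ₗ T.theta ρ) (s := T.res Φ) (fun a y => ?_) hr (fun v => ?_) h
    · rw [LinearMap.comp_apply, theta_act, hF1]; rfl
    · rw [LinearMap.comp_apply, theta_globIn, hF1, hF2, LinearMap.comp_apply, h2]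
      simp
  have := congrArg F hvh
  rw [map_add, key, hF2, map_zero, LinearMap.comp_apply, LinearMap.inl_apply, ← map_add,
    Prod.mk_add_mk, add_zero, zero_add] at this
  exact (Submodule.Quotient.mk_eq_zero _).1 this

/-- In `A(n+2) = A(n+1) + A(n+1) u A(n+1)` the first term preserves `1 ⊗ V`, and the second sends it
into the image of `theta`. -/
theorem exists_eq_add_theta (ρ : AlgRep k (A (n + 1)) V) (y : T.Glob ρ) :
    ∃ v h, y = T.globIn ρ v + T.theta ρ h := by
  suffices y ∈ LinearMap.range (T.globIn ρ) ⊔ LinearMap.range (T.theta ρ) by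
    obtain ⟨_, ⟨v, rfl⟩, _, ⟨h, rfl⟩, rfl⟩ := Submodule.mem_sup.1 this
    exact ⟨v, h, rfl⟩
  refine glob_induction (fun a v => ?_) y
  have ha := T.spanU_eq_top (T.exists_u_mul_u n) a
  obtain ⟨_, ⟨x, rfl⟩, t, ht, rfl⟩ := Submodule.mem_sup.1 ha
  rw [map_add, AlgRep.add_act]
  refine Submodule.add_mem_sup ⟨ρ x v, (T.globIn_act ρ x v).symm⟩ ?_
  clear ha
  induction ht using Submodule.span_induction with
  | mem t ht =>
    obtain ⟨a, b, rfl⟩ := ht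
    refine ⟨T.globAct (T.res ρ) (T.inc (n + 1) a) (T.globIn (T.res ρ) (ρ b v)), ?_⟩
    rw [theta_act, theta_globIn, ← globIn_act, ← AlgRep.mul_act, ← AlgRep.mul_act, T.inc2_apply,
      map_mul (T.inc (n + 2)), map_mul (T.inc (n + 2)), mul_assoc]
  | zero => rw [map_zero, AlgRep.zero_act]; exact Submodule.zero_mem _
  | add x y _ _ hx hy => rw [map_add, AlgRep.add_act]; exact Submodule.add_mem _ hx hy
  | smul c x _ hx => rw [map_smul, AlgRep.smul_act]; exact Submodule.smul_mem _ c hx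

/-! ### Localisation -/

/-- The image of the idempotent `ε`. -/
def Loc (T : Tower k A d) (ρ : AlgRep k (A (n + 2)) V) : Submodule k V :=
  LinearMap.range (ρ (T.u (n + 1)))

theorem mem_Loc {ρ : AlgRep k (A (n + 2)) V} {v : V} :
    v ∈ T.Loc ρ ↔ ρ (T.u (n + 1)) v = d • v := by
  constructor
  · rintro ⟨w, rfl⟩
    rw [← AlgRep.mul_act, T.u_sq, AlgRep.smul_act]
  · intro h
    exact ⟨d⁻¹ • v, by rw [map_smul, h, smul_smul, inv_mul_cancel₀ T.d_ne, one_smul]⟩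

theorem u_act_mem_Loc (ρ : AlgRep k (A (n + 2)) V) (v : V) : ρ (T.u (n + 1)) v ∈ T.Loc ρ :=
  ⟨v, rfl⟩

/-- The action of `A n` on the image of the idempotent `ε` of `A (n + 2)`. -/
def locAct (T : Tower k A d) (ρ : AlgRep k (A (n + 2)) V) : AlgRep k (A n) (T.Loc ρ) :=
  AlgRep.sub (T.res (T.res ρ)) (T.Loc ρ) (by
    rintro b _ ⟨v, rfl⟩
    refine ⟨ρ (T.inc2 n b) v, ?_⟩
    rw [T.res_apply, T.res_apply, ← T.inc2_apply, ← AlgRep.mul_act, ← AlgRep.mul_act, T.u_inc2])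

theorem coe_locAct (ρ : AlgRep k (A (n + 2)) V) (b : A n) (v : T.Loc ρ) :
    ((T.locAct ρ b v : T.Loc ρ) : V) = ρ (T.inc2 n b) v := rfl

theorem exists_counit (ρ : AlgRep k (A (n + 2)) V) : ∃ f : T.Glob (T.locAct ρ) →ₗ[k] V,
    AlgRep.IsHom (T.globAct (T.locAct ρ)) ρ f ∧ ∀ v, f (T.globIn (T.locAct ρ) v) = v :=
  T.exists_globLift (T.locAct ρ) ρ (T.Loc ρ).subtype (fun _ _ => rfl) (fun v => mem_Loc.1 v.2)

/-- The counit `A ε ⊗ ε V → V`. -/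
noncomputable def counit (T : Tower k A d) (ρ : AlgRep k (A (n + 2)) V) :
    T.Glob (T.locAct ρ) →ₗ[k] V := (T.exists_counit ρ).choose

theorem counit_isHom (ρ : AlgRep k (A (n + 2)) V) :
    AlgRep.IsHom (T.globAct (T.locAct ρ)) ρ (T.counit ρ) := (T.exists_counit ρ).choose_spec.1

theorem counit_globIn (ρ : AlgRep k (A (n + 2)) V) (v : T.Loc ρ) :
    T.counit ρ (T.globIn (T.locAct ρ) v) = v := (T.exists_counit ρ).choose_spec.2 v

/-- The map induced by an intertwining map on the images of `ε`. -/
def locMap (T : Tower k A d) {ρ : AlgRep k (A (n + 2)) V} {σ : AlgRep k (A (n + 2)) W}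
    {f : V →ₗ[k] W} (hf : AlgRep.IsHom ρ σ f) : T.Loc ρ →ₗ[k] T.Loc σ :=
  f.restrict (by rintro _ ⟨v, rfl⟩; exact ⟨f v, (hf _ v).symm⟩)

theorem coe_locMap {ρ : AlgRep k (A (n + 2)) V} {σ : AlgRep k (A (n + 2)) W}
    {f : V →ₗ[k] W} (hf : AlgRep.IsHom ρ σ f) (v : T.Loc ρ) : (T.locMap hf v : W) = f v := rfl

theorem locMap_isHom {ρ : AlgRep k (A (n + 2)) V} {σ : AlgRep k (A (n + 2)) W}
    {f : V →ₗ[k] W} (hf : AlgRep.IsHom ρ σ f) :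
    AlgRep.IsHom (T.locAct ρ) (T.locAct σ) (T.locMap hf) := fun _ _ => Subtype.ext (hf _ _)

theorem locMap_surjective {ρ : AlgRep k (A (n + 2)) V} {σ : AlgRep k (A (n + 2)) W}
    {f : V →ₗ[k] W} (hf : AlgRep.IsHom ρ σ f) (h : Function.Surjective f) :
    Function.Surjective (T.locMap hf) := by
  rintro ⟨_, w, rfl⟩
  obtain ⟨v, rfl⟩ := h w
  exact ⟨⟨_, v, rfl⟩, Subtype.ext (hf _ v)⟩

theorem locMap_injective {ρ : AlgRep k (A (n + 2)) V} {σ : AlgRep k (A (n + 2)) W}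
    {f : V →ₗ[k] W} (hf : AlgRep.IsHom ρ σ f) (h : Function.Injective f) :
    Function.Injective (T.locMap hf) :=
  fun _ _ hvw => Subtype.ext (h (congrArg Subtype.val hvw))

theorem locMap_exact {ρ : AlgRep k (A (n + 2)) V} {σ : AlgRep k (A (n + 2)) W}
    {τ : AlgRep k (A (n + 2)) Y} {f : V →ₗ[k] W} (hf : AlgRep.IsHom ρ σ f) {g : W →ₗ[k] Y}
    (hg : AlgRep.IsHom σ τ g) (hi : Function.Injective f)
    (h : ∀ w, g w = 0 → ∃ v, f v = w) (w : T.Loc σ) (hw : T.locMap hg w = 0) :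
    ∃ v, T.locMap hf v = w := by
  obtain ⟨v, hv⟩ := h w (congrArg Subtype.val hw)
  refine ⟨⟨v, mem_Loc.2 (hi ?_)⟩, Subtype.ext hv⟩
  rw [hf, map_smul, hv, mem_Loc.1 w.2]

theorem counit_naturality {ρ : AlgRep k (A (n + 2)) V} {σ : AlgRep k (A (n + 2)) W}
    {f : V →ₗ[k] W} (hf : AlgRep.IsHom ρ σ f) (y : T.Glob (T.locAct ρ)) :
    T.counit σ (T.globMap (locMap_isHom hf) y) = f (T.counit ρ y) := by
  refine glob_ext (f := T.counit σ ∘ₗ T.globMap (locMap_isHom hf)) (f' := f ∘ₗ T.counit ρ)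
    (s := σ) (fun a y => ?_) (fun a y => ?_) (fun v => ?_) y
  · simp only [LinearMap.comp_apply]
    rw [globMap_isHom, counit_isHom]
  · simp only [LinearMap.comp_apply]
    rw [counit_isHom, hf]
  · simp only [LinearMap.comp_apply]
    rw [globMap_globIn, counit_globIn, counit_globIn, coe_locMap]

end Tower

namespace Tower

variable {k : Type u} [Field k] {A : ℕ → Type u} [∀ n, Ring (A n)] [∀ n, Algebra k (A n)] {d : k}
variable {T : Tower k A d}
variable {V : Type w} [AddCommGroup V] [Module k V] {W : Type w'} [AddCommGroup W] [Module k W]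
variable {Y : Type w''} [AddCommGroup Y] [Module k Y] {n : ℕ}

/-! ### Acyclic representations -/

/-- The counit `A ε ⊗ ε V → V` is injective; no condition for `A 0` and `A 1`. -/
def CounitInj (T : Tower k A d) : ∀ {n : ℕ}, AlgRep k (A n) V → Prop
  | 0, _ => True
  | 1, _ => True
  | _ + 2, ρ => Function.Injective (T.counit ρ)

/-- The counit is injective for the representation and for all its restrictions. -/
def Acyclic (T : Tower k A d) : ∀ {n : ℕ}, AlgRep k (A n) V → Prop
  | 0, _ => True
  | _ + 1, ρ => T.CounitInj ρ ∧ T.Acyclic (T.res ρ)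

/-- An injection whose image contains `u W` identifies `εV` with `εW`; naturality of the counit
transfers injectivity. -/
theorem counit_injective_of_sub {ρ : AlgRep k (A (n + 2)) V} {σ : AlgRep k (A (n + 2)) W}
    {f : V →ₗ[k] W} (hf : AlgRep.IsHom ρ σ f) (hi : Function.Injective f)
    (hu : ∀ w, ∃ v, f v = σ (T.u (n + 1)) w) (h : Function.Injective (T.counit ρ)) :
    Function.Injective (T.counit σ) := by
  have hs : Function.Surjective (T.locMap hf) := by
    intro w
    obtain ⟨v, hv⟩ := hu w
    have hw := mem_Loc.1 w.2
    refine ⟨⟨d⁻¹ • v, mem_Loc.2 (hi ?_)⟩, Subtype.ext ?_⟩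
    · rw [hf, map_smul, map_smul, map_smul, hv, hw, map_smul, hw, smul_comm, map_smul, hv, hw]
    · rw [coe_locMap, map_smul, hv, hw, smul_smul, inv_mul_cancel₀ T.d_ne, one_smul]
  refine (injective_iff_map_eq_zero _).2 fun y hy => ?_
  obtain ⟨x, rfl⟩ := globMap_surjective (locMap_isHom hf) hs y
  rw [counit_naturality] at hy
  rw [h (hi (by rw [hy, map_zero, map_zero]) : T.counit ρ x = T.counit ρ 0), map_zero]

/-- The condition that the image contain `u W` descends to restrictions: by the braid relation `u(n)
w = u(n) u(n+1) u(n) w`, and `u(n+1) u(n) w` is already in the image. -/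
theorem acyclic_of_sub : ∀ {n : ℕ} {ρ : AlgRep k (A (n + 1)) V} {σ : AlgRep k (A (n + 1)) W}
    {f : V →ₗ[k] W}, AlgRep.IsHom ρ σ f → Function.Injective f →
    (∀ w, ∃ v, f v = σ (T.u n) w) → T.Acyclic ρ → T.Acyclic σ
  | 0, _, _, _, _, _, _, _ => ⟨trivial, trivial⟩
  | n + 1, ρ, σ, f, hf, hi, hu, h => by
    refine ⟨counit_injective_of_sub hf hi hu h.1, ?_⟩
    refine acyclic_of_sub (ρ := T.res ρ) (fun a v => hf _ v) hi (fun w => ?_) h.2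
    obtain ⟨v, hv⟩ := hu (σ (T.inc (n + 1) (T.u n)) w)
    refine ⟨ρ (T.inc (n + 1) (T.u n)) v, ?_⟩
    rw [hf, hv, ← AlgRep.mul_act, ← AlgRep.mul_act, T.braid_down, T.res_apply]

theorem acyclic_of_subsingleton [Subsingleton V] : ∀ {n : ℕ} (ρ : AlgRep k (A n) V), T.Acyclic ρ
  | 0, _ => trivial
  | 1, _ => ⟨trivial, trivial⟩
  | n + 2, ρ => by
    refine ⟨?_, acyclic_of_subsingleton _⟩
    have : Subsingleton (T.Glob (T.locAct ρ)) := by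
      refine subsingleton_of_forall_eq 0 fun y => ?_
      refine glob_induction' (X := ⊥) (fun a v => ?_) y
      rw [Subsingleton.elim v 0, map_zero, map_zero]
      rfl
    exact Function.injective_of_subsingleton _

/-- The zero subrepresentation then contains `u V`, so `acyclic_of_sub` applies to it. -/
theorem acyclic_of_u_act {ρ : AlgRep k (A (n + 1)) V} (h : ∀ v, ρ (T.u n) v = 0) :
    T.Acyclic ρ :=
  acyclic_of_sub (f := (⊥ : Submodule k V).subtype)
    (ρ := ρ.sub ⊥ (by rintro a v hv; rw [(Submodule.mem_bot k).1 hv, map_zero]; rfl))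
    (fun _ _ => rfl) Subtype.val_injective (fun w => ⟨0, (h w).symm⟩) (acyclic_of_subsingleton _)

theorem exists_kappa (ρ : AlgRep k (A (n + 2)) V) :
    ∃ f : T.Glob (T.locAct ρ) →ₗ[k] T.Glob (T.res ρ),
      AlgRep.IsHom (T.globAct (T.locAct ρ)) (T.res (T.globAct (T.res ρ))) f ∧
      ∀ v, f (T.globIn _ v) = T.globAct (T.res ρ) (T.inc (n + 2) (T.u (n + 1)))
        (T.globIn (T.res ρ) v) := by
  refine T.exists_globLift (T.locAct ρ) (T.res (T.globAct (T.res ρ)))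
    ((T.globAct (T.res ρ) (T.inc (n + 2) (T.u (n + 1)))).comp
      ((T.globIn (T.res ρ)).comp (T.Loc ρ).subtype)) (fun b v => ?_) (fun v => ?_)
  · simp only [LinearMap.comp_apply, T.res_apply, Submodule.subtype_apply, coe_locAct]
    rw [T.inc2_apply, ← T.res_apply ρ, ← globIn_act, ← AlgRep.mul_act, ← AlgRep.mul_act,
      T.inc2_apply (n + 1), ← map_mul, ← map_mul, T.u_comm]
  · simp only [LinearMap.comp_apply, T.res_apply, Submodule.subtype_apply]
    rw [← AlgRep.mul_act, ← map_mul, T.u_sq, map_smul, AlgRep.smul_act]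

/-- The map `Glob (ε V) → Glob (res V)`, `v ↦ u v`. -/
noncomputable def kappa (T : Tower k A d) (ρ : AlgRep k (A (n + 2)) V) :
    T.Glob (T.locAct ρ) →ₗ[k] T.Glob (T.res ρ) := (T.exists_kappa ρ).choose

theorem kappa_act (ρ : AlgRep k (A (n + 2)) V) (a : A (n + 2)) (y : T.Glob (T.locAct ρ)) :
    T.kappa ρ (T.globAct _ a y) = T.globAct (T.res ρ) (T.inc (n + 2) a) (T.kappa ρ y) :=
  (T.exists_kappa ρ).choose_spec.1 a y

theorem kappa_globIn (ρ : AlgRep k (A (n + 2)) V) (v : T.Loc ρ) :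
    T.kappa ρ (T.globIn _ v) = T.globAct (T.res ρ) (T.inc (n + 2) (T.u (n + 1)))
      (T.globIn (T.res ρ) v) :=
  (T.exists_kappa ρ).choose_spec.2 v

/-- The generator attached to `x` and `v` comes from `x ⊗ u v` in `Glob(εV)`. This puts `pushRel`
inside the image of the first map of the exact sequence. -/
theorem exists_of_mem_pushRel {ρ : AlgRep k (A (n + 2)) V} {t : V × T.Glob (T.res ρ)}
    (ht : t ∈ T.pushRel ρ) : ∃ z, t = (T.counit ρ z, - T.kappa ρ z) := by
  suffices t ∈ LinearMap.range (LinearMap.prod (T.counit ρ) (- T.kappa ρ)) by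
    obtain ⟨z, rfl⟩ := this
    exact ⟨z, rfl⟩
  refine (Submodule.span_le.2 ?_ : T.pushRel ρ ≤ _) ht
  rintro _ ⟨x, v, rfl⟩
  refine ⟨T.globAct _ x (T.globIn _ ⟨_, u_act_mem_Loc ρ v⟩), ?_⟩
  rw [LinearMap.prod_apply, Function.prod_apply, LinearMap.neg_apply, counit_isHom, counit_globIn, kappa_act,
    kappa_globIn, map_mul (T.inc (n + 1 + 1)), AlgRep.mul_act, AlgRep.mul_act]

/-- The exact sequence is a complex. On `1 ⊗ v` with `v` in `εV` one writes `v = d⁻¹ u v`, and the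
braid relation removes the extra generator. -/
theorem theta_kappa (ρ : AlgRep k (A (n + 2)) V) (z : T.Glob (T.locAct ρ)) :
    T.theta ρ (T.kappa ρ z) = T.globIn ρ (T.counit ρ z) := by
  refine glob_ext (f := T.theta ρ ∘ₗ T.kappa ρ) (f' := T.globIn ρ ∘ₗ T.counit ρ)
    (s := T.res (T.res (T.globAct ρ))) (fun a y => ?_) (fun a y => ?_) (fun v => ?_) z
  · simp only [LinearMap.comp_apply, T.res_apply, kappa_act, theta_act]
  · simp only [LinearMap.comp_apply, T.res_apply]
    rw [counit_isHom, ← globIn_act, T.inc2_apply]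
  · simp only [LinearMap.comp_apply]
    have h : T.globIn ρ (v : V) = d⁻¹ • T.globAct ρ (T.inc2 (n + 2) (T.u (n + 1)))
        (T.globIn ρ v) := by
      rw [globIn_act, mem_Loc.1 v.2, map_smul, smul_smul, inv_mul_cancel₀ T.d_ne, one_smul]
    rw [kappa_globIn, theta_act, theta_globIn, counit_globIn]
    rw [h, map_smul, map_smul, ← AlgRep.mul_act, ← AlgRep.mul_act, T.inc2_apply, ← map_mul,
      ← map_mul, T.braid_down]

/-- By the exact sequence an element of the kernel is, up to sign, `kappa z` with `z` in the kernel
of the counit; at the bottom there are no relations at all. -/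
theorem theta_injective {ρ : AlgRep k (A (n + 1)) V} (hρ : T.CounitInj ρ) :
    Function.Injective (T.theta ρ) := by
  refine (injective_iff_map_eq_zero _).2 fun h hh => ?_
  have := mem_pushRel_of_eq_zero ρ (v := 0) (h := h) (by rw [hh, map_zero, add_zero])
  rcases n with _ | n
  · exact congrArg Prod.snd (pushRel_eq_bot this)
  · obtain ⟨z, hz⟩ := exists_of_mem_pushRel this
    obtain ⟨h1, h2⟩ := Prod.ext_iff.1 hz
    simp only at h1 h2
    have hz0 : z = 0 := hρ (by rw [← h1, map_zero])
    rw [h2, hz0, map_zero, neg_zero]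

theorem exists_locGlob (T : Tower k A d) (ρ : AlgRep k (A n) V) :
    ∃ f : V →ₗ[k] T.Loc (T.globAct ρ), AlgRep.IsHom ρ (T.locAct (T.globAct ρ)) f ∧
      Function.Injective f ∧ Function.Surjective f ∧ ∀ v, (f v : T.Glob ρ) = T.globIn ρ v := by
  refine ⟨(T.globIn ρ).codRestrict _ (fun v => mem_Loc.2 (globIn_u T ρ v)),
    fun b v => Subtype.ext (globIn_act T ρ b v).symm,
    fun v w h => T.globIn_injective ρ (congrArg Subtype.val h), ?_, fun v => rfl⟩
  rintro ⟨_, y, rfl⟩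
  obtain ⟨v, hv⟩ := glob_u_mem y
  exact ⟨v, Subtype.ext hv.symm⟩

theorem counit_globAct_injective (ρ : AlgRep k (A n) V) :
    Function.Injective (T.counit (T.globAct ρ)) := by
  obtain ⟨f, hf, -, hs, hfv⟩ := T.exists_locGlob ρ
  refine (injective_iff_map_eq_zero _).2 fun y hy => ?_
  obtain ⟨x, rfl⟩ := globMap_surjective hf hs y
  have : T.counit (T.globAct ρ) (T.globMap hf x) = x := by
    refine glob_ext (f := T.counit (T.globAct ρ) ∘ₗ T.globMap hf) (f' := LinearMap.id)
      (s := T.globAct ρ) (fun a y => ?_) (fun _ _ => rfl) (fun v => ?_) x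
    · rw [LinearMap.comp_apply, globMap_isHom, counit_isHom, LinearMap.comp_apply]
    · rw [LinearMap.comp_apply, globMap_globIn, counit_globIn, hfv]; rfl
  rw [← this, hy, map_zero]

/-- The restriction of `Glob V` to `A(n+2)` contains `Glob(res V)` through `theta`, and `u(n+1)`
maps everything into it, because `u(n+1)` sends `1 ⊗ v` to `theta` of `1 ⊗ v`. So `acyclic_of_sub`
reduces the claim to `res V`. -/
theorem acyclic_globAct : ∀ {n : ℕ} {ρ : AlgRep k (A n) V}, T.Acyclic ρ →
    T.Acyclic (T.globAct ρ)
  | 0, ρ, _ => ⟨counit_globAct_injective ρ, trivial, trivial⟩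
  | n + 1, ρ, h => by
    refine ⟨counit_globAct_injective ρ, ?_⟩
    refine acyclic_of_sub (f := T.theta ρ) (fun a y => theta_act ρ a y) (theta_injective h.1)
      (fun y => ?_) (acyclic_globAct h.2)
    obtain ⟨v, h, rfl⟩ := exists_eq_add_theta ρ y
    exact ⟨T.globIn (T.res ρ) v + T.globAct _ (T.u (n + 1)) h, by
      rw [map_add, theta_globIn, theta_act, map_add]; rfl⟩

theorem theta_naturality {ρ : AlgRep k (A (n + 1)) V} {σ : AlgRep k (A (n + 1)) W}
    {f : V →ₗ[k] W} (hf : AlgRep.IsHom ρ σ f) (hf' : AlgRep.IsHom (T.res ρ) (T.res σ) f)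
    (y : T.Glob (T.res ρ)) : T.theta σ (T.globMap hf' y) = T.globMap hf (T.theta ρ y) := by
  refine glob_ext (f := T.theta σ ∘ₗ T.globMap hf') (f' := T.globMap hf ∘ₗ T.theta ρ)
    (s := T.res (T.globAct σ)) (fun a y => ?_) (fun a y => ?_) (fun v => ?_) y
  · simp only [LinearMap.comp_apply]
    rw [globMap_isHom, theta_act, T.res_apply]
  · simp only [LinearMap.comp_apply]
    rw [theta_act, globMap_isHom, T.res_apply]
  · simp only [LinearMap.comp_apply]
    rw [globMap_globIn, theta_globIn, theta_globIn, globMap_isHom, globMap_globIn]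

theorem kappa_naturality {ρ : AlgRep k (A (n + 2)) V} {σ : AlgRep k (A (n + 2)) W}
    {f : V →ₗ[k] W} (hf : AlgRep.IsHom ρ σ f) (hf' : AlgRep.IsHom (T.res ρ) (T.res σ) f)
    (y : T.Glob (T.locAct ρ)) :
    T.kappa σ (T.globMap (locMap_isHom hf) y) = T.globMap hf' (T.kappa ρ y) := by
  refine glob_ext (f := T.kappa σ ∘ₗ T.globMap (locMap_isHom hf))
    (f' := T.globMap hf' ∘ₗ T.kappa ρ)
    (s := T.res (T.globAct (T.res σ))) (fun a y => ?_) (fun a y => ?_) (fun v => ?_) y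
  · simp only [LinearMap.comp_apply]
    rw [globMap_isHom, kappa_act, T.res_apply]
  · simp only [LinearMap.comp_apply]
    rw [kappa_act, globMap_isHom, T.res_apply]
  · simp only [LinearMap.comp_apply]
    rw [globMap_globIn, kappa_globIn, kappa_globIn, globMap_isHom, globMap_globIn, coe_locMap]

/-- Globalisation preserves injectivity of maps with acyclic cokernel. -/
theorem globMap_injective : ∀ {n : ℕ} {ρ : AlgRep k (A n) V} {σ : AlgRep k (A n) W}
    {τ : AlgRep k (A n) Y} {f : V →ₗ[k] W} (hf : AlgRep.IsHom ρ σ f) {g : W →ₗ[k] Y}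
    (_ : AlgRep.IsHom σ τ g) (_ : Function.Injective f) (_ : Function.Surjective g)
    (_ : ∀ v, g (f v) = 0) (_ : ∀ w, g w = 0 → ∃ v, f v = w) (_ : T.Acyclic τ),
    Function.Injective (T.globMap hf)
  | 0, ρ, σ, τ, f, hf, g, hg, hi, hs, h0, he, hτ => by
    -- `A 0` consists of scalars, so a linear retraction is automatically equivariant and can be
    -- globalised.
    obtain ⟨r, hr⟩ := f.exists_leftInverse_of_injective (LinearMap.ker_eq_bot.2 hi)
    have hr' : AlgRep.IsHom σ ρ r := fun b w => by
      obtain ⟨c, rfl, -⟩ := zero_act_eq.{u, u} T b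
      rw [AlgRep.algebraMap_act, AlgRep.algebraMap_act, map_smul]
    refine Function.LeftInverse.injective (g := T.globMap hr') fun y => ?_
    have hid : AlgRep.IsHom ρ ρ LinearMap.id := fun _ _ => rfl
    rw [globMap_comp hf hr' hid (fun v => LinearMap.congr_fun hr v), globMap_id hid (fun _ => rfl)]
  | n + 1, ρ, σ, τ, f, hf, g, hg, hi, hs, h0, he, hτ => by
    have hf' : AlgRep.IsHom (T.res ρ) (T.res σ) f := fun _ _ => hf _ _
    have hg' : AlgRep.IsHom (T.res σ) (T.res τ) g := fun _ _ => hg _ _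
    have ih := globMap_injective hf' hg' hi hs h0 he hτ.2
    refine (injective_iff_map_eq_zero _).2 fun y hy => ?_
    obtain ⟨v, h, rfl⟩ := exists_eq_add_theta ρ y
    rw [map_add, globMap_globIn, ← theta_naturality hf hf'] at hy
    have hmem := mem_pushRel_of_eq_zero σ hy
    rcases n with _ | n
    · obtain ⟨h1, h2⟩ := Prod.ext_iff.1 (pushRel_eq_bot hmem)
      have hv : v = 0 := hi (h1.trans (map_zero f).symm)
      have hh : h = 0 := ih (h2.trans (map_zero _).symm)
      rw [hv, hh, map_zero, map_zero, add_zero]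
    · obtain ⟨z, hz⟩ := exists_of_mem_pushRel hmem
      obtain ⟨h1, h2⟩ := Prod.ext_iff.1 hz
      simp only at h1 h2
      -- Acyclicity of the cokernel enters here: the image of `z` in `Glob(εY)` vanishes because its
      -- counit does. By right exactness `z` then comes from `Glob(εV)`, and the induction
      -- hypothesis identifies both components of the preimage.
      have hz0 : T.globMap (locMap_isHom hg) z = 0 := hτ.1 (by
        rw [counit_naturality, ← h1, h0, map_zero])
      obtain ⟨x, rfl⟩ := exists_of_globMap_eq_zero (locMap_isHom hf) (locMap_isHom hg)
        (locMap_surjective hg hs) (locMap_exact hf hg hi he) hz0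
      rw [counit_naturality] at h1
      rw [kappa_naturality hf hf', ← map_neg] at h2
      rw [hi h1, ih h2, map_neg, theta_kappa, add_neg_cancel]

end Tower

/-! ### Simple modules and their labels -/

namespace AlgRep

variable {k : Type u} [Field k] {R : Type v} [Ring R] [Algebra k R]
variable {V : Type w} [AddCommGroup V] [Module k V] {W : Type w'} [AddCommGroup W] [Module k W]

/-- Irreducible representations. -/
def IsSimple (ρ : AlgRep k R V) : Prop := Nontrivial V ∧ ∀ x, x ≠ 0 → ∀ y, ∃ a, ρ a x = y

theorem IsHom.surjective {ρ : AlgRep k R V} {σ : AlgRep k R W} {f : V →ₗ[k] W}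
    (hf : IsHom ρ σ f) (hσ : σ.IsSimple) {v : V} (hv : f v ≠ 0) : Function.Surjective f := by
  intro w
  obtain ⟨a, rfl⟩ := hσ.2 _ hv w
  exact ⟨ρ a v, hf a v⟩

end AlgRep

/-- Labels for the simple modules of the algebras of a tower. A label `l` of level `n` which is not
`Top` comes from level `n - 2`. The simple module with label `l` is the one which is killed by
`y n l` and `z n l`, but not by `s n l`. -/
structure Labels {k : Type u} [Field k] {A : ℕ → Type u} [∀ n, Ring (A n)]
    [∀ n, Algebra k (A n)] {d : k} (T : Tower k A d) (Λ : Type) where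
  IsWeight : ℕ → Λ → Prop
  Top : ℕ → Λ → Prop
  le : Λ → Λ → Prop
  s : ∀ n, Λ → A n
  y : ∀ n, Λ → A n
  z : ∀ n, Λ → A n
  isWeight_zero : ∀ l, IsWeight 0 l ↔ Top 0 l
  isWeight_one : ∀ l, IsWeight 1 l ↔ Top 1 l
  isWeight_succ : ∀ n l, IsWeight (n + 2) l ↔ IsWeight n l ∨ Top (n + 2) l
  not_top : ∀ n l, IsWeight n l → ¬ Top (n + 2) l
  s_top : ∀ n l, Top n l → s n l = 1
  s_succ : ∀ n l, IsWeight n l → s (n + 2) l = T.u (n + 1) * T.inc2 n (s n l)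
  y_zero : ∀ l, Top 0 l → y 0 l = 0
  y_top : ∀ n l, Top (n + 1) l → y (n + 1) l = T.u n
  y_succ : ∀ n l, IsWeight n l → y (n + 2) l = T.u (n + 1) * T.inc2 n (y n l)
  z_succ : ∀ n l, IsWeight n l → z (n + 2) l = T.u (n + 1) * T.inc2 n (z n l)
  z_sq : ∀ n l, Top n l → ∃ c : k, c ≠ 0 ∧ z n l * z n l = c • z n l
  -- At a top label `z` is central modulo the ideal of `y`, and modulo the ideal of both the algebra
  -- consists of scalars: a top label stands for a character.
  z_comm : ∀ n l, Top n l → ∀ a, a * z n l - z n l * a ∈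
    Submodule.span k {t | ∃ b c, t = b * y n l * c}
  scalar : ∀ n l, Top n l → ∀ a, ∃ c, a - algebraMap k (A n) c ∈
    Submodule.span k {t | ∃ b c, t = b * y n l * c ∨ t = b * z n l * c}
  exists_top_zero : ∀ (L : Type u) [AddCommGroup L] [Module k L] (ρ : AlgRep k (A 0) L),
    ρ.IsSimple → ∃ l, Top 0 l ∧ ∀ v, ρ (z 0 l) v = 0
  exists_top : ∀ (n : ℕ) (L : Type u) [AddCommGroup L] [Module k L] (ρ : AlgRep k (A (n + 1)) L),
    ρ.IsSimple → (∀ v, ρ (T.u n) v = 0) → ∃ l, Top (n + 1) l ∧ ∀ v, ρ (z (n + 1) l) v = 0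
  top_unique : ∀ n l m, Top n l → Top n m → l ≠ m → ∃ a b, a * z n l + b * z n m = 1
  le_refl : ∀ l, le l l
  top_le : ∀ n l m, IsWeight n l → Top (n + 2) m → le m l
  eq_of_le_top : ∀ n l m, Top n l → IsWeight n m → le m l → m = l

namespace Labels

variable {k : Type u} [Field k] {A : ℕ → Type u} [∀ n, Ring (A n)] [∀ n, Algebra k (A n)] {d : k}
variable {T : Tower k A d} {Λ : Type} (S : Labels T Λ)
variable {V : Type w} [AddCommGroup V] [Module k V] {W : Type w'} [AddCommGroup W] [Module k W]
variable {n : ℕ} {l m : Λ}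

open Tower

/-- The elements `y n l` and `z n l` act as zero. -/
def Kills (n : ℕ) (l : Λ) (ρ : AlgRep k (A n) V) : Prop :=
  ∀ v, ρ (S.y n l) v = 0 ∧ ρ (S.z n l) v = 0

/-- The irreducible representation with label `l`. -/
def IsL (n : ℕ) (l : Λ) (ρ : AlgRep k (A n) V) : Prop :=
  S.IsWeight n l ∧ ρ.IsSimple ∧ (∃ v, ρ (S.s n l) v ≠ 0) ∧ S.Kills n l ρ

variable {S}

theorem isWeight_of_top (h : S.Top n l) : S.IsWeight n l := by
  rcases n with _ | _ | n
  · exact (S.isWeight_zero l).2 h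
  · exact (S.isWeight_one l).2 h
  · exact (S.isWeight_succ n l).2 (Or.inr h)

/-- The recursions for `y` and `z` carry a factor `u`, so for an old label both elements see only
the module `εV`. -/
theorem kills_succ (h : S.IsWeight n l) (ρ : AlgRep k (A (n + 2)) V) :
    S.Kills (n + 2) l ρ ↔ S.Kills n l (T.locAct ρ) := by
  unfold Kills
  rw [S.y_succ n l h, S.z_succ n l h, T.u_inc2, T.u_inc2]
  simp only [AlgRep.mul_act]
  constructor
  · rintro h ⟨_, v, rfl⟩
    exact ⟨Subtype.ext (h v).1, Subtype.ext (h v).2⟩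
  · intro h v
    exact ⟨congrArg Subtype.val (h ⟨_, v, rfl⟩).1, congrArg Subtype.val (h ⟨_, v, rfl⟩).2⟩

theorem s_succ_act_ne (h : S.IsWeight n l) (ρ : AlgRep k (A (n + 2)) V) :
    (∃ v, ρ (S.s (n + 2) l) v ≠ 0) ↔ ∃ v, T.locAct ρ (S.s n l) v ≠ 0 := by
  rw [S.s_succ n l h, T.u_inc2]
  simp only [AlgRep.mul_act]
  constructor
  · rintro ⟨v, hv⟩
    exact ⟨⟨_, v, rfl⟩, fun h => hv (congrArg Subtype.val h)⟩
  · rintro ⟨⟨_, v, rfl⟩, hv⟩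
    exact ⟨v, fun h => hv (Subtype.ext h)⟩

theorem isSimple_locAct {ρ : AlgRep k (A (n + 2)) V} (h : ρ.IsSimple)
    (hu : ∃ v, ρ (T.u (n + 1)) v ≠ 0) : (T.locAct ρ).IsSimple := by
  constructor
  · obtain ⟨v, hv⟩ := hu
    exact ⟨⟨_, v, rfl⟩, 0, fun h => hv (congrArg Subtype.val h)⟩
  · intro x hx y
    obtain ⟨a, ha⟩ := h.2 x (fun h => hx (Subtype.ext h)) y
    obtain ⟨b, hb⟩ := T.exists_u_mul_mul_u n a
    refine ⟨d⁻¹ • b, Subtype.ext ?_⟩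
    have h1 := congrArg (fun a => ρ a (x : V)) hb
    simp only [AlgRep.mul_act, mem_Loc.1 x.2, map_smul] at h1
    rw [ha, mem_Loc.1 y.2] at h1
    rw [coe_locAct, map_smul, AlgRep.smul_act, ← smul_right_injective _ T.d_ne h1, smul_smul,
      inv_mul_cancel₀ T.d_ne, one_smul]

theorem u_act_of_top (hl : S.Top (n + 1) l) {ρ : AlgRep k (A (n + 1)) V}
    (h : S.Kills (n + 1) l ρ) (v : V) : ρ (T.u n) v = 0 := by
  rw [← S.y_top n l hl]
  exact (h v).1

/-- If `εL` is non-zero it is simple and the label comes from two levels below; if it is zero, `u`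
kills `L` and the label is a top label. -/
theorem exists_isL : ∀ (n : ℕ) {L : Type u} [AddCommGroup L] [Module k L]
    {ρ : AlgRep k (A n) L}, ρ.IsSimple → ∃ l, S.IsL n l ρ
  | 0, L, _, _, ρ, h => by
    obtain ⟨l, hl, hz⟩ := S.exists_top_zero L ρ h
    have := h.1
    obtain ⟨v, hv⟩ := exists_ne (0 : L)
    exact ⟨l, isWeight_of_top hl, h, ⟨v, by rwa [S.s_top _ _ hl, AlgRep.one_act]⟩,
      fun v => ⟨by rw [S.y_zero l hl, AlgRep.zero_act], hz v⟩⟩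
  | 1, L, _, _, ρ, h => by
    obtain ⟨l, hl, hz⟩ := S.exists_top 0 L ρ h (fun v => by rw [T.u_zero, AlgRep.zero_act])
    have := h.1
    obtain ⟨v, hv⟩ := exists_ne (0 : L)
    exact ⟨l, isWeight_of_top hl, h, ⟨v, by rwa [S.s_top _ _ hl, AlgRep.one_act]⟩,
      fun v => ⟨by rw [S.y_top _ l hl, T.u_zero, AlgRep.zero_act], hz v⟩⟩
  | n + 2, L, _, _, ρ, h => by
    by_cases hu : ∃ v, ρ (T.u (n + 1)) v ≠ 0
    · obtain ⟨l, hl, -, hs, hk⟩ := exists_isL n (isSimple_locAct h hu)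
      exact ⟨l, (S.isWeight_succ n l).2 (Or.inl hl), h, (s_succ_act_ne hl ρ).2 hs,
        (kills_succ hl ρ).2 hk⟩
    · push Not at hu
      obtain ⟨l, hl, hz⟩ := S.exists_top (n + 1) L ρ h hu
      have := h.1
      obtain ⟨v, hv⟩ := exists_ne (0 : L)
      exact ⟨l, isWeight_of_top hl, h, ⟨v, by rwa [S.s_top _ _ hl, AlgRep.one_act]⟩,
        fun v => ⟨by rw [S.y_top _ l hl, hu], hz v⟩⟩

theorem u_act_ne (h : S.IsWeight n l) {ρ : AlgRep k (A (n + 2)) V}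
    (hs : ∃ v, ρ (S.s (n + 2) l) v ≠ 0) : ∃ v, ρ (T.u (n + 1)) v ≠ 0 := by
  obtain ⟨v, hv⟩ := hs
  rw [S.s_succ n l h, AlgRep.mul_act] at hv
  exact ⟨_, hv⟩

theorem IsL.loc (h : S.IsWeight n l) {ρ : AlgRep k (A (n + 2)) V} (hρ : S.IsL (n + 2) l ρ) :
    S.IsL n l (T.locAct ρ) :=
  ⟨h, isSimple_locAct hρ.2.1 (u_act_ne h hρ.2.2.1), (s_succ_act_ne h ρ).1 hρ.2.2.1,
    (kills_succ h ρ).1 hρ.2.2.2⟩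

/-- With `le_of_kills` this translates the order into annihilation: on `L(m)` the elements belonging
to `l` vanish exactly when `m` is below `l`. Localisation lowers the level until one of the two
labels is at the top. -/
theorem kills_of_le : ∀ (n : ℕ) {V : Type w} [AddCommGroup V] [Module k V]
    {ρ : AlgRep k (A n) V}, S.IsWeight n l → S.IsL n m ρ → S.le m l → S.Kills n l ρ
  | 0, _, _, _, ρ, hl, hm, hle => by
    rw [← S.eq_of_le_top 0 l m ((S.isWeight_zero l).1 hl) hm.1 hle]
    exact hm.2.2.2
  | 1, _, _, _, ρ, hl, hm, hle => by
    rw [← S.eq_of_le_top 1 l m ((S.isWeight_one l).1 hl) hm.1 hle]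
    exact hm.2.2.2
  | n + 2, _, _, _, ρ, hl, hm, hle => by
    rcases (S.isWeight_succ n l).1 hl with hl' | hl'
    · rcases (S.isWeight_succ n m).1 hm.1 with hm' | hm'
      · exact (kills_succ hl' ρ).2 (kills_of_le n hl' (hm.loc hm') hle)
      · intro v
        rw [S.y_succ n l hl', S.z_succ n l hl', AlgRep.mul_act, AlgRep.mul_act,
          u_act_of_top hm' hm.2.2.2, u_act_of_top hm' hm.2.2.2]
        exact ⟨rfl, rfl⟩
    · rw [← S.eq_of_le_top _ l m hl' hm.1 hle]
      exact hm.2.2.2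

theorem top_eq_of_kills (hl : S.Top n l) (hm : S.Top n m) {ρ : AlgRep k (A n) V} [Nontrivial V]
    (h : ∀ v, ρ (S.z n l) v = 0) (h' : ∀ v, ρ (S.z n m) v = 0) : l = m := by
  by_contra hne
  obtain ⟨a, b, hab⟩ := S.top_unique n l m hl hm hne
  obtain ⟨v, hv⟩ := exists_ne (0 : V)
  apply hv
  rw [← AlgRep.one_act ρ v, ← hab, AlgRep.add_act, AlgRep.mul_act, AlgRep.mul_act, h, h', map_zero,
    map_zero, add_zero]

theorem le_of_kills : ∀ (n : ℕ) {V : Type w} [AddCommGroup V] [Module k V]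
    {ρ : AlgRep k (A n) V}, S.IsWeight n l → S.IsL n m ρ → S.Kills n l ρ → S.le m l
  | 0, _, _, _, ρ, hl, hm, hk => by
    have := hm.2.1.1
    rw [top_eq_of_kills ((S.isWeight_zero l).1 hl) ((S.isWeight_zero m).1 hm.1)
      (fun v => (hk v).2) (fun v => (hm.2.2.2 v).2)]
    exact S.le_refl _
  | 1, _, _, _, ρ, hl, hm, hk => by
    have := hm.2.1.1
    rw [top_eq_of_kills ((S.isWeight_one l).1 hl) ((S.isWeight_one m).1 hm.1)
      (fun v => (hk v).2) (fun v => (hm.2.2.2 v).2)]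
    exact S.le_refl _
  | n + 2, _, _, _, ρ, hl, hm, hk => by
    rcases (S.isWeight_succ n l).1 hl with hl' | hl'
    · rcases (S.isWeight_succ n m).1 hm.1 with hm' | hm'
      · exact le_of_kills n hl' (hm.loc hm') ((kills_succ hl' ρ).1 hk)
      · exact S.top_le n l m hl' hm'
    · rcases (S.isWeight_succ n m).1 hm.1 with hm' | hm'
      · obtain ⟨v, hv⟩ := u_act_ne hm' hm.2.2.1
        exact absurd (u_act_of_top hl' hk v) hv
      · have := hm.2.1.1
        rw [top_eq_of_kills hl' hm' (fun v => (hk v).2) (fun v => (hm.2.2.2 v).2)]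
        exact S.le_refl _

theorem exists_sq_succ {x : A n} {c : k} (hc : c ≠ 0) (h : x * x = c • x) :
    ∃ c : k, c ≠ 0 ∧ (T.u (n + 1) * T.inc2 n x) * (T.u (n + 1) * T.inc2 n x) =
      c • (T.u (n + 1) * T.inc2 n x) := by
  refine ⟨d * c, mul_ne_zero T.d_ne hc, ?_⟩
  have h2 : T.inc2 n x * T.inc2 n x = c • T.inc2 n x := by rw [← map_mul, h, map_smul]
  rw [mul_assoc, ← mul_assoc (T.inc2 n x), ← T.u_inc2, mul_assoc, h2, ← mul_assoc, T.u_sq,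
    smul_mul_assoc, mul_smul_comm, smul_smul]

/-- The elements `y n l` and `z n l` are idempotent up to non-zero scalars. -/
theorem exists_sq : ∀ (n : ℕ), S.IsWeight n l →
    (∃ c : k, c ≠ 0 ∧ S.y n l * S.y n l = c • S.y n l) ∧
    (∃ c : k, c ≠ 0 ∧ S.z n l * S.z n l = c • S.z n l)
  | 0, hl => by
    have h := (S.isWeight_zero l).1 hl
    exact ⟨⟨1, one_ne_zero, by simp [S.y_zero l h]⟩, S.z_sq 0 l h⟩
  | 1, hl => by
    have h := (S.isWeight_one l).1 hl
    exact ⟨⟨d, T.d_ne, by rw [S.y_top 0 l h, T.u_sq]⟩, S.z_sq 1 l h⟩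
  | n + 2, hl => by
    rcases (S.isWeight_succ n l).1 hl with h | h
    · obtain ⟨⟨c, hc, hc'⟩, ⟨c₁, hc₁, hc₁'⟩⟩ := exists_sq n h
      rw [S.y_succ n l h, S.z_succ n l h]
      exact ⟨exists_sq_succ hc hc', exists_sq_succ hc₁ hc₁'⟩
    · exact ⟨⟨d, T.d_ne, by rw [S.y_top _ l h, T.u_sq]⟩, S.z_sq _ l h⟩

variable (S) in
/-- The subrepresentation generated by the images of `y n l` and `z n l`. -/
def killSpan (n : ℕ) (l : Λ) (ρ : AlgRep k (A n) V) : Submodule k V :=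
  Submodule.span k {t | ∃ a v, t = ρ a (ρ (S.y n l) v) ∨ t = ρ a (ρ (S.z n l) v)}

theorem act_mem_killSpan {ρ : AlgRep k (A n) V} (a : A n) {v : V} (hv : v ∈ S.killSpan n l ρ) :
    ρ a v ∈ S.killSpan n l ρ := by
  refine (Submodule.span_le.2 ?_ : S.killSpan n l ρ ≤ (S.killSpan n l ρ).comap (ρ a)) hv
  rintro _ ⟨b, w, rfl | rfl⟩
  · exact Submodule.subset_span ⟨a * b, w, Or.inl (by rw [AlgRep.mul_act ρ a b])⟩
  · exact Submodule.subset_span ⟨a * b, w, Or.inr (by rw [AlgRep.mul_act ρ a b])⟩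

end Labels

/-! ### Truncation by `u` -/

namespace Tower

variable {k : Type u} [Field k] {A : ℕ → Type u} [∀ n, Ring (A n)] [∀ n, Algebra k (A n)] {d : k}

/-- The vector `1 ⊗ 1` in the globalisation of the regular representation detects `b`: the product
acts on it as `d` times `1 ⊗ b`. -/
theorem inc2_mul_u_injective (T : Tower k A d) (n : ℕ) :
    Function.Injective (LinearMap.mulRight k (T.u (n + 1)) ∘ₗ (T.inc2 n).toLinearMap) := by
  refine (injective_iff_map_eq_zero _).2 fun b hb => ?_
  have hb' : T.inc2 n b * T.u (n + 1) = 0 := hb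
  have h1 := congrArg (fun a => T.globAct (Algebra.lmul k (A n)) a (T.globIn _ 1)) hb'
  simp only [AlgRep.mul_act, globIn_u, map_smul, globIn_act, AlgRep.zero_act] at h1
  rw [smul_eq_zero_iff_right T.d_ne] at h1
  have := T.globIn_injective _ (h1.trans (map_zero _).symm)
  simpa using this

/-- The linear map `a ↦ b`, where `u a u = b u`. -/
theorem exists_trunc (T : Tower k A d) (n : ℕ) : ∃ t : A (n + 2) →ₗ[k] A n,
    (∀ a, T.u (n + 1) * a * T.u (n + 1) = T.inc2 n (t a) * T.u (n + 1)) ∧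
    ∀ b a, t (T.inc2 n b * a) = b * t a := by
  have hi := T.inc2_mul_u_injective n
  let φ := LinearMap.mulRight k (T.u (n + 1)) ∘ₗ (T.inc2 n).toLinearMap
  have hφ : ∀ b, φ b = T.inc2 n b * T.u (n + 1) := fun _ => rfl
  let ψ : A (n + 2) →ₗ[k] A (n + 2) :=
    LinearMap.mulRight k (T.u (n + 1)) ∘ₗ LinearMap.mulLeft k (T.u (n + 1))
  have hψ : ∀ a, ψ a = T.u (n + 1) * a * T.u (n + 1) := fun _ => rfl
  let t : A (n + 2) →ₗ[k] A n := (LinearEquiv.ofInjective φ hi).symm ∘ₗ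
    ψ.codRestrict (LinearMap.range φ) (fun a => by
      obtain ⟨b, hb⟩ := T.exists_u_mul_mul_u n a
      exact ⟨b, hb.symm⟩)
  have ht : ∀ a, φ (t a) = ψ a := fun a =>
    congrArg Subtype.val ((LinearEquiv.ofInjective φ hi).apply_symm_apply _)
  refine ⟨t, fun a => ?_, fun b a => hi ?_⟩
  · rw [← hψ, ← ht, hφ]
  · change φ _ = φ _
    rw [ht, hψ, hφ, map_mul, mul_assoc (T.inc2 n b), ← hφ, ht, hψ, ← mul_assoc, T.u_inc2]
    simp only [mul_assoc]

end Tower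

namespace Labels

variable {k : Type u} [Field k] {A : ℕ → Type u} [∀ n, Ring (A n)] [∀ n, Algebra k (A n)] {d : k}
variable {T : Tower k A d} {Λ : Type} {S : Labels T Λ}
variable {V : Type w} [AddCommGroup V] [Module k V] {W : Type w'} [AddCommGroup W] [Module k W]
variable {n : ℕ} {l m : Λ}

open Tower

/-! ### Standard representations -/

variable (S) in
/-- `P` is a projective cover of the irreducible representation with label `l`. -/
structure IsCover (n : ℕ) (l : Λ) {P : Type u} [AddCommGroup P] [Module k P]
    (ρ : AlgRep k (A n) P) {L : Type u} [AddCommGroup L] [Module k L] (σ : AlgRep k (A n) L)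
    (π : P →ₗ[k] L) (p₀ : P) (τ : P →ₗ[k] A n) : Prop where
  isL : S.IsL n l σ
  hom : AlgRep.IsHom ρ σ π
  ne : ∃ p, π p ≠ 0
  gen : ∀ p, π p ≠ 0 → ∀ p', ∃ a, ρ a p = p'
  hom' : ∀ a p, τ (ρ a p) = a * τ p
  split : ∀ p, ρ (τ p) p₀ = p

variable (S) in
/-- The standard representation with label `l`: the quotient of the projective cover by the
subrepresentation generated by the images of `y n l` and `z n l`. -/
def IsStd (n : ℕ) (l : Λ) {D : Type w} [AddCommGroup D] [Module k D] (ρ : AlgRep k (A n) D) :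
    Prop :=
  ∃ (P : Type u) (_ : AddCommGroup P) (_ : Module k P) (ρP : AlgRep k (A n) P)
    (L : Type u) (_ : AddCommGroup L) (_ : Module k L) (σ : AlgRep k (A n) L)
    (π : P →ₗ[k] L) (p₀ : P) (τ : P →ₗ[k] A n) (q : P →ₗ[k] D),
    S.IsCover n l ρP σ π p₀ τ ∧ AlgRep.IsHom ρP ρ q ∧ Function.Surjective q ∧
      ∀ p, q p = 0 ↔ p ∈ S.killSpan n l ρP

theorem IsStd.isWeight {ρ : AlgRep k (A n) V} (h : S.IsStd n l ρ) : S.IsWeight n l := by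
  obtain ⟨P, _, _, ρP, L, _, _, σ, π, p₀, τ, q, hc, -⟩ := h
  exact hc.isL.1

theorem IsStd.kills {ρ : AlgRep k (A n) V} (h : S.IsStd n l ρ) : S.Kills n l ρ := by
  obtain ⟨P, _, _, ρP, L, _, _, σ, π, p₀, τ, q, hc, hq, hs, hk⟩ := h
  intro v
  obtain ⟨p, rfl⟩ := hs v
  rw [← hq, ← hq, hk, hk]
  exact ⟨Submodule.subset_span ⟨1, p, Or.inl (by rw [AlgRep.one_act])⟩,
    Submodule.subset_span ⟨1, p, Or.inr (by rw [AlgRep.one_act])⟩⟩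

theorem killSpan_le_ker {ρ : AlgRep k (A n) V} {σ : AlgRep k (A n) W} {f : V →ₗ[k] W}
    (hf : AlgRep.IsHom ρ σ f) (hσ : S.Kills n l σ) : S.killSpan n l ρ ≤ LinearMap.ker f := by
  refine Submodule.span_le.2 ?_
  rintro _ ⟨a, v, rfl | rfl⟩
  · rw [SetLike.mem_coe, LinearMap.mem_ker, hf, hf, (hσ _).1, map_zero]
  · rw [SetLike.mem_coe, LinearMap.mem_ker, hf, hf, (hσ _).2, map_zero]

theorem IsStd.congr {ρ : AlgRep k (A n) V} (h : S.IsStd n l ρ) {σ : AlgRep k (A n) W}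
    {f : V →ₗ[k] W} (hf : AlgRep.IsHom ρ σ f) (hi : Function.Injective f)
    (hs : Function.Surjective f) : S.IsStd n l σ := by
  obtain ⟨P, _, _, ρP, L, _, _, σP, π, p₀, τ, q, hc, hq, hqs, hk⟩ := h
  refine ⟨P, _, _, ρP, L, _, _, σP, π, p₀, τ, f ∘ₗ q, hc, fun a p => ?_, hs.comp hqs, fun p => ?_⟩
  · rw [LinearMap.comp_apply, hq, hf, LinearMap.comp_apply]
  · rw [← hk, LinearMap.comp_apply, map_eq_zero_iff f hi]

theorem act_of_scalar {ρ : AlgRep k (A n) V} (hl : S.Top n l) (hk : S.Kills n l ρ) (a : A n) :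
    ∃ c : k, ∀ v, ρ a v = c • v := by
  obtain ⟨c, hc⟩ := S.scalar n l hl a
  refine ⟨c, fun v => ?_⟩
  have key : Submodule.span k {t | ∃ b c, t = b * S.y n l * c ∨ t = b * S.z n l * c} ≤
      LinearMap.ker ((LinearMap.applyₗ v).comp ρ.toLinearMap) := by
    refine Submodule.span_le.2 ?_
    rintro _ ⟨b, c, rfl | rfl⟩
    · change ρ _ v = 0
      rw [AlgRep.mul_act, AlgRep.mul_act, (hk _).1, map_zero]
    · change ρ _ v = 0
      rw [AlgRep.mul_act, AlgRep.mul_act, (hk _).2, map_zero]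
  have h : ρ (a - algebraMap k _ c) v = 0 := key hc
  rwa [AlgRep.sub_act, AlgRep.algebraMap_act, sub_eq_zero] at h

/-- At a top label the algebra acts by scalars on anything killed by `y` and `z`, and a standard
module is cyclic. It is non-zero since the simple quotient of the cover is killed by both. -/
theorem IsStd.length_eq_one {ρ : AlgRep k (A n) V} (h : S.IsStd n l ρ) (hl : S.Top n l) :
    Module.length k V = 1 := by
  have hk' := h.kills
  obtain ⟨P, _, _, ρP, L, _, _, σ, π, p₀, τ, q, hc, hq, hs, hk⟩ := h
  have h0 : q p₀ ≠ 0 := by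
    intro h0
    have hp : π p₀ = 0 := killSpan_le_ker hc.hom hc.isL.2.2.2 ((hk _).1 h0)
    obtain ⟨p, hp'⟩ := hc.ne
    rw [← hc.split p, hc.hom, hp, map_zero] at hp'
    exact hp' rfl
  have h1 : Module.finrank k V = 1 := by
    refine finrank_eq_one (q p₀) h0 fun v => ?_
    obtain ⟨p, rfl⟩ := hs v
    obtain ⟨c, hc'⟩ := act_of_scalar hl hk' (τ p)
    exact ⟨c, by rw [← hc', ← hq, hc.split]⟩
  have : Module.Finite k V := Module.finite_of_finrank_eq_succ h1
  rw [Module.length_eq_finrank, h1, Nat.cast_one]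

section Loc

variable {P : Type u} [AddCommGroup P] [Module k P] {ρP : AlgRep k (A (n + 2)) P}
  {L : Type u} [AddCommGroup L] [Module k L] {σ : AlgRep k (A (n + 2)) L}
  {π : P →ₗ[k] L} {p₀ : P} {τ : P →ₗ[k] A (n + 2)}

/-- Since `ε L ≠ 0`, the generator of `P` can be moved into `εP`. Then `P` is a direct summand of `A
ε`, so `εP` is a summand of `A n`, and every element of `1 ⊗ εP` is a multiple of `1 ⊗ p₁`. -/
theorem IsCover.exists_loc (hW : S.IsWeight n l) (hc : S.IsCover (n + 2) l ρP σ π p₀ τ) :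
    ∃ (p₁ : T.Loc ρP) (τ₁ : P →ₗ[k] A (n + 2)) (τ' : T.Loc ρP →ₗ[k] A n),
      S.IsCover (n + 2) l ρP σ π p₁ τ₁ ∧
      S.IsCover n l (T.locAct ρP) (T.locAct σ) (T.locMap hc.hom) p₁ τ' ∧
      ∀ v : T.Loc ρP, T.globAct (T.locAct ρP) (τ₁ v) (T.globIn _ p₁) = T.globIn _ v := by
  obtain ⟨x, hx⟩ := u_act_ne hW hc.isL.2.2.1
  obtain ⟨p, hp⟩ := hc.ne
  obtain ⟨p, rfl⟩ := hc.hom.surjective hc.isL.2.1 hp x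
  let p₁ : T.Loc ρP := ⟨_, u_act_mem_Loc ρP p⟩
  have hp₁ : π p₁ ≠ 0 := by rwa [hc.hom]
  obtain ⟨a₀, ha₀⟩ := hc.gen _ hp₁ p₀
  let τ₁ : P →ₗ[k] A (n + 2) := LinearMap.mulRight k a₀ ∘ₗ τ
  have h1 : ∀ a p, τ₁ (ρP a p) = a * τ₁ p := fun a p => by
    change τ _ * a₀ = a * (τ p * a₀)
    rw [hc.hom', mul_assoc]
  have h2 : ∀ p, ρP (τ₁ p) p₁ = p := fun p => by
    change ρP (τ p * a₀) p₁ = p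
    rw [AlgRep.mul_act, ha₀, hc.split]
  obtain ⟨t, ht, htb⟩ := T.exists_trunc n
  -- On `εP` one has `τ₁ v = d⁻¹ u τ₁ v`; hence the factor `d⁻¹` in front of the truncation of `τ₁
  -- v`.
  let τ' : T.Loc ρP →ₗ[k] A n := d⁻¹ • (t ∘ₗ τ₁ ∘ₗ (T.Loc ρP).subtype)
  have hτ' : ∀ v, τ' v = d⁻¹ • t (τ₁ v) := fun v => rfl
  have h3 : ∀ v : T.Loc ρP, τ₁ v = d⁻¹ • (T.u (n + 1) * τ₁ v) := fun v => by
    rw [← h1, mem_Loc.1 v.2, map_smul, smul_smul, inv_mul_cancel₀ T.d_ne, one_smul]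
  have h4 : ∀ v : T.Loc ρP, τ₁ v * T.u (n + 1) = T.inc2 n (τ' v) * T.u (n + 1) := fun v => by
    rw [h3, smul_mul_assoc, ht, hτ', map_smul, smul_mul_assoc]
  have h5 : ∀ v, T.locAct ρP (τ' v) p₁ = v := fun v => Subtype.ext (by
    have := congrArg (fun a => ρP a (p₁ : P)) (h4 v)
    simp only [AlgRep.mul_act, mem_Loc.1 p₁.2, map_smul] at this
    rw [h2] at this
    rw [coe_locAct]
    exact (smul_right_injective _ T.d_ne this).symm)
  refine ⟨p₁, τ₁, τ', ⟨hc.isL, hc.hom, hc.ne, hc.gen, h1, h2⟩,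
    ⟨hc.isL.loc hW, locMap_isHom hc.hom, ⟨p₁, fun h => hp₁ (congrArg Subtype.val h)⟩,
    fun v hv v' => ?_, fun b v => ?_, h5⟩, fun v => ?_⟩
  · obtain ⟨a, ha⟩ := hc.gen v (fun h => hv (Subtype.ext h)) v'
    refine ⟨d⁻¹ • t a, Subtype.ext ?_⟩
    have := congrArg (fun a => ρP a (v : P)) (ht a)
    simp only [AlgRep.mul_act, mem_Loc.1 v.2, map_smul] at this
    rw [ha, mem_Loc.1 v'.2] at this
    rw [coe_locAct, map_smul, AlgRep.smul_act, ← smul_right_injective _ T.d_ne this, smul_smul,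
      inv_mul_cancel₀ T.d_ne, one_smul]
  · rw [hτ', hτ', coe_locAct, h1, htb, mul_smul_comm]
  · have := congrArg (fun a => T.globAct (T.locAct ρP) a (T.globIn _ p₁)) (h4 v)
    simp only [AlgRep.mul_act, globIn_u, map_smul] at this
    rw [smul_right_injective _ T.d_ne this, globIn_act, h5]

end Loc

/-- For an old label `y` and `z` are `u` times those of level `n`. Since `u A(n+2) u = A(n) u`,
applying `u` to the submodule they generate gives the one generated inside `εV`. -/
theorem killSpan_loc (hW : S.IsWeight n l) {ρ : AlgRep k (A (n + 2)) V} (v : T.Loc ρ) :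
    (v : V) ∈ S.killSpan (n + 2) l ρ ↔ v ∈ S.killSpan n l (T.locAct ρ) := by
  constructor
  · intro hv
    have key : S.killSpan (n + 2) l ρ ≤
        ((S.killSpan n l (T.locAct ρ)).map (T.Loc ρ).subtype).comap (ρ (T.u (n + 1))) := by
      refine Submodule.span_le.2 ?_
      rintro _ ⟨a, w, h⟩
      obtain ⟨b, hb⟩ := T.exists_u_mul_mul_u n a
      rw [S.y_succ n l hW, S.z_succ n l hW] at h
      have hw : ∀ x, ρ (T.u (n + 1)) (ρ a (ρ (T.u (n + 1) * T.inc2 n x) w)) =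
          T.locAct ρ b (T.locAct ρ x ⟨_, u_act_mem_Loc ρ w⟩) := fun x => by
        rw [← AlgRep.mul_act, ← AlgRep.mul_act, ← mul_assoc, hb, mul_assoc, T.u_inc2,
          AlgRep.mul_act, AlgRep.mul_act, coe_locAct, coe_locAct]
      rcases h with rfl | rfl
      · exact ⟨_, Submodule.subset_span ⟨b, _, Or.inl rfl⟩, (hw _).symm⟩
      · exact ⟨_, Submodule.subset_span ⟨b, _, Or.inr rfl⟩, (hw _).symm⟩
    obtain ⟨x, hx, hxv⟩ := key hv
    rw [mem_Loc.1 v.2] at hxv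
    have : v = d⁻¹ • x := Subtype.ext (by
      change (v : V) = d⁻¹ • (T.Loc ρ).subtype x
      rw [hxv, smul_smul, inv_mul_cancel₀ T.d_ne, one_smul])
    rw [this]
    exact Submodule.smul_mem _ _ hx
  · intro hv
    refine (Submodule.span_le.2 ?_ : S.killSpan n l (T.locAct ρ) ≤
      (S.killSpan (n + 2) l ρ).comap (T.Loc ρ).subtype) hv
    have hw : ∀ x (w : T.Loc ρ), ρ (T.inc2 n x) w.1 =
        ρ (T.u (n + 1) * T.inc2 n x) (d⁻¹ • w.1) := fun x w => by
      rw [T.u_inc2, AlgRep.mul_act, map_smul, mem_Loc.1 w.2, smul_smul, inv_mul_cancel₀ T.d_ne,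
        one_smul]
    rintro _ ⟨b, w, rfl | rfl⟩
    · refine Submodule.subset_span ⟨T.inc2 n b, d⁻¹ • w, Or.inl ?_⟩
      rw [S.y_succ n l hW, ← hw]; rfl
    · refine Submodule.subset_span ⟨T.inc2 n b, d⁻¹ • w, Or.inr ?_⟩
      rw [S.z_succ n l hW, ← hw]; rfl

theorem IsStd.loc (hW : S.IsWeight n l) {ρ : AlgRep k (A (n + 2)) V}
    (h : S.IsStd (n + 2) l ρ) : S.IsStd n l (T.locAct ρ) := by
  obtain ⟨P, _, _, ρP, L, _, _, σ, π, p₀, τ, q, hc, hq, hs, hk⟩ := h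
  obtain ⟨p₁, τ₁, τ', -, h2, -⟩ := hc.exists_loc hW
  refine ⟨T.Loc ρP, _, _, T.locAct ρP, T.Loc σ, _, _, T.locAct σ, T.locMap hc.hom, p₁, τ',
    T.locMap hq, h2, locMap_isHom hq, locMap_surjective hq hs, fun v => ?_⟩
  rw [← killSpan_loc hW, ← hk]
  exact ⟨congrArg Subtype.val, fun h => Subtype.ext h⟩

/-- For the cover, `p ↦ τ₁ p ⊗ p₁` is a left inverse of the counit. The kernel of `P → D` is
generated by vectors that pass through `ε`, and these are already images of the kernel of `Glob(εP)
→ Glob(εD)`; so injectivity descends to `D`. -/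
theorem IsStd.counit_bijective (hW : S.IsWeight n l) {ρ : AlgRep k (A (n + 2)) V}
    (h : S.IsStd (n + 2) l ρ) : Function.Bijective (T.counit ρ) := by
  obtain ⟨P, _, _, ρP, L, _, _, σ, π, p₀, τ, q, hc, hq, hs, hk⟩ := h
  obtain ⟨p₁, τ₁, τ', h1, h2, h3⟩ := hc.exists_loc hW
  have hinj : Function.Injective (T.counit ρP) := by
    let inv : P →ₗ[k] T.Glob (T.locAct ρP) :=
      (LinearMap.applyₗ (T.globIn _ p₁)).comp ((T.globAct (T.locAct ρP)).toLinearMap.comp τ₁)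
    have hinv : ∀ p, inv p = T.globAct (T.locAct ρP) (τ₁ p) (T.globIn _ p₁) := fun p => rfl
    refine Function.LeftInverse.injective (g := inv) fun y => ?_
    refine glob_ext (f := inv ∘ₗ T.counit ρP) (f' := LinearMap.id)
      (s := T.globAct (T.locAct ρP)) (fun a y => ?_) (fun _ _ => rfl) (fun v => ?_) y
    · rw [LinearMap.comp_apply, counit_isHom, hinv, h1.hom', AlgRep.mul_act]; rfl
    · rw [LinearMap.comp_apply, counit_globIn, hinv, h3]; rfl
  constructor
  · refine (injective_iff_map_eq_zero _).2 fun x hx => ?_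
    obtain ⟨y, rfl⟩ := globMap_surjective (locMap_isHom hq) (locMap_surjective hq hs) x
    rw [counit_naturality, hk] at hx
    have hle : S.killSpan (n + 2) l ρP ≤
        (LinearMap.ker (T.globMap (locMap_isHom hq))).map (T.counit ρP) := by
      have hw : ∀ a b w, (∀ v : T.Loc ρ, T.locAct ρ b v = 0) → ρP a (ρP (T.u (n + 1) * T.inc2 n b) w) ∈
          (LinearMap.ker (T.globMap (locMap_isHom hq))).map (T.counit ρP) := by
        intro a b w hb
        refine ⟨T.globAct _ a (T.globIn _ (T.locAct ρP b ⟨_, u_act_mem_Loc ρP w⟩)), ?_, ?_⟩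
        · rw [SetLike.mem_coe, LinearMap.mem_ker, globMap_isHom, globMap_globIn, locMap_isHom, hb,
            map_zero, map_zero]
        · rw [counit_isHom, counit_globIn, coe_locAct, T.u_inc2, AlgRep.mul_act _ _ (T.u _)]
      have hkill : S.Kills n l (T.locAct ρ) :=
        IsStd.kills (IsStd.loc hW ⟨P, _, _, ρP, L, _, _, σ, π, p₀, τ, q, hc, hq, hs, hk⟩)
      refine Submodule.span_le.2 ?_
      rintro _ ⟨a, w, rfl | rfl⟩
      · rw [S.y_succ n l hW]
        exact hw a _ w (fun v => (hkill v).1)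
      · rw [S.z_succ n l hW]
        exact hw a _ w (fun v => (hkill v).2)
    obtain ⟨y', hy', hyy⟩ := hle hx
    rw [← hinj hyy]
    exact hy'
  · intro v
    obtain ⟨p, rfl⟩ := hs v
    refine ⟨T.globAct _ (τ₁ p) (T.globIn _ (T.locMap hq p₁)), ?_⟩
    rw [counit_isHom, counit_globIn, coe_locMap, ← hq, h1.split]

end Labels

namespace Labels

variable {k : Type u} [Field k] {A : ℕ → Type u} [∀ n, Ring (A n)] [∀ n, Algebra k (A n)] {d : k}
variable {T : Tower k A d} {Λ : Type} {S : Labels T Λ}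
variable {V : Type w} [AddCommGroup V] [Module k V] {W : Type w'} [AddCommGroup W] [Module k W]
variable {Y : Type w''} [AddCommGroup Y] [Module k Y]
variable {n : ℕ} {l m : Λ}

open Tower

/-! ### Globalisation of standard representations -/

/-- The orbit map of a vector. -/
def _root_.AlgRep.orbit {B : Type w'} [Ring B] [Algebra k B] (ρ : AlgRep k B V) (v : V) :
    B →ₗ[k] V :=
  ρ.toLinearMap.flip v

theorem _root_.AlgRep.orbit_apply {B : Type w'} [Ring B] [Algebra k B] (ρ : AlgRep k B V) (v : V)
    (b : B) : ρ.orbit v b = ρ b v := rfl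

theorem glob_gen {ρ : AlgRep k (A n) V} {v₀ : V} (h : ∀ v, ∃ b, ρ b v₀ = v) (y : T.Glob ρ) :
    ∃ c, T.globAct ρ c (T.globIn ρ v₀) = y := by
  refine glob_induction' (X := LinearMap.range ((T.globAct ρ).orbit (T.globIn ρ v₀)))
    (fun a v => ?_) y
  obtain ⟨b, rfl⟩ := h v
  refine ⟨a * T.inc2 n b, ?_⟩
  rw [AlgRep.orbit_apply, AlgRep.mul_act, globIn_act]

theorem kills_globAct (hW : S.IsWeight n l) {ρ : AlgRep k (A n) V} (h : S.Kills n l ρ) :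
    S.Kills (n + 2) l (T.globAct ρ) := by
  intro x
  obtain ⟨v, hv⟩ := glob_u_mem x
  rw [S.y_succ n l hW, S.z_succ n l hW, T.u_inc2, T.u_inc2, AlgRep.mul_act, AlgRep.mul_act, hv,
    globIn_act, globIn_act, (h v).1, (h v).2, map_zero]
  exact ⟨rfl, rfl⟩

/-- The largest subrepresentation killed by `ε`. -/
def epsKer (T : Tower k A d) (ρ : AlgRep k (A (n + 2)) V) : Submodule k V :=
  ⨅ a, LinearMap.ker (ρ (T.u (n + 1) * a))

theorem mem_epsKer {ρ : AlgRep k (A (n + 2)) V} {v : V} :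
    v ∈ epsKer T ρ ↔ ∀ a, ρ (T.u (n + 1)) (ρ a v) = 0 := by
  simp [epsKer]

/-- The quotient by the largest subrepresentation killed by `ε`. -/
def epsQuot (T : Tower k A d) (ρ : AlgRep k (A (n + 2)) V) :
    AlgRep k (A (n + 2)) (V ⧸ epsKer T ρ) :=
  ρ.quot (epsKer T ρ) (fun a v hv => mem_epsKer.2 fun b => by
    rw [← AlgRep.mul_act ρ b]; exact mem_epsKer.1 hv _)

theorem mk_globIn_ne_zero {ρ : AlgRep k (A n) V} {v : V} (hv : v ≠ 0) :
    (epsKer T (T.globAct ρ)).mkQ (T.globIn ρ v) ≠ 0 := by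
  intro h
  have := mem_epsKer.1 ((Submodule.Quotient.mk_eq_zero _).1 h) 1
  rw [AlgRep.one_act, globIn_u, smul_eq_zero_iff_right T.d_ne] at this
  exact hv (T.globIn_injective ρ (this.trans (map_zero _).symm))

theorem exists_of_mk_ne_zero {ρ : AlgRep k (A n) V} {x : T.Glob ρ}
    (hx : (epsKer T (T.globAct ρ)).mkQ x ≠ 0) :
    ∃ a v, v ≠ 0 ∧ T.globAct ρ a x = T.globIn ρ v := by
  have : ¬ ∀ a, T.globAct ρ (T.u (n + 1)) (T.globAct ρ a x) = 0 := fun h =>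
    hx ((Submodule.Quotient.mk_eq_zero _).2 (mem_epsKer.2 h))
  push Not at this
  obtain ⟨a, ha⟩ := this
  obtain ⟨v, hv⟩ := glob_u_mem (T.globAct ρ a x)
  refine ⟨T.u (n + 1) * a, v, ?_, by rw [AlgRep.mul_act, hv]⟩
  rintro rfl
  exact ha (hv.trans (map_zero _))

/-- A vector of `Glob V` outside the largest `ε`-killed subrepresentation can be moved to a non-zero
vector of `V`, which generates `V` by simplicity and therefore all of `Glob V`. -/
theorem isL_epsQuot {ρ : AlgRep k (A n) V} (h : S.IsL n l ρ) :
    S.IsL (n + 2) l (epsQuot T (T.globAct ρ)) := by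
  obtain ⟨hW, ⟨hn, hs⟩, ⟨v, hv⟩, hk⟩ := h
  have hne : (epsKer T (T.globAct ρ)).mkQ (T.globIn ρ (ρ (S.s n l) v)) ≠ 0 := mk_globIn_ne_zero hv
  refine ⟨(S.isWeight_succ n l).2 (Or.inl hW), ⟨⟨_, _, hne⟩, ?_⟩,
    ⟨(epsKer T (T.globAct ρ)).mkQ (T.globIn ρ v), ?_⟩, ?_⟩
  · intro x hx y
    obtain ⟨x, rfl⟩ := (epsKer T (T.globAct ρ)).mkQ_surjective x
    obtain ⟨y, rfl⟩ := (epsKer T (T.globAct ρ)).mkQ_surjective y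
    obtain ⟨a, v', hv', ha⟩ := exists_of_mk_ne_zero hx
    obtain ⟨c, rfl⟩ := glob_gen (fun w => hs v' hv' w) y
    refine ⟨c * a, ?_⟩
    rw [← ha, ← AlgRep.mul_act]; rfl
  · have : T.globAct ρ (S.s (n + 2) l) (T.globIn ρ v) = d • T.globIn ρ (ρ (S.s n l) v) := by
      rw [S.s_succ n l hW, AlgRep.mul_act, globIn_act, globIn_u]
    change (epsKer T (T.globAct ρ)).mkQ (T.globAct ρ (S.s (n + 2) l) (T.globIn ρ v)) ≠ 0
    rw [this, map_smul]
    exact smul_ne_zero T.d_ne hne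
  · intro x
    obtain ⟨x, rfl⟩ := (epsKer T (T.globAct ρ)).mkQ_surjective x
    have := kills_globAct hW hk x
    change (epsKer T (T.globAct ρ)).mkQ _ = 0 ∧ (epsKer T (T.globAct ρ)).mkQ _ = 0
    rw [this.1, this.2, map_zero]
    exact ⟨rfl, rfl⟩

/-- The globalised cover is again a cyclic projective generated by any vector outside the kernel of
the map to the simple quotient of `Glob L`. Right exactness identifies the kernel of `Glob P → Glob
D` with the submodule generated by the images of `y` and `z`. -/
theorem IsStd.glob {ρ : AlgRep k (A n) V} (h : S.IsStd n l ρ) :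
    S.IsStd (n + 2) l (T.globAct ρ) := by
  have hW := h.isWeight
  have hkill := h.kills
  obtain ⟨P, _, _, ρP, L, _, _, σ, π, p₀, τ, q, hc, hq, hs, hk⟩ := h
  -- As `P` is a summand of `A n`, `Glob P` is a summand of `A(n+2) ε`; the coordinate map is `1 ⊗ p
  -- ↦ d⁻¹ τ(p) u`.
  obtain ⟨τ', h1, h2⟩ := T.exists_globLift ρP (Algebra.lmul k (A (n + 2)))
    (d⁻¹ • (LinearMap.mulRight k (T.u (n + 1)) ∘ₗ (T.inc2 n).toLinearMap ∘ₗ τ))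
    (fun b p => by
      simp [hc.hom', mul_assoc])
    (fun p => by
      simp only [LinearMap.smul_apply, LinearMap.comp_apply, LinearMap.mulRight_apply,
        AlgHom.toLinearMap_apply, map_smul, Algebra.coe_lmul_eq_mul, LinearMap.mul_apply_apply]
      rw [← mul_assoc, T.u_inc2, mul_assoc, T.u_sq, mul_smul_comm, smul_comm])
  have h2' : ∀ p, τ' (T.globIn ρP p) = d⁻¹ • (T.inc2 n (τ p) * T.u (n + 1)) := h2
  let πQ : T.Glob ρP →ₗ[k] (T.Glob σ ⧸ epsKer T (T.globAct σ)) :=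
    (epsKer T (T.globAct σ)).mkQ ∘ₗ T.globMap hc.hom
  have hπQ : ∀ x, πQ x = (epsKer T (T.globAct σ)).mkQ (T.globMap hc.hom x) := fun _ => rfl
  refine ⟨T.Glob ρP, _, _, T.globAct ρP, T.Glob σ ⧸ epsKer T (T.globAct σ), _, _,
    epsQuot T (T.globAct σ), πQ, T.globIn ρP p₀, τ', T.globMap hq,
    ⟨isL_epsQuot hc.isL, fun a x => ?_, ?_, fun x hx y => ?_, h1, fun x => ?_⟩,
    globMap_isHom hq, globMap_surjective hq hs, fun x => ⟨fun hx => ?_, fun hx => ?_⟩⟩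
  · rw [hπQ, globMap_isHom]; rfl
  · obtain ⟨p, hp⟩ := hc.ne
    exact ⟨T.globIn ρP p, by rw [hπQ, globMap_globIn]; exact mk_globIn_ne_zero hp⟩
  · obtain ⟨a, v, hv, ha⟩ := exists_of_mk_ne_zero hx
    obtain ⟨p, hp⟩ := glob_u_mem (T.globAct ρP a x)
    have hv' : π p ≠ 0 := by
      intro h0
      have := congrArg (T.globMap hc.hom) hp
      rw [globMap_isHom, globMap_isHom, globMap_globIn, ha, h0, globIn_u, map_zero,
        smul_eq_zero_iff_right T.d_ne] at this
      exact hv (T.globIn_injective σ (this.trans (map_zero _).symm))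
    obtain ⟨c, hc'⟩ := glob_gen (hc.gen p hv') y
    exact ⟨c * (T.u (n + 1) * a), by rw [AlgRep.mul_act, AlgRep.mul_act, hp, hc']⟩
  · refine glob_ext (f := (T.globAct ρP).orbit (T.globIn ρP p₀) ∘ₗ τ') (f' := LinearMap.id) (s := T.globAct ρP)
      (fun a y => ?_) (fun _ _ => rfl) (fun p => ?_) x
    · rw [LinearMap.comp_apply, LinearMap.comp_apply, AlgRep.orbit_apply, AlgRep.orbit_apply,
        h1, ← AlgRep.mul_act]; rfl
    · rw [LinearMap.comp_apply, AlgRep.orbit_apply, h2', AlgRep.smul_act, AlgRep.mul_act, globIn_u, map_smul, globIn_act, hc.split,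
        smul_smul, inv_mul_cancel₀ T.d_ne, one_smul]; rfl
  · have hx' := ker_globMap_le hq hs (N := S.killSpan n l ρP) (fun p hp => (hk p).1 hp) hx
    refine (Submodule.span_le.2 ?_ : _ ≤ S.killSpan (n + 2) l (T.globAct ρP)) hx'
    rintro _ ⟨a, p, hp, rfl⟩
    refine act_mem_killSpan a ?_
    refine (Submodule.span_le.2 ?_ : S.killSpan n l ρP ≤
      (S.killSpan (n + 2) l (T.globAct ρP)).comap (T.globIn ρP)) hp
    have hw : ∀ b x p, T.globIn ρP (ρP b (ρP x p)) = T.globAct ρP (T.inc2 n b)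
        (T.globAct ρP (T.u (n + 1) * T.inc2 n x) (d⁻¹ • T.globIn ρP p)) := fun b x p => by
      rw [T.u_inc2, AlgRep.mul_act, map_smul, globIn_u, smul_smul, inv_mul_cancel₀ T.d_ne,
        one_smul, globIn_act, globIn_act]
    rintro _ ⟨b, w, rfl | rfl⟩
    · refine Submodule.subset_span ⟨T.inc2 n b, d⁻¹ • T.globIn ρP w, Or.inl ?_⟩
      rw [hw, S.y_succ n l hW]
    · refine Submodule.subset_span ⟨T.inc2 n b, d⁻¹ • T.globIn ρP w, Or.inr ?_⟩
      rw [hw, S.z_succ n l hW]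
  · exact killSpan_le_ker (globMap_isHom hq) (kills_globAct hW hkill) hx

/-- For an old label `D` is isomorphic to `Glob(εD)` and induction applies; for a top label `u` acts
as zero. -/
theorem IsStd.acyclic : ∀ {n : ℕ} {V : Type w} [AddCommGroup V] [Module k V]
    {ρ : AlgRep k (A n) V}, S.IsStd n l ρ → T.Acyclic ρ
  | 0, _, _, _, _, _ => trivial
  | 1, _, _, _, _, _ => ⟨trivial, trivial⟩
  | n + 2, V, _, _, ρ, h => by
    rcases (S.isWeight_succ n l).1 h.isWeight with hW | hW
    · have hb := h.counit_bijective hW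
      refine acyclic_of_sub (counit_isHom ρ) hb.1 (fun v => hb.2 _)
        (acyclic_globAct (IsStd.acyclic (h.loc hW)))
    · exact acyclic_of_u_act (u_act_of_top hW h.kills)

/-! ### Multiplicities -/

/-- Injectivity of the counits of all localisations. -/
def Good (T : Tower k A d) : ∀ {n : ℕ} {V : Type w} [AddCommGroup V] [Module k V],
    AlgRep k (A n) V → Prop
  | 0, _, _, _, _ => True
  | 1, _, _, _, _ => True
  | _ + 2, _, _, _, ρ => Function.Injective (T.counit ρ) ∧ Good T (T.locAct ρ)

theorem good_of_subsingleton : ∀ {n : ℕ} {V : Type w} [AddCommGroup V] [Module k V]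
    [Subsingleton V] (ρ : AlgRep k (A n) V), Good T ρ
  | 0, _, _, _, _, _ => trivial
  | 1, _, _, _, _, _ => trivial
  | _ + 2, _, _, _, _, ρ => ⟨(acyclic_of_subsingleton ρ).1, good_of_subsingleton _⟩

theorem loc_subsingleton {ρ : AlgRep k (A (n + 2)) V} (h : ∀ v, ρ (T.u (n + 1)) v = 0) :
    Subsingleton (T.Loc ρ) :=
  subsingleton_of_forall_eq 0 (by rintro ⟨_, v, rfl⟩; exact Subtype.ext (h v))

theorem IsStd.good : ∀ {n : ℕ} {V : Type w} [AddCommGroup V] [Module k V]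
    {ρ : AlgRep k (A n) V}, S.IsStd n l ρ → Good T ρ
  | 0, _, _, _, _, _ => trivial
  | 1, _, _, _, _, _ => trivial
  | n + 2, V, _, _, ρ, h => by
    refine ⟨h.acyclic.1, ?_⟩
    rcases (S.isWeight_succ n l).1 h.isWeight with hW | hW
    · exact (h.loc hW).good
    · have := loc_subsingleton (u_act_of_top hW h.kills)
      exact good_of_subsingleton _

open Classical in
/-- The multiplicity of the standard representation with label `l` in a representation with a
standard filtration. -/
noncomputable def count (S : Labels T Λ) (l : Λ) : ∀ {n : ℕ} {V : Type w} [AddCommGroup V]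
    [Module k V], AlgRep k (A n) V → ℕ∞
  | 0, V, _, _, ρ => Module.length k (V ⧸ S.killSpan 0 l ρ)
  | 1, V, _, _, ρ => Module.length k (V ⧸ S.killSpan 1 l ρ)
  | n + 2, V, _, _, ρ => if S.IsWeight n l then count S l (T.locAct ρ) else
      Module.length k (V ⧸ S.killSpan (n + 2) l ρ)

theorem count_of_top {ρ : AlgRep k (A n) V} (h : S.Top n l) :
    S.count l ρ = Module.length k (V ⧸ S.killSpan n l ρ) := by
  rcases n with _ | _ | n
  · rw [count]
  · rw [count]
  · rw [count, if_neg (fun hW => S.not_top n l hW h)]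

theorem count_of_isWeight {ρ : AlgRep k (A (n + 2)) V} (h : S.IsWeight n l) :
    S.count l ρ = S.count l (T.locAct ρ) := by
  rw [count, if_pos h]

theorem count_of_subsingleton : ∀ {n : ℕ} {V : Type w} [AddCommGroup V] [Module k V]
    [Subsingleton V] (ρ : AlgRep k (A n) V), S.count l ρ = 0
  | 0, V, _, _, _, ρ => by rw [count]; exact Module.length_eq_zero
  | 1, V, _, _, _, ρ => by rw [count]; exact Module.length_eq_zero
  | n + 2, V, _, _, _, ρ => by
    rw [count]
    split_ifs
    · exact count_of_subsingleton _
    · exact Module.length_eq_zero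

/-- At a top label of level `n + 2` the element `y` is `u` itself, and the image of the counit is
the submodule generated by `u V`. -/
theorem killSpan_eq_top_of_counit {ρ : AlgRep k (A (n + 2)) V}
    (h : Function.Surjective (T.counit ρ)) (hl : S.Top (n + 2) l) :
    S.killSpan (n + 2) l ρ = ⊤ := by
  refine eq_top_iff.2 fun v _ => ?_
  obtain ⟨y, rfl⟩ := h v
  refine glob_induction' (X := (S.killSpan (n + 2) l ρ).comap (T.counit ρ)) (fun a v => ?_) y
  rw [Submodule.mem_comap, counit_isHom, counit_globIn]
  refine act_mem_killSpan a ?_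
  obtain ⟨_, w, rfl⟩ := v
  refine Submodule.subset_span ⟨1, w, Or.inl ?_⟩
  rw [S.y_top _ l hl, AlgRep.one_act]

theorem count_isStd_self : ∀ {n : ℕ} {V : Type w} [AddCommGroup V] [Module k V]
    {ρ : AlgRep k (A n) V}, S.IsStd n l ρ → S.count l ρ = 1 := by
  have key : ∀ {n : ℕ} {V : Type w} [AddCommGroup V] [Module k V]
    {ρ : AlgRep k (A n) V}, S.Top n l → S.IsStd n l ρ → S.count l ρ = 1 := by
    intro n V _ _ ρ ht h
    rw [count_of_top ht]
    have hbot : S.killSpan n l ρ = ⊥ :=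
      eq_bot_iff.2 (killSpan_le_ker (f := LinearMap.id) (fun _ _ => rfl) h.kills)
    rw [← h.length_eq_one ht]
    exact ((Submodule.quotEquivOfEqBot _ hbot).length_eq)
  intro n
  induction n using Nat.twoStepInduction with
  | zero => exact fun h => key ((S.isWeight_zero l).1 h.isWeight) h
  | one => exact fun h => key ((S.isWeight_one l).1 h.isWeight) h
  | more n ih _ =>
    intro V _ _ ρ h
    rcases (S.isWeight_succ n l).1 h.isWeight with hW | hW
    · rw [count_of_isWeight hW, ih (h.loc hW)]
    · exact key hW h

/-- If both labels are top, the two elements `z` generate the unit ideal. If `l` appears at a higher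
level than `m`, localisation annihilates the module before `m` is reached; if at a lower level, the
module is generated by its `ε`-part when `m` is at the top. -/
theorem count_isStd_ne (hne : l ≠ m) : ∀ {n : ℕ} {V : Type w} [AddCommGroup V] [Module k V]
    {ρ : AlgRep k (A n) V}, S.IsWeight n m → S.IsStd n l ρ → S.count m ρ = 0 := by
  have key : ∀ {n : ℕ} {V : Type w} [AddCommGroup V] [Module k V]
    {ρ : AlgRep k (A n) V}, S.Top n l → S.Top n m → S.IsStd n l ρ → S.count m ρ = 0 := by
    intro n V _ _ ρ hl hm h
    rw [count_of_top hm, Module.length_eq_zero_iff, Submodule.Quotient.subsingleton_iff]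
    obtain ⟨a, b, hab⟩ := S.top_unique n l m hl hm hne
    refine eq_top_iff.2 fun v _ => ?_
    rw [← AlgRep.one_act ρ v, ← hab, AlgRep.add_act, AlgRep.mul_act, AlgRep.mul_act,
      (h.kills v).2, map_zero, zero_add]
    exact Submodule.subset_span ⟨b, v, Or.inr rfl⟩
  intro n
  induction n using Nat.twoStepInduction with
  | zero => exact fun hm h => key ((S.isWeight_zero l).1 h.isWeight) ((S.isWeight_zero m).1 hm) h
  | one => exact fun hm h => key ((S.isWeight_one l).1 h.isWeight) ((S.isWeight_one m).1 hm) h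
  | more n ih _ =>
    intro V _ _ ρ hm h
    rcases (S.isWeight_succ n m).1 hm with hm' | hm'
    · rw [count_of_isWeight hm']
      rcases (S.isWeight_succ n l).1 h.isWeight with hW | hW
      · exact ih hm' (h.loc hW)
      · have := loc_subsingleton (u_act_of_top hW h.kills)
        exact count_of_subsingleton _
    · rcases (S.isWeight_succ n l).1 h.isWeight with hW | hW
      · rw [count_of_top hm', Module.length_eq_zero_iff,
          Submodule.Quotient.subsingleton_iff]
        exact killSpan_eq_top_of_counit (h.counit_bijective hW).2 hm'
      · exact key hW hm' h

end Labels

/-- Short exact sequences of representations. -/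
structure AlgRep.ShortExact {k : Type u} [Field k] {R : Type v} [Ring R] [Algebra k R]
    {V : Type w} [AddCommGroup V] [Module k V] {W : Type w'} [AddCommGroup W] [Module k W]
    {Y : Type w''} [AddCommGroup Y] [Module k Y] (ρ : AlgRep k R V) (σ : AlgRep k R W)
    (τ : AlgRep k R Y) (f : V →ₗ[k] W) (g : W →ₗ[k] Y) : Prop where
  hom_left : AlgRep.IsHom ρ σ f
  hom_right : AlgRep.IsHom σ τ g
  injective : Function.Injective f
  surjective : Function.Surjective g
  comp : ∀ v, g (f v) = 0
  exact : ∀ w, g w = 0 → ∃ v, f v = w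

namespace Labels

variable {k : Type u} [Field k] {A : ℕ → Type u} [∀ n, Ring (A n)] [∀ n, Algebra k (A n)] {d : k}
variable {T : Tower k A d} {Λ : Type} {S : Labels T Λ}
variable {V : Type w} [AddCommGroup V] [Module k V] {W : Type w'} [AddCommGroup W] [Module k W]
variable {Y : Type w''} [AddCommGroup Y] [Module k Y]
variable {n : ℕ} {l m : Λ}

open Tower

/-! ### Additivity of multiplicities -/

variable (S) in
/-- The subrepresentation generated by the image of `y n l`. -/
def ySpan (n : ℕ) (l : Λ) (ρ : AlgRep k (A n) V) : Submodule k V :=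
  Submodule.span k {t | ∃ a v, t = ρ a (ρ (S.y n l) v)}

theorem ySpan_le_killSpan (ρ : AlgRep k (A n) V) : S.ySpan n l ρ ≤ S.killSpan n l ρ :=
  Submodule.span_mono fun _ ⟨a, v, h⟩ => ⟨a, v, Or.inl h⟩

theorem act_mem_ySpan {ρ : AlgRep k (A n) V} (a : A n) {v : V} (hv : v ∈ S.ySpan n l ρ) :
    ρ a v ∈ S.ySpan n l ρ := by
  refine (Submodule.span_le.2 ?_ : S.ySpan n l ρ ≤ (S.ySpan n l ρ).comap (ρ a)) hv
  rintro _ ⟨b, w, rfl⟩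
  exact Submodule.subset_span ⟨a * b, w, by rw [AlgRep.mul_act ρ a b]⟩

theorem z_act_mem_killSpan (ρ : AlgRep k (A n) V) (v : V) :
    ρ (S.z n l) v ∈ S.killSpan n l ρ :=
  Submodule.subset_span ⟨1, v, Or.inr (by rw [AlgRep.one_act])⟩

/-- Because `z` is central modulo the ideal of `y`, the image of `z` is a submodule modulo `ySpan`.
-/
theorem exists_of_mem_killSpan (hl : S.Top n l) {ρ : AlgRep k (A n) V} {v : V}
    (hv : v ∈ S.killSpan n l ρ) : ∃ v₀ ∈ S.ySpan n l ρ, ∃ v₁, v = v₀ + ρ (S.z n l) v₁ := by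
  suffices v ∈ S.ySpan n l ρ ⊔ LinearMap.range (ρ (S.z n l)) by
    obtain ⟨v₀, h, _, ⟨v₁, rfl⟩, rfl⟩ := Submodule.mem_sup.1 this
    exact ⟨v₀, h, v₁, rfl⟩
  refine (Submodule.span_le.2 ?_ : S.killSpan n l ρ ≤ _) hv
  rintro _ ⟨a, w, rfl | rfl⟩
  · exact Submodule.mem_sup_left (Submodule.subset_span ⟨a, w, rfl⟩)
  · have key : Submodule.span k {t | ∃ b c, t = b * S.y n l * c} ≤
        (S.ySpan n l ρ).comap (ρ.orbit w) := by
      refine Submodule.span_le.2 ?_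
      rintro _ ⟨b, c, rfl⟩
      rw [SetLike.mem_coe, Submodule.mem_comap, AlgRep.orbit_apply, AlgRep.mul_act, AlgRep.mul_act]
      exact Submodule.subset_span ⟨b, _, rfl⟩
    have h := key (S.z_comm n l hl a)
    rw [Submodule.mem_comap, AlgRep.orbit_apply, AlgRep.sub_act, AlgRep.mul_act,
      AlgRep.mul_act] at h
    rw [← sub_add_cancel (ρ a (ρ (S.z n l) w)) (ρ (S.z n l) (ρ a w))]
    exact Submodule.add_mem_sup h ⟨_, rfl⟩

theorem ySpan_eq_range_counit (hl : S.Top (n + 2) l) (ρ : AlgRep k (A (n + 2)) V) :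
    S.ySpan (n + 2) l ρ = LinearMap.range (T.counit ρ) := by
  refine le_antisymm (Submodule.span_le.2 ?_) ?_
  · rintro _ ⟨a, v, rfl⟩
    refine ⟨T.globAct _ a (T.globIn _ ⟨_, u_act_mem_Loc ρ v⟩), ?_⟩
    rw [counit_isHom, counit_globIn, S.y_top _ l hl]
  · rintro _ ⟨y, rfl⟩
    refine glob_induction' (X := (S.ySpan (n + 2) l ρ).comap (T.counit ρ)) (fun a v => ?_) y
    obtain ⟨_, w, rfl⟩ := v
    rw [Submodule.mem_comap, counit_isHom, counit_globIn]
    exact Submodule.subset_span ⟨a, w, by rw [S.y_top _ l hl]⟩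

theorem ySpan_eq_bot (h : S.y n l = 0) (ρ : AlgRep k (A n) V) : S.ySpan n l ρ = ⊥ := by
  refine eq_bot_iff.2 (Submodule.span_le.2 ?_)
  rintro _ ⟨a, v, rfl⟩
  rw [h, AlgRep.zero_act, map_zero]
  exact zero_mem _

section Exact

variable {f : V →ₗ[k] W} {g : W →ₗ[k] Y}

/-- The only place where the counit of the cokernel matters for additivity. Write `f v` as the
counit of `x`; the image of `x` in `Glob(εY)` is zero by injectivity, so `x` lifts to `Glob(εV)`. At
levels `0` and `1` the element `y` is zero. -/
theorem ShortExact.mem_ySpan {ρ : AlgRep k (A n) V} {σ : AlgRep k (A n) W} {τ : AlgRep k (A n) Y}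
    (h : AlgRep.ShortExact ρ σ τ f g) (hτ : Good T τ) (hl : S.Top n l) {v : V}
    (hv : f v ∈ S.ySpan n l σ) : v ∈ S.ySpan n l ρ := by
  have h0 : S.y n l = 0 → v ∈ S.ySpan n l ρ := fun hy => by
    rw [ySpan_eq_bot hy, Submodule.mem_bot, map_eq_zero_iff f h.injective] at hv
    rw [hv]
    exact zero_mem _
  rcases n with _ | _ | n
  · exact h0 (S.y_zero l hl)
  · exact h0 ((S.y_top 0 l hl).trans T.u_zero)
  · rw [ySpan_eq_range_counit hl] at hv ⊢
    obtain ⟨x, hx⟩ := hv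
    have hx0 : T.globMap (locMap_isHom h.hom_right) x = 0 := hτ.1 (by
      rw [counit_naturality, hx, h.comp, map_zero])
    obtain ⟨x', rfl⟩ := exists_of_globMap_eq_zero (locMap_isHom h.hom_left)
      (locMap_isHom h.hom_right) (locMap_surjective h.hom_right h.surjective)
      (locMap_exact h.hom_left h.hom_right h.injective h.exact) hx0
    rw [counit_naturality] at hx
    exact ⟨x', h.injective hx⟩

/-- Modulo `ySpan`, `f v` is an image under `z`, and `z² = c z`; hence `z f v` and `c f v` agree
modulo `ySpan`. This congruence pulls back along `f`, and `c` is invertible. -/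
theorem ShortExact.mem_killSpan {ρ : AlgRep k (A n) V} {σ : AlgRep k (A n) W}
    {τ : AlgRep k (A n) Y} (h : AlgRep.ShortExact ρ σ τ f g) (hτ : Good T τ) (hl : S.Top n l)
    {v : V} (hv : f v ∈ S.killSpan n l σ) : v ∈ S.killSpan n l ρ := by
  obtain ⟨w₀, hw₀, w₁, hw⟩ := exists_of_mem_killSpan hl hv
  obtain ⟨c, hc, hz⟩ := S.z_sq n l hl
  have h1 : f (ρ (S.z n l) v - c • v) = σ (S.z n l) w₀ - c • w₀ := by
    rw [map_sub, map_smul, h.hom_left, hw, map_add, ← AlgRep.mul_act, hz, AlgRep.smul_act, smul_add]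
    abel
  have h2 : ρ (S.z n l) v - c • v ∈ S.ySpan n l ρ := ShortExact.mem_ySpan h hτ hl (by
    rw [h1]
    exact sub_mem (act_mem_ySpan _ hw₀) (Submodule.smul_mem _ _ hw₀))
  have h3 : c • v ∈ S.killSpan n l ρ := by
    rw [← sub_sub_cancel (ρ (S.z n l) v) (c • v)]
    exact sub_mem (z_act_mem_killSpan ρ v) (ySpan_le_killSpan ρ h2)
  have := Submodule.smul_mem _ c⁻¹ h3
  rwa [smul_smul, inv_mul_cancel₀ hc, one_smul] at this

theorem killSpan_le_comap {ρ : AlgRep k (A n) V} {σ : AlgRep k (A n) W}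
    (hf : AlgRep.IsHom ρ σ f) : S.killSpan n l ρ ≤ (S.killSpan n l σ).comap f := by
  refine Submodule.span_le.2 ?_
  rintro _ ⟨a, v, rfl | rfl⟩
  · exact Submodule.subset_span ⟨a, f v, Or.inl (by rw [hf, hf])⟩
  · exact Submodule.subset_span ⟨a, f v, Or.inr (by rw [hf, hf])⟩

theorem killSpan_le_map {ρ : AlgRep k (A n) V} {σ : AlgRep k (A n) W}
    (hf : AlgRep.IsHom ρ σ f) (hs : Function.Surjective f) :
    S.killSpan n l σ ≤ (S.killSpan n l ρ).map f := by
  refine Submodule.span_le.2 ?_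
  rintro _ ⟨a, v, h⟩
  obtain ⟨v, rfl⟩ := hs v
  rcases h with rfl | rfl
  · exact ⟨_, Submodule.subset_span ⟨a, v, Or.inl rfl⟩, by rw [hf, hf]⟩
  · exact ⟨_, Submodule.subset_span ⟨a, v, Or.inr rfl⟩, by rw [hf, hf]⟩

theorem count_add_of_top {ρ : AlgRep k (A n) V} {σ : AlgRep k (A n) W}
    {τ : AlgRep k (A n) Y} (h : AlgRep.ShortExact ρ σ τ f g) (hτ : Good T τ) (hl : S.Top n l) :
    S.count l σ = S.count l ρ + S.count l τ := by
  rw [count_of_top hl, count_of_top hl, count_of_top hl]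
  have hle := killSpan_le_comap (S := S) (l := l) h.hom_left
  have hle' := killSpan_le_comap (S := S) (l := l) h.hom_right
  refine Module.length_eq_add_of_exact (Submodule.mapQ _ _ f hle) (Submodule.mapQ _ _ g hle')
    ((injective_iff_map_eq_zero _).2 fun x hx => ?_) (fun y => ?_) fun x => ⟨fun hx => ?_, ?_⟩
  · obtain ⟨v, rfl⟩ := Submodule.Quotient.mk_surjective _ x
    rw [Submodule.mapQ_apply, Submodule.Quotient.mk_eq_zero] at hx
    exact (Submodule.Quotient.mk_eq_zero _).2 (ShortExact.mem_killSpan h hτ hl hx)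
  · obtain ⟨y, rfl⟩ := Submodule.Quotient.mk_surjective _ y
    obtain ⟨w, rfl⟩ := h.surjective y
    exact ⟨Submodule.Quotient.mk w, rfl⟩
  · obtain ⟨w, rfl⟩ := Submodule.Quotient.mk_surjective _ x
    rw [Submodule.mapQ_apply, Submodule.Quotient.mk_eq_zero] at hx
    obtain ⟨w', hw', hww⟩ := killSpan_le_map h.hom_right h.surjective hx
    obtain ⟨v, hv⟩ := h.exact (w - w') (by rw [map_sub, hww, sub_self])
    refine ⟨Submodule.Quotient.mk v, ?_⟩
    rw [Submodule.mapQ_apply, hv]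
    exact (Submodule.Quotient.eq _).2 (by simpa using hw')
  · rintro ⟨y, rfl⟩
    obtain ⟨v, rfl⟩ := Submodule.Quotient.mk_surjective _ y
    rw [Submodule.mapQ_apply, Submodule.mapQ_apply, h.comp, Submodule.Quotient.mk_zero]

end Exact

theorem ShortExact.loc {ρ : AlgRep k (A (n + 2)) V} {σ : AlgRep k (A (n + 2)) W}
    {τ : AlgRep k (A (n + 2)) Y} {f : V →ₗ[k] W} {g : W →ₗ[k] Y}
    (h : AlgRep.ShortExact ρ σ τ f g) : AlgRep.ShortExact (T.locAct ρ) (T.locAct σ) (T.locAct τ)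
      (T.locMap h.hom_left) (T.locMap h.hom_right) :=
  ⟨locMap_isHom _, locMap_isHom _, locMap_injective _ h.injective,
    locMap_surjective _ h.surjective, fun v => Subtype.ext (h.comp v),
    locMap_exact h.hom_left h.hom_right h.injective h.exact⟩

theorem count_add : ∀ {n : ℕ} {V : Type w} [AddCommGroup V] [Module k V] {W : Type w'}
    [AddCommGroup W] [Module k W] {Y : Type w''} [AddCommGroup Y] [Module k Y]
    {ρ : AlgRep k (A n) V} {σ : AlgRep k (A n) W} {τ : AlgRep k (A n) Y} {f : V →ₗ[k] W}
    {g : W →ₗ[k] Y}, AlgRep.ShortExact ρ σ τ f g → Good T τ → S.IsWeight n l →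
    S.count l σ = S.count l ρ + S.count l τ
  | 0, _, _, _, _, _, _, _, _, _, _, _, _, _, _, h, hτ, hl =>
    count_add_of_top h hτ ((S.isWeight_zero l).1 hl)
  | 1, _, _, _, _, _, _, _, _, _, _, _, _, _, _, h, hτ, hl =>
    count_add_of_top h hτ ((S.isWeight_one l).1 hl)
  | n + 2, _, _, _, _, _, _, _, _, _, _, _, _, _, _, h, hτ, hl => by
    rcases (S.isWeight_succ n l).1 hl with hW | hW
    · rw [count_of_isWeight hW, count_of_isWeight hW, count_of_isWeight hW]
      exact count_add (ShortExact.loc h) hτ.2 hW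
    · exact count_add_of_top h hτ hW

/-- An isomorphism is a short exact sequence with zero cokernel. -/
theorem count_congr {ρ : AlgRep k (A n) V} {σ : AlgRep k (A n) W} {f : V →ₗ[k] W}
    (hf : AlgRep.IsHom ρ σ f) (hi : Function.Injective f) (hs : Function.Surjective f)
    (hl : S.IsWeight n l) : S.count l σ = S.count l ρ := by
  have h : AlgRep.ShortExact ρ σ (σ.quot ⊤ fun a => (Submodule.comap_top (σ a)).ge) f
      (Submodule.mkQ ⊤) :=
    ⟨hf, fun _ _ => rfl, hi, Submodule.mkQ_surjective _, fun _ => Subsingleton.elim _ _,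
      fun w _ => hs w⟩
  rw [count_add h (good_of_subsingleton _) hl, count_of_subsingleton (V := W ⧸ ⊤), add_zero]

theorem counit_globAct_surjective (ρ : AlgRep k (A n) V) :
    Function.Surjective (T.counit (T.globAct ρ)) := by
  intro y
  refine glob_induction' (X := LinearMap.range (T.counit (T.globAct ρ))) (fun a v => ?_) y
  refine ⟨T.globAct _ a (T.globIn _ ⟨T.globIn ρ v, mem_Loc.2 (globIn_u T ρ v)⟩), ?_⟩
  rw [counit_isHom, counit_globIn]

theorem count_globAct (ρ : AlgRep k (A n) V) (hl : S.IsWeight n l) :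
    S.count l (T.globAct ρ) = S.count l ρ := by
  rw [count_of_isWeight hl]
  obtain ⟨f, hf, hi, hs, -⟩ := T.exists_locGlob ρ
  exact count_congr hf hi hs hl

theorem count_globAct_of_top (ρ : AlgRep k (A n) V) (hl : S.Top (n + 2) l) :
    S.count l (T.globAct ρ) = 0 := by
  rw [count_of_top hl, Module.length_eq_zero_iff, Submodule.Quotient.subsingleton_iff]
  exact killSpan_eq_top_of_counit (counit_globAct_surjective ρ) hl

end Labels

/-! ### Modules and representations -/

namespace AlgRep

variable {k : Type u} [Field k] {R : Type u} [Ring R] [Algebra k R]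
variable {X : Type w} [AddCommGroup X] [Module k X] [Module R X] [IsScalarTower k R X]
variable {Y : Type w'} [AddCommGroup Y] [Module k Y] [Module R Y] [IsScalarTower k R Y]

variable (k R X) in
/-- The representation given by a module. -/
def ofModule : AlgRep k R X := Algebra.lsmul k k X

theorem ofModule_act (a : R) (x : X) : ofModule k R X a x = a • x := rfl

theorem ofModule_isHom (f : X →ₗ[R] Y) :
    IsHom (ofModule k R X) (ofModule k R Y) (f.restrictScalars k) := fun a x => f.map_smul a x

variable (k) in
theorem isSimple_ofModule_iff : IsSimpleModule R X ↔ (ofModule k R X).IsSimple :=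
  isSimpleModule_iff_toSpanSingleton_surjective

theorem exists_factor {V : Type*} [AddCommGroup V] [Module k V] {W : Type*} [AddCommGroup W]
    [Module k W] {Z : Type*} [AddCommGroup Z] [Module k Z] {a : V →ₗ[k] W} {b : V →ₗ[k] Z}
    (hs : Function.Surjective a) (h : ∀ v, a v = 0 → b v = 0) :
    ∃ φ : W →ₗ[k] Z, ∀ v, φ (a v) = b v := by
  obtain ⟨s, hs⟩ := a.exists_rightInverse_of_surjective (LinearMap.range_eq_top.2 hs)
  refine ⟨b ∘ₗ s, fun v => sub_eq_zero.1 ?_⟩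
  rw [LinearMap.comp_apply, ← map_sub]
  refine h _ ?_
  rw [map_sub, sub_eq_zero]
  exact LinearMap.congr_fun hs (a v)

end AlgRep

/-! ### Standard modules in terms of `y` and `z` -/

namespace Labels

variable {k : Type u} [Field k] {A : ℕ → Type u} [∀ n, Ring (A n)] [∀ n, Algebra k (A n)] {d : k}
variable {T : Tower k A d} {Λ : Type} {S : Labels T Λ}
variable {n : ℕ} {l m : Λ}

open Tower AlgRep

section Standard

variable {isL : Λ → ∀ (L : Type u) [AddCommGroup L] [Module (A n) L], Prop}

/-- If `x`, one of `y` and `z`, does not kill `v`, then `x v` is an eigenvector of `x` with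
eigenvalue `c ≠ 0`. The cyclic module it generates has a simple quotient in which its class is
non-zero, although `x` should kill that quotient. No finiteness of `X` is needed. -/
theorem factorsIn_iff
    (hL : ∀ μ (L : Type u) [AddCommGroup L] [Module k L] [Module (A n) L]
      [IsScalarTower k (A n) L], isL μ L ↔ S.IsL n μ (ofModule k (A n) L))
    (hl : S.IsWeight n l) (X : Type u) [AddCommGroup X] [Module k X] [Module (A n) X]
    [IsScalarTower k (A n) X] :
    FactorsIn isL (fun μ => S.le μ l) X ↔ S.Kills n l (ofModule k (A n) X) := by
  constructor
  · intro h
    have key : ∀ x : A n, (∃ c : k, c ≠ 0 ∧ x * x = c • x) →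
        (∀ {V : Type u} [AddCommGroup V] [Module k V] (ρ : AlgRep k (A n) V),
          S.Kills n l ρ → ∀ v, ρ x v = 0) → ∀ v : X, x • v = 0 := by
      rintro x ⟨c, hc, hx⟩ hkill v
      by_contra hv
      let N₂ := Submodule.span (A n) {x • v}
      let u : N₂ := ⟨x • v, Submodule.mem_span_singleton_self _⟩
      have hu : x • u = c • u := Subtype.ext (by
        change x • x • v = c • x • v
        rw [smul_smul, hx, smul_assoc])
      have hgen : ∀ N : Submodule (A n) N₂, u ∈ N → N = ⊤ := fun N hN => by
        refine eq_top_iff.2 fun w _ => ?_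
        obtain ⟨a, ha⟩ := Submodule.mem_span_singleton.1 w.2
        have : w = a • u := Subtype.ext ha.symm
        rw [this]
        exact N.smul_mem a hN
      have hfin : Module.Finite (A n) N₂ := Module.Finite.span_singleton (A n) _
      have hnt : (⊥ : Submodule (A n) N₂) ≠ ⊤ := fun hbt => by
        have : u ∈ (⊥ : Submodule (A n) N₂) := hbt ▸ Submodule.mem_top
        exact hv (congrArg Subtype.val ((Submodule.mem_bot _).1 this))
      obtain hb | ⟨N, hN, -⟩ := eq_top_or_exists_le_coatom (⊥ : Submodule (A n) N₂)
      · exact hnt hb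
      have hNN : (N.map N₂.subtype).submoduleOf N₂ = N :=
        Submodule.comap_map_eq_of_injective N₂.injective_subtype N
      obtain ⟨μ, hμ, hμ'⟩ := h (N.map N₂.subtype) N₂ (Submodule.map_subtype_le _ _) (by
        rw [hNN]; exact isSimpleModule_iff_isCoatom.2 hN)
      have h0 := hkill _ (kills_of_le n hl ((hL _ _).1 hμ') hμ) (Submodule.Quotient.mk u)
      rw [ofModule_act, ← Submodule.Quotient.mk_smul, hu, Submodule.Quotient.mk_smul,
        smul_eq_zero_iff_right hc, Submodule.Quotient.mk_eq_zero, hNN] at h0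
      exact hN.1 (hgen N h0)
    obtain ⟨hy, hz⟩ := exists_sq n hl
    exact fun v => ⟨key _ hy (fun ρ h v => (h v).1) v, key _ hz (fun ρ h v => (h v).2) v⟩
  · intro h N₁ N₂ _ hs
    obtain ⟨μ, hμ⟩ := S.exists_isL n ((isSimple_ofModule_iff k).1 hs)
    refine ⟨μ, le_of_kills n hl hμ fun x => ?_, (hL _ _).2 hμ⟩
    obtain ⟨w, rfl⟩ := Submodule.Quotient.mk_surjective _ x
    rw [ofModule_act, ofModule_act, ← Submodule.Quotient.mk_smul, ← Submodule.Quotient.mk_smul]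
    have h1 : S.y n l • w = 0 := Subtype.ext (h w.1).1
    have h2 : S.z n l • w = 0 := Subtype.ext (h w.1).2
    rw [h1, h2]
    exact ⟨rfl, rfl⟩

/-- The submodule generated by the images of `y` and `z` belongs to the family, so the infimum is
attained there. -/
theorem mem_sInf_factorsIn
    (hL : ∀ μ (L : Type u) [AddCommGroup L] [Module k L] [Module (A n) L]
      [IsScalarTower k (A n) L], isL μ L ↔ S.IsL n μ (ofModule k (A n) L))
    (hl : S.IsWeight n l) (P : Type u) [AddCommGroup P] [Module k P] [Module (A n) P]
    [IsScalarTower k (A n) P] (p : P) :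
    p ∈ sInf {N : Submodule (A n) P | FactorsIn isL (fun μ => S.le μ l) (P ⧸ N)} ↔
      p ∈ S.killSpan n l (ofModule k (A n) P) := by
  rw [Submodule.mem_sInf]
  constructor
  · intro h
    let K : Submodule (A n) P :=
      { S.killSpan n l (ofModule k (A n) P) with smul_mem' := fun a _ hp => act_mem_killSpan a hp }
    refine h K ((factorsIn_iff hL hl _).2 fun x => ?_)
    obtain ⟨w, rfl⟩ := Submodule.Quotient.mk_surjective _ x
    exact ⟨(Submodule.Quotient.mk_eq_zero K).2 (Submodule.subset_span ⟨1, w, Or.inl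
      (by rw [AlgRep.one_act]; rfl)⟩), (Submodule.Quotient.mk_eq_zero K).2
      (Submodule.subset_span ⟨1, w, Or.inr (by rw [AlgRep.one_act]; rfl)⟩)⟩
  · intro hp N hN
    have := killSpan_le_ker (ofModule_isHom (k := k) N.mkQ) ((factorsIn_iff hL hl _).1 hN) hp
    exact (Submodule.Quotient.mk_eq_zero N).1 this

/-- A superfluous kernel means that every vector outside it generates `P`; projectivity then splits
the map from the regular module given by one such generator. Conversely these data give back
projectivity and superfluity. -/
theorem isStandardModule_iff
    (hL : ∀ μ (L : Type u) [AddCommGroup L] [Module k L] [Module (A n) L]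
      [IsScalarTower k (A n) L], isL μ L ↔ S.IsL n μ (ofModule k (A n) L))
    (D : Type w) [AddCommGroup D] [Module k D] [Module (A n) D] [IsScalarTower k (A n) D] :
    IsStandardModule S.le isL l D ↔ S.IsStd n l (ofModule k (A n) D) := by
  constructor
  · rintro ⟨P, _, _, L, _, _, π, hLl, ⟨hP, hπ, hsup⟩, ⟨e⟩⟩
    -- The cover comes only with an action of the algebra; its scalars are those acting through
    -- `algebraMap`.
    let _ : Module k P := Module.compHom P (algebraMap k (A n))
    let _ : Module k L := Module.compHom L (algebraMap k (A n))
    have : IsScalarTower k (A n) P := IsScalarTower.of_algebraMap_smul fun _ _ => rfl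
    have : IsScalarTower k (A n) L := IsScalarTower.of_algebraMap_smul fun _ _ => rfl
    have hLl' := (hL l L).1 hLl
    have hgen : ∀ p, π p ≠ 0 → ∀ p' : P, ∃ a : A n, a • p = p' := by
      intro p hp p'
      have htop : Submodule.span (A n) {p} ⊔ LinearMap.ker π = ⊤ := by
        refine eq_top_iff.2 fun x _ => ?_
        obtain ⟨a, ha⟩ := hLl'.2.1.2 _ hp (π x)
        rw [← sub_add_cancel x (a • p), sup_comm]
        refine Submodule.add_mem_sup ?_ (Submodule.smul_mem _ _ (Submodule.mem_span_singleton_self p))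
        rw [LinearMap.mem_ker, map_sub, map_smul, sub_eq_zero]
        exact ha.symm
      exact Submodule.mem_span_singleton.1 ((hsup _ htop).symm ▸ Submodule.mem_top)
    have := hLl'.2.1.1
    obtain ⟨x, hx⟩ := exists_ne (0 : L)
    obtain ⟨p₀, rfl⟩ := hπ x
    obtain ⟨τ, hτ⟩ := Module.projective_lifting_property (LinearMap.toSpanSingleton (A n) P p₀)
      LinearMap.id (hgen p₀ hx)
    refine ⟨P, _, _, ofModule k (A n) P, L, _, _, ofModule k (A n) L, π.restrictScalars k, p₀,
      τ.restrictScalars k, (e.symm.toLinearMap ∘ₗ Submodule.mkQ _).restrictScalars k,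
      ⟨hLl', ofModule_isHom π, ⟨p₀, hx⟩, hgen, fun a p => τ.map_smul a p,
        fun p => LinearMap.congr_fun hτ p⟩, ofModule_isHom _,
      e.symm.surjective.comp (Submodule.mkQ_surjective _), fun p => ?_⟩
    rw [← mem_sInf_factorsIn hL hLl'.1, ← Submodule.Quotient.mk_eq_zero]
    exact e.symm.map_eq_zero_iff
  · rintro ⟨P, _, _, ρP, L, _, _, σ, π, p₀, τ, q, hc, hq, hs, hk⟩
    let _ : Module (A n) P := Module.compHom P ρP.toRingHom
    let _ : Module (A n) L := Module.compHom L σ.toRingHom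
    have : IsScalarTower k (A n) P := ⟨fun c a p => ρP.smul_act c a p⟩
    have : IsScalarTower k (A n) L := ⟨fun c a p => σ.smul_act c a p⟩
    have hk' : ∀ p, q p = 0 ↔ p ∈ S.killSpan n l (ofModule k (A n) P) := hk
    let π' : P →ₗ[A n] L := { π with map_smul' := hc.hom }
    let q' : P →ₗ[A n] D := { q with map_smul' := hq }
    let τ' : P →ₗ[A n] A n := { τ with map_smul' := hc.hom' }
    obtain ⟨p, hp⟩ := hc.ne
    refine ⟨P, _, _, L, _, _, π', (hL _ _).2 hc.isL, ⟨?_, hc.hom.surjective hc.isL.2.1 hp,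
      fun N hN => ?_⟩, ?_⟩
    · exact Module.Projective.of_split τ' (LinearMap.toSpanSingleton (A n) P p₀)
        (LinearMap.ext fun p => hc.split p)
    · have : p ∈ N ⊔ LinearMap.ker π' := hN ▸ Submodule.mem_top
      obtain ⟨x, hx, y, hy, rfl⟩ := Submodule.mem_sup.1 this
      have hx0 : π x ≠ 0 := by
        have hy0 : π y = 0 := hy
        rwa [map_add, hy0, add_zero] at hp
      refine eq_top_iff.2 fun p' _ => ?_
      obtain ⟨a, rfl⟩ := hc.gen x hx0 p'
      exact N.smul_mem a hx
    · have hker : LinearMap.ker q' =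
          sInf {N : Submodule (A n) P | FactorsIn isL (fun μ => S.le μ l) (P ⧸ N)} := by
        ext p
        rw [mem_sInf_factorsIn hL hc.isL.1, ← hk']
        rfl
      rw [← hker]
      exact ⟨(q'.quotKerEquivOfSurjective hs).symm⟩

end Standard

end Labels

namespace AlgRep

variable {k : Type u} [Field k] {R : Type u} [Ring R] [Algebra k R]
variable {M : Type v} [AddCommGroup M] [Module k M] [Module R M] [IsScalarTower k R M]

theorem shortExact_quotient {N N' : Submodule R M} (h : N ≤ N') :
    ShortExact (ofModule k R N) (ofModule k R N')
      (ofModule k R (N' ⧸ N.submoduleOf N')) ((Submodule.inclusion h).restrictScalars k)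
      ((N.submoduleOf N').mkQ.restrictScalars k) := by
  constructor
  · exact ofModule_isHom (Submodule.inclusion h)
  · exact ofModule_isHom (N.submoduleOf N').mkQ
  · exact Submodule.inclusion_injective h
  · exact Submodule.mkQ_surjective (N.submoduleOf N')
  · intro v
    exact (Submodule.Quotient.mk_eq_zero (N.submoduleOf N')).2 v.2
  · intro w hw
    exact ⟨⟨w, (Submodule.Quotient.mk_eq_zero (N.submoduleOf N')).1 hw⟩, rfl⟩

end AlgRep

namespace Labels

variable {k : Type u} [Field k] {A : ℕ → Type u} [∀ n, Ring (A n)] [∀ n, Algebra k (A n)] {d : k}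
variable {T : Tower k A d} {Λ : Type} {S : Labels T Λ}
variable {n : ℕ} {l m : Λ}

open Tower AlgRep

/-! ### Standard filtrations -/

section Filtration

variable {M : Type v} [AddCommGroup M] [Module k M] [Module (A n) M] [IsScalarTower k (A n) M]

theorem eq_sum_of_succ : ∀ {r : ℕ} {c : Fin (r + 1) → ℕ∞} {x : Fin r → ℕ∞}, c 0 = 0 →
    (∀ i : Fin r, c i.succ = c i.castSucc + x i) → c (Fin.last r) = ∑ i, x i
  | 0, _, _, h, _ => h
  | r + 1, c, x, h, hs => by
    rw [← Fin.succ_last, hs, Fin.sum_univ_castSucc,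
      ← eq_sum_of_succ (c := fun i => c i.castSucc) h (fun i => hs i.castSucc)]

variable {isStd : Λ → ∀ (D : Type v) [AddCommGroup D] [Module (A n) D], Prop}

/-- The right-hand side does not involve the filtration. It is additive along `F`, since standard
factors are `Good`, and each factor contributes `1` or `0`. -/
theorem mult_eq_count
    (hS : ∀ μ (D : Type v) [AddCommGroup D] [Module k D] [Module (A n) D]
      [IsScalarTower k (A n) D], isStd μ D ↔ S.IsStd n μ (ofModule k (A n) D))
    (F : StandardFiltration isStd M) (hl : S.IsWeight n l) :
    (F.mult l : ℕ∞) = S.count l (ofModule k (A n) M) := by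
  classical
  have hx : ∀ i : Fin F.length,
      S.count l (ofModule k (A n) (F.sub i.succ ⧸ (F.sub i.castSucc).submoduleOf (F.sub i.succ))) =
      if isStd l (F.sub i.succ ⧸ (F.sub i.castSucc).submoduleOf (F.sub i.succ)) then 1 else 0 := by
    intro i
    split_ifs with h
    · exact count_isStd_self ((hS _ _).1 h)
    · obtain ⟨m, hm⟩ := F.factor i
      have hne : m ≠ l := by rintro rfl; exact h hm
      exact count_isStd_ne hne hl ((hS _ _).1 hm)
  have hsucc : ∀ i : Fin F.length, S.count l (ofModule k (A n) (F.sub i.succ)) =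
      S.count l (ofModule k (A n) (F.sub i.castSucc)) +
      if isStd l (F.sub i.succ ⧸ (F.sub i.castSucc).submoduleOf (F.sub i.succ)) then 1 else 0 := by
    intro i
    obtain ⟨m, hm⟩ := F.factor i
    rw [← hx, count_add (shortExact_quotient (F.mono i.castSucc_le_succ))
      ((hS _ _).1 hm).good hl]
  have h0 : S.count l (ofModule k (A n) (F.sub 0)) = 0 := by
    have : Subsingleton (F.sub 0) := by rw [F.sub_zero]; infer_instance
    exact count_of_subsingleton _
  have hlast : S.count l (ofModule k (A n) M) =
      S.count l (ofModule k (A n) (F.sub (Fin.last _))) :=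
    count_congr (ofModule_isHom (F.sub (Fin.last _)).subtype) Subtype.val_injective
      (fun x => ⟨⟨x, F.sub_last ▸ Submodule.mem_top⟩, rfl⟩) hl
  rw [hlast, eq_sum_of_succ (c := fun i => S.count l (ofModule k (A n) (F.sub i))) h0 hsucc,
    Finset.sum_boole, StandardFiltration.mult,
    Nat.card_eq_fintype_card, Fintype.card_subtype]

end Filtration

/-! ### Globalising a filtration -/

section Glob

variable {M : Type v} [AddCommGroup M] [Module k M] [Module (A n) M] [IsScalarTower k (A n) M]
variable {X : Type w} [AddCommGroup X] [Module k X] [Module (A (n + 2)) X]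
  [IsScalarTower k (A (n + 2)) X]
variable {isStd : Λ → ∀ (D : Type v) [AddCommGroup D] [Module (A n) D], Prop}
variable {isStd' : Λ → ∀ (D : Type w) [AddCommGroup D] [Module (A (n + 2)) D], Prop}
variable {e : T.Glob (ofModule k (A n) M) →ₗ[k] X}

/-- The image of the globalisation of a submodule. -/
noncomputable def globSub (he : IsHom (T.globAct (ofModule k (A n) M)) (ofModule k (A (n + 2)) X) e)
    (N : Submodule (A n) M) : Submodule (A (n + 2)) X :=
  { LinearMap.range (e ∘ₗ T.globMap (ofModule_isHom N.subtype)) with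
    smul_mem' := by
      rintro a _ ⟨y, rfl⟩
      refine ⟨T.globAct _ a y, ?_⟩
      rw [LinearMap.comp_apply, globMap_isHom, he]
      rfl }

theorem mem_globSub {he : IsHom (T.globAct (ofModule k (A n) M)) (ofModule k (A (n + 2)) X) e}
    {N : Submodule (A n) M} {x : X} :
    x ∈ globSub he N ↔ ∃ y, e (T.globMap (ofModule_isHom N.subtype) y) = x := Iff.rfl

theorem glob_subsingleton {V : Type w'} [AddCommGroup V] [Module k V] [Subsingleton V]
    (ρ : AlgRep k (A n) V) : Subsingleton (T.Glob ρ) := by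
  refine subsingleton_of_forall_eq 0 fun y => ?_
  refine (Submodule.mem_bot k).1 (glob_induction' (X := ⊥) (fun a v => ?_) y)
  rw [Subsingleton.elim v 0, map_zero, map_zero]
  exact zero_mem _

theorem globMap_inclusion {N N' : Submodule (A n) M} (h : N ≤ N')
    (y : T.Glob (ofModule k (A n) N)) :
    T.globMap (ofModule_isHom N'.subtype) (T.globMap (ofModule_isHom (Submodule.inclusion h)) y) =
      T.globMap (ofModule_isHom N.subtype) y :=
  globMap_comp _ _ (ofModule_isHom N.subtype) (fun _ => rfl) y

theorem IsStd.of_surjective {V W Z : Type*} [AddCommGroup V] [Module k V] [AddCommGroup W]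
    [Module k W] [AddCommGroup Z] [Module k Z] {ρ : AlgRep k (A n) V} {σ : AlgRep k (A n) W}
    {τ : AlgRep k (A n) Z} {a : V →ₗ[k] W} {b : V →ₗ[k] Z} (h : S.IsStd n l σ)
    (ha : IsHom ρ σ a) (hb : IsHom ρ τ b) (has : Function.Surjective a)
    (hbs : Function.Surjective b) (hab : ∀ v, a v = 0 ↔ b v = 0) : S.IsStd n l τ := by
  obtain ⟨φ, hφ⟩ := exists_factor has (fun v => (hab v).1)
  refine h.congr (f := φ) (fun x w => ?_) ((injective_iff_map_eq_zero _).2 fun w hw => ?_)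
    fun z => ?_
  · obtain ⟨v, rfl⟩ := has w
    rw [← ha, hφ, hφ, hb]
  · obtain ⟨v, rfl⟩ := has w
    rw [hφ] at hw
    exact (hab v).2 hw
  · obtain ⟨v, rfl⟩ := hbs z
    exact ⟨a v, hφ v⟩

/-- The terms are the images of the globalised terms of `F`. Exactness makes each factor the
globalisation of a factor of `F`, which is standard with the same label. -/
theorem nonempty_filtration_glob
    (hS : ∀ μ (D : Type v) [AddCommGroup D] [Module k D] [Module (A n) D]
      [IsScalarTower k (A n) D], isStd μ D ↔ S.IsStd n μ (ofModule k (A n) D))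
    (hS' : ∀ μ (D : Type w) [AddCommGroup D] [Module k D] [Module (A (n + 2)) D]
      [IsScalarTower k (A (n + 2)) D],
      isStd' μ D ↔ S.IsStd (n + 2) μ (ofModule k (A (n + 2)) D))
    (he : IsHom (T.globAct (ofModule k (A n) M)) (ofModule k (A (n + 2)) X) e)
    (hi : Function.Injective e) (hs : Function.Surjective e)
    (F : StandardFiltration isStd M) : Nonempty (StandardFiltration isStd' X) := by
  have hle : ∀ i : Fin F.length, F.sub i.castSucc ≤ F.sub i.succ :=
    fun i => F.mono i.castSucc_le_succ
  -- Downward induction from the whole module: each step `Glob(M_i) → Glob(M_{i+1})` is injective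
  -- because the factor, being standard, is acyclic.
  have hinj : ∀ i, Function.Injective (T.globMap (ofModule_isHom (k := k) (F.sub i).subtype)) := by
    intro i
    induction i using Fin.reverseInduction with
    | last =>
      refine (injective_iff_map_eq_zero _).2 fun y hy => ?_
      let f : M →ₗ[A n] F.sub (Fin.last F.length) :=
        LinearMap.id.codRestrict _ (fun x => F.sub_last ▸ Submodule.mem_top)
      have := globMap_comp (T := T) (ofModule_isHom (k := k) (F.sub (Fin.last F.length)).subtype)
        (ofModule_isHom f) (ofModule_isHom LinearMap.id) (fun _ => rfl) y
      rw [hy, map_zero, globMap_id (ofModule_isHom LinearMap.id) (fun _ => rfl)] at this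
      exact this.symm
    | cast i ih =>
      obtain ⟨μ, hμ⟩ := F.factor i
      have h := shortExact_quotient (k := k) (hle i)
      have h1 := globMap_injective (T := T) h.hom_left h.hom_right h.injective h.surjective h.comp
        h.exact ((hS _ _).1 hμ).acyclic
      intro x y hxy
      rw [← globMap_inclusion (hle i), ← globMap_inclusion (hle i)] at hxy
      exact h1 (ih hxy)
  have hmono : ∀ N N' : Submodule (A n) M, N ≤ N' → globSub he N ≤ globSub he N' := by
    rintro N N' h _ ⟨y, rfl⟩
    exact ⟨T.globMap (ofModule_isHom (Submodule.inclusion h)) y,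
      congrArg e (globMap_inclusion h y)⟩
  refine ⟨⟨F.length, fun i => globSub he (F.sub i), fun i j h => hmono _ _ (F.mono h), ?_, ?_,
    fun i => ?_⟩⟩
  · refine eq_bot_iff.2 ?_
    rintro _ ⟨y, rfl⟩
    have : Subsingleton (F.sub 0) := by rw [F.sub_zero]; infer_instance
    have := glob_subsingleton (T := T) (ofModule k (A n) (F.sub 0))
    rw [Subsingleton.elim y 0, map_zero]
    exact zero_mem _
  · refine eq_top_iff.2 fun x _ => ?_
    obtain ⟨y, rfl⟩ := hs x
    obtain ⟨y, rfl⟩ := globMap_surjective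
      (ofModule_isHom (k := k) (F.sub (Fin.last F.length)).subtype)
      (fun x => ⟨⟨x, F.sub_last ▸ Submodule.mem_top⟩, rfl⟩) y
    exact ⟨y, rfl⟩
  · obtain ⟨μ, hμ⟩ := F.factor i
    have h := shortExact_quotient (k := k) (hle i)
    refine ⟨μ, (hS' _ _).2 ?_⟩
    let c : T.Glob (ofModule k (A n) (F.sub i.succ)) →ₗ[k] globSub he (F.sub i.succ) :=
      (e ∘ₗ T.globMap (ofModule_isHom (F.sub i.succ).subtype)).codRestrict
        ((globSub he (F.sub i.succ)).restrictScalars k) (fun y => ⟨y, rfl⟩)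
    have hcv : ∀ y, (c y : X) = e (T.globMap (ofModule_isHom (F.sub i.succ).subtype) y) :=
      fun _ => rfl
    have hc : IsHom (T.globAct _) (ofModule k (A (n + 2)) _) c := fun a y => Subtype.ext (by
      rw [hcv, globMap_isHom, he]; rfl)
    refine ((hS _ _).1 hμ).glob.of_surjective (globMap_isHom h.hom_right)
      (b := ((globSub he (F.sub i.castSucc)).submoduleOf (globSub he (F.sub i.succ))).mkQ.restrictScalars
        k ∘ₗ c) (fun a y => ?_) (globMap_surjective _ h.surjective) ?_ (fun y => ?_)
    · rw [LinearMap.comp_apply, hc]; rfl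
    · refine (Submodule.mkQ_surjective _).comp ?_
      rintro ⟨_, y, rfl⟩
      exact ⟨y, rfl⟩
    · have h2 : (((globSub he (F.sub i.castSucc)).submoduleOf
          (globSub he (F.sub i.succ))).mkQ.restrictScalars k ∘ₗ c) y = 0 ↔
          (c y : X) ∈ globSub he (F.sub i.castSucc) := Submodule.Quotient.mk_eq_zero _
      rw [h2, mem_globSub]
      constructor
      · intro hy
        obtain ⟨x, rfl⟩ := exists_of_globMap_eq_zero h.hom_left h.hom_right h.surjective h.exact hy
        exact ⟨x, by rw [hcv]; exact congrArg e (globMap_inclusion (hle i) x).symm⟩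
      · rintro ⟨x, hx⟩
        rw [hcv, ← globMap_inclusion (hle i)] at hx
        rw [← hinj _ (hi hx)]
        have h0 := globMap_comp (T := T) h.hom_left h.hom_right
          (ofModule_isHom 0) h.comp x
        refine h0.trans (glob_ext (f' := 0) (globMap_isHom _) (fun a y => (map_zero _).symm)
          (fun v => ?_) x)
        rw [globMap_globIn]
        exact map_zero _

theorem mult_glob
    (hS : ∀ μ (D : Type v) [AddCommGroup D] [Module k D] [Module (A n) D]
      [IsScalarTower k (A n) D], isStd μ D ↔ S.IsStd n μ (ofModule k (A n) D))
    (hS' : ∀ μ (D : Type w) [AddCommGroup D] [Module k D] [Module (A (n + 2)) D]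
      [IsScalarTower k (A (n + 2)) D],
      isStd' μ D ↔ S.IsStd (n + 2) μ (ofModule k (A (n + 2)) D))
    (he : IsHom (T.globAct (ofModule k (A n) M)) (ofModule k (A (n + 2)) X) e)
    (hi : Function.Injective e) (hs : Function.Surjective e)
    (F : StandardFiltration isStd M) (F' : StandardFiltration isStd' X)
    (hl : S.IsWeight (n + 2) l) [Decidable (S.IsWeight n l)] :
    F'.mult l = if S.IsWeight n l then F.mult l else 0 := by
  have h : (F'.mult l : ℕ∞) = S.count l (T.globAct (ofModule k (A n) M)) := by
    rw [mult_eq_count hS' F' hl, count_congr he hi hs hl]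
  split_ifs with hW
  · rw [count_globAct _ hW, ← mult_eq_count hS F hW] at h
    exact_mod_cast h
  · rw [count_globAct_of_top _ (((S.isWeight_succ n l).1 hl).resolve_left hW)] at h
    exact_mod_cast h

end Glob

end Labels

/-! ### Comparison with the tensor product over `A n` -/

namespace Tower

variable {k : Type u} [Field k] {A : ℕ → Type u} [∀ n, Ring (A n)] [∀ n, Algebra k (A n)] {d : k}
variable {n : ℕ}

open AlgRep

theorem exists_globaliseEquiv (T : Tower k A d) {ι : A n →ₐ[k] A (n + 2)} {ε : A (n + 2)}
    (hι : ι = T.inc2 n) (hε : ε = d⁻¹ • T.u (n + 1)) (h : ∀ b, Commute (ι b) ε)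
    (M : Type v) [AddCommGroup M] [Module k M] [Module (A n) M] [IsScalarTower k (A n) M] :
    ∃ e : T.Glob (ofModule k (A n) M) →ₗ[k] Globalise ι ε h M,
      IsHom (T.globAct (ofModule k (A n) M)) (ofModule k (A (n + 2)) (Globalise ι ε h M)) e ∧
      Function.Injective e ∧ Function.Surjective e := by
  let ε' : Submodule.span (A (n + 2)) {ε} := ⟨ε, Submodule.mem_span_singleton_self ε⟩
  have hgen : ∀ x : Submodule.span (A (n + 2)) {ε}, ∃ a : A (n + 2), x = a • ε' := fun x => by
    obtain ⟨a, ha⟩ := Submodule.mem_span_singleton.1 x.2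
    exact ⟨a, Subtype.ext ha.symm⟩
  have hu : T.u (n + 1) • ε' = d • ε' := Subtype.ext (by
    change T.u (n + 1) * ε = d • ε
    rw [hε, mul_smul_comm, T.u_sq, smul_comm])
  have hglob : ∀ v : M, T.globAct (ofModule k (A n) M) ε (T.globIn _ v) = T.globIn _ v := fun v => by
    rw [hε, AlgRep.smul_act, globIn_u, smul_smul, inv_mul_cancel₀ T.d_ne, one_smul]
  let φ : M →ₗ[k] Globalise ι ε h M :=
    (balancedRelations ι ε h M).mkQ.restrictScalars k ∘ₗ TensorProduct.mk k _ M ε'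
  have hφ : ∀ v, φ v = Submodule.Quotient.mk (ε' ⊗ₜ[k] v) := fun _ => rfl
  obtain ⟨e, he, heφ⟩ := T.exists_globLift (ofModule k (A n) M)
    (ofModule k (A (n + 2)) (Globalise ι ε h M)) φ
    (fun b v => by
      rw [ofModule_act, ofModule_act, hφ, hφ, ← Submodule.Quotient.mk_smul]
      have h1 : rightMul ι ε h b ε' ⊗ₜ[k] v - ε' ⊗ₜ[k] (b • v) ∈ balancedRelations ι ε h M :=
        Submodule.subset_span ⟨ε', b, v, rfl⟩
      have h2 : rightMul ι ε h b ε' = T.inc2 n b • ε' := Subtype.ext (by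
        change ε * ι b = T.inc2 n b * ε
        rw [← hι, (h b).eq])
      rw [h2] at h1
      exact ((Submodule.Quotient.eq _).2 h1).symm)
    (fun v => by
      rw [ofModule_act, hφ, ← Submodule.Quotient.mk_smul, TensorProduct.smul_tmul', hu]
      rfl)
  -- The candidate inverse `x ⊗ m ↦ x (1 ⊗ m)`; it is well defined on the balanced tensor product
  -- and does not change `ε ⊗ m`, as `ε` fixes `1 ⊗ m`.
  let G : (Submodule.span (A (n + 2)) {ε}) ⊗[k] M →ₗ[k] T.Glob (ofModule k (A n) M) :=
    TensorProduct.lift (((LinearMap.lcomp k _ (T.globIn (ofModule k (A n) M))).comp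
      (T.globAct (ofModule k (A n) M)).toLinearMap).comp
      ((Submodule.span (A (n + 2)) {ε}).subtype.restrictScalars k))
  have hG : ∀ x m, G (x ⊗ₜ m) = T.globAct _ x.1 (T.globIn _ m) := fun x m => by
    simp only [G, TensorProduct.lift.tmul]
    rfl
  have hGa : ∀ a t, G (a • t) = T.globAct _ a (G t) := fun a t => by
    induction t using TensorProduct.induction_on with
    | zero => rw [smul_zero, map_zero, map_zero]
    | add x y hx hy => rw [smul_add, map_add, map_add, map_add, hx, hy]
    | tmul x m =>
      rw [TensorProduct.smul_tmul', hG, hG, ← AlgRep.mul_act]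
      rfl
  have hker : ∀ t ∈ balancedRelations ι ε h M, G t = 0 := fun t ht => by
    refine Submodule.span_induction (p := fun t _ => G t = 0) ?_ (map_zero _)
      (fun x y _ _ hx hy => by rw [map_add, hx, hy, add_zero])
      (fun a x _ hx => by rw [hGa, hx, map_zero]) ht
    rintro _ ⟨x, b, m, rfl⟩
    rw [map_sub, hG, hG, sub_eq_zero, ← ofModule_act (k := k), ← globIn_act, ← AlgRep.mul_act, ← hι]
    rfl
  refine ⟨e, he, (injective_iff_map_eq_zero _).2 fun y hy => ?_, fun y => ?_⟩
  · have key : y ∈ (LinearMap.range (((balancedRelations ι ε h M).mkQ.restrictScalars k).prod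
        G)).comap (e.prod LinearMap.id) := by
      refine glob_induction' (fun a v => ?_) y
      refine Submodule.mem_comap.2 ⟨a • (ε' ⊗ₜ v), Prod.ext ?_ ?_⟩
      · change Submodule.Quotient.mk (a • (ε' ⊗ₜ[k] v)) = e _
        rw [he, heφ, hφ]
        rfl
      · change G (a • (ε' ⊗ₜ[k] v)) = T.globAct (ofModule k (A n) M) a (T.globIn _ v)
        rw [hGa, hG, hglob]
    obtain ⟨t, ht⟩ := key
    have h1 : Submodule.Quotient.mk t = e y := congrArg Prod.fst ht
    have h2 : G t = y := congrArg Prod.snd ht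
    rw [← h2]
    exact hker t ((Submodule.Quotient.mk_eq_zero _).1 (h1.trans hy))
  · obtain ⟨t, rfl⟩ := Submodule.Quotient.mk_surjective _ y
    induction t using TensorProduct.induction_on with
    | zero => exact ⟨0, map_zero _⟩
    | add x y hx hy =>
      obtain ⟨x', hx'⟩ := hx
      obtain ⟨y', hy'⟩ := hy
      exact ⟨x' + y', by rw [map_add, hx', hy', Submodule.Quotient.mk_add]⟩
    | tmul x m =>
      obtain ⟨a, rfl⟩ := hgen x
      exact ⟨T.globAct _ a (T.globIn _ m), by rw [he, heφ]; rfl⟩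

end Tower

namespace Labels

variable {k : Type u} [Field k] {A : ℕ → Type u} [∀ n, Ring (A n)] [∀ n, Algebra k (A n)] {d : k}
variable {T : Tower k A d} {Λ : Type} {n : ℕ}

open AlgRep

theorem filtration_globalise (S : Labels T Λ) {ι : A n →ₐ[k] A (n + 2)} {ε : A (n + 2)}
    (hι : ι = T.inc2 n) (hε : ε = d⁻¹ • T.u (n + 1)) (h : ∀ b, Commute (ι b) ε)
    {isStd : Λ → ∀ (D : Type v) [AddCommGroup D] [Module (A n) D], Prop}
    {isStd' : Λ → ∀ (D : Type (max u v)) [AddCommGroup D] [Module (A (n + 2)) D], Prop}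
    (hS : ∀ μ (D : Type v) [AddCommGroup D] [Module k D] [Module (A n) D]
      [IsScalarTower k (A n) D], isStd μ D ↔ S.IsStd n μ (ofModule k (A n) D))
    (hS' : ∀ μ (D : Type (max u v)) [AddCommGroup D] [Module k D] [Module (A (n + 2)) D]
      [IsScalarTower k (A (n + 2)) D],
      isStd' μ D ↔ S.IsStd (n + 2) μ (ofModule k (A (n + 2)) D))
    [hd : DecidablePred (S.IsWeight n)]
    (M : Type v) [AddCommGroup M] [Module k M] [Module (A n) M] [IsScalarTower k (A n) M]
    (hM : Nonempty (StandardFiltration isStd M)) :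
    Nonempty (StandardFiltration isStd' (Globalise ι ε h M)) ∧
      ∀ (F : StandardFiltration isStd M) (F' : StandardFiltration isStd' (Globalise ι ε h M)),
        ∀ μ, S.IsWeight (n + 2) μ → F'.mult μ = if S.IsWeight n μ then F.mult μ else 0 := by
  obtain ⟨e, he, hi, hs⟩ := T.exists_globaliseEquiv hι hε h M
  obtain ⟨F⟩ := hM
  exact ⟨nonempty_filtration_glob hS hS' he hi hs F,
    fun F F' μ hμ => mult_glob hS hS' he hi hs F F' hμ⟩

end Labels

/-! ### Presentations -/

section Generators

variable {k : Type u} [Field k] {R : Type v} [Ring R] [Algebra k R] {G : Set R}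

theorem exists_sub_algebraMap_mem (hG : Algebra.adjoin k G = ⊤) {X : Submodule k R}
    (hl : ∀ a, ∀ x ∈ X, a * x ∈ X) (hr : ∀ a, ∀ x ∈ X, x * a ∈ X)
    (h : ∀ g ∈ G, ∃ c, g - algebraMap k R c ∈ X) (a : R) : ∃ c, a - algebraMap k R c ∈ X := by
  have ha : a ∈ Algebra.adjoin k G := hG ▸ Algebra.mem_top
  induction ha using Algebra.adjoin_induction with
  | mem x hx => exact h x hx
  | algebraMap r => exact ⟨r, by rw [sub_self]; exact X.zero_mem⟩
  | add x y _ _ hx hy =>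
    obtain ⟨c, hc⟩ := hx
    obtain ⟨c', hc'⟩ := hy
    refine ⟨c + c', ?_⟩
    rw [map_add, add_sub_add_comm]
    exact X.add_mem hc hc'
  | mul x y _ _ hx hy =>
    obtain ⟨c, hc⟩ := hx
    obtain ⟨c', hc'⟩ := hy
    refine ⟨c * c', ?_⟩
    have : x * y - algebraMap k R (c * c') =
        (x - algebraMap k R c) * y + algebraMap k R c * (y - algebraMap k R c') := by
      rw [map_mul, sub_mul, mul_sub, sub_add_sub_cancel]
    rw [this]
    exact X.add_mem (hr _ _ hc) (hl _ _ hc')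

theorem commutator_mem (hG : Algebra.adjoin k G = ⊤) {X : Submodule k R}
    (hl : ∀ a, ∀ x ∈ X, a * x ∈ X) (hr : ∀ a, ∀ x ∈ X, x * a ∈ X) {z : R}
    (h : ∀ g ∈ G, g * z - z * g ∈ X) (a : R) : a * z - z * a ∈ X := by
  have ha : a ∈ Algebra.adjoin k G := hG ▸ Algebra.mem_top
  induction ha using Algebra.adjoin_induction with
  | mem x hx => exact h x hx
  | algebraMap r => rw [Algebra.commutes, sub_self]; exact X.zero_mem
  | add x y _ _ hx hy =>
    rw [add_mul, mul_add, add_sub_add_comm]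
    exact X.add_mem hx hy
  | mul x y _ _ hx hy =>
    have : x * y * z - z * (x * y) = x * (y * z - z * y) + (x * z - z * x) * y := by
      rw [mul_sub, sub_mul]
      simp only [mul_assoc]
      rw [sub_add_sub_cancel]
    rw [this]
    exact X.add_mem (hl _ _ hy) (hr _ _ hx)

theorem commute_of_adjoin (hG : Algebra.adjoin k G = ⊤) {S : Type w} [Ring S] [Algebra k S]
    (f : R →ₐ[k] S) {z : S} (h : ∀ g ∈ G, z * f g = f g * z) (a : R) : z * f a = f a * z := by
  have ha : a ∈ Algebra.adjoin k G := hG ▸ Algebra.mem_top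
  induction ha using Algebra.adjoin_induction with
  | mem x hx => exact h x hx
  | algebraMap r => rw [AlgHom.commutes, Algebra.commutes]
  | add x y _ _ hx hy => rw [map_add, mul_add, add_mul, hx, hy]
  | mul x y _ _ hx hy => rw [map_mul, ← mul_assoc, hx, mul_assoc, hy, mul_assoc]

variable (k) in
theorem mul_mem_twoSided (y z a x : R)
    (hx : x ∈ Submodule.span k {t | ∃ b c, t = b * y * c ∨ t = b * z * c}) :
    a * x ∈ Submodule.span k {t | ∃ b c, t = b * y * c ∨ t = b * z * c} ∧
    x * a ∈ Submodule.span k {t | ∃ b c, t = b * y * c ∨ t = b * z * c} := by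
  constructor
  · refine (Submodule.span_le.2 ?_ : _ ≤ Submodule.comap (LinearMap.mulLeft k a)
      (Submodule.span k {t | ∃ b c, t = b * y * c ∨ t = b * z * c})) hx
    rintro _ ⟨b, c, rfl | rfl⟩
    · exact Submodule.subset_span ⟨a * b, c, Or.inl (by simp [mul_assoc])⟩
    · exact Submodule.subset_span ⟨a * b, c, Or.inr (by simp [mul_assoc])⟩
  · refine (Submodule.span_le.2 ?_ : _ ≤ Submodule.comap (LinearMap.mulRight k a)
      (Submodule.span k {t | ∃ b c, t = b * y * c ∨ t = b * z * c})) hx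
    rintro _ ⟨b, c, rfl | rfl⟩
    · exact Submodule.subset_span ⟨b, c * a, Or.inl (by simp [mul_assoc])⟩
    · exact Submodule.subset_span ⟨b, c * a, Or.inr (by simp [mul_assoc])⟩

end Generators

/-! ### The Temperley–Lieb algebras -/

namespace TL

variable {k : Type u} [Field k] {q : k}

theorem adjoin_U (n : ℕ) :
    Algebra.adjoin k {x | ∃ i, (1 ≤ i ∧ i < n) ∧ U k q n i = x} = ⊤ := by
  refine eq_top_iff.2 fun a _ => ?_
  obtain ⟨x, rfl⟩ := RingQuot.mkAlgHom_surjective k (Rel k q n) a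
  induction x using FreeAlgebra.induction with
  | grade0 r => rw [AlgHom.commutes]; exact Subalgebra.algebraMap_mem _ r
  | grade1 i => exact Algebra.subset_adjoin ⟨i.1, i.2, dif_pos i.2⟩
  | mul a b ha hb => rw [map_mul]; exact mul_mem (ha trivial) (hb trivial)
  | add a b ha hb => rw [map_add]; exact add_mem (ha trivial) (hb trivial)

theorem hom_ext {n : ℕ} {S : Type w} [Ring S] [Algebra k S] {f g : Alg k q n →ₐ[k] S}
    (h : ∀ i, 1 ≤ i ∧ i < n → f (U k q n i) = g (U k q n i)) : f = g :=
  AlgHom.ext_of_adjoin_eq_top (adjoin_U n) (by rintro _ ⟨i, hi, rfl⟩; exact h i hi)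

theorem exists_lift (n : ℕ) {S : Type w} [Ring S] [Algebra k S] (g : ℕ → S)
    (hsq : ∀ i, 1 ≤ i ∧ i < n → g i * g i = (q + q⁻¹) • g i)
    (hbraid : ∀ i j, 1 ≤ i ∧ i < n → 1 ≤ j ∧ j < n → i = j + 1 ∨ j = i + 1 →
      g i * g j * g i = g i)
    (hcomm : ∀ i j, 1 ≤ i ∧ i < n → 1 ≤ j ∧ j < n → ¬ (i = j + 1 ∨ j = i + 1) →
      g i * g j = g j * g i) :
    ∃ Φ : Alg k q n →ₐ[k] S, ∀ i, 1 ≤ i ∧ i < n → Φ (U k q n i) = g i := by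
  refine ⟨RingQuot.liftAlgHom k ⟨FreeAlgebra.lift k fun i : Gen n => g i.1, ?_⟩, fun i hi => ?_⟩
  · intro x y hxy
    cases hxy with
    | sq i => simpa only [map_mul, map_smul, FreeAlgebra.lift_ι_apply] using hsq _ i.2
    | braid i j h =>
      simpa only [map_mul, FreeAlgebra.lift_ι_apply] using hbraid _ _ i.2 j.2 h
    | comm i j h => simpa only [map_mul, FreeAlgebra.lift_ι_apply] using hcomm _ _ i.2 j.2 h
  · rw [U, dif_pos hi, RingQuot.liftAlgHom_mkAlgHom_apply, FreeAlgebra.lift_ι_apply]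

theorem exists_inc (n : ℕ) : ∃ Φ : Alg k q n →ₐ[k] Alg k q (n + 1),
    ∀ i, 1 ≤ i ∧ i < n → Φ (U k q n i) = U k q (n + 1) i :=
  exists_lift n _ (fun i _ => U_sq _ i) (fun _ _ _ hj h => U_braid _ (by omega) h)
    (fun _ _ _ _ h => U_comm _ h)

variable (k q) in
/-- The inclusion `T_n → T_{n+1}`. -/
noncomputable def inc (n : ℕ) : Alg k q n →ₐ[k] Alg k q (n + 1) := (exists_inc n).choose

theorem inc_U {n i : ℕ} (hi : i < n) : inc k q n (U k q n i) = U k q (n + 1) i := by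
  rcases Nat.eq_zero_or_pos i with rfl | h
  · rw [U, dif_neg (by omega), U, dif_neg (by omega), map_zero]
  · exact (exists_inc n).choose_spec i ⟨h, hi⟩

theorem exists_algebraMap {n : ℕ} (hn : n ≤ 1) (a : Alg k q n) :
    ∃ c, a = algebraMap k (Alg k q n) c := by
  have ha : a ∈ Algebra.adjoin k {x | ∃ i, (1 ≤ i ∧ i < n) ∧ U k q n i = x} :=
    adjoin_U (k := k) (q := q) n ▸ Algebra.mem_top
  have he : {x | ∃ i, (1 ≤ i ∧ i < n) ∧ U k q n i = x} = ∅ := by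
    refine Set.eq_empty_of_forall_notMem ?_
    rintro _ ⟨i, hi, rfl⟩
    omega
  rw [he, Algebra.adjoin_empty] at ha
  obtain ⟨c, rfl⟩ := Algebra.mem_bot.1 ha
  exact ⟨c, rfl⟩

theorem nonempty_counit : Nonempty (Alg k q 1 →ₐ[k] k) := by
  obtain ⟨Φ, -⟩ := exists_lift (q := q) 1 (fun _ => (0 : k)) (fun _ _ => by omega)
    (fun _ _ _ _ => by omega) (fun _ _ _ _ => by omega)
  exact ⟨Φ⟩

variable (q) in
/-- The tower of the Temperley–Lieb algebras. -/
noncomputable def tower (h2 : q + q⁻¹ ≠ 0) : Tower k (Alg k q) (q + q⁻¹) where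
  inc := inc k q
  u n := U k q (n + 1) n
  cap := (q + q⁻¹) • (nonempty_counit (k := k) (q := q)).some.toLinearMap
  d_ne := h2
  scalar := exists_algebraMap (by omega)
  cap_one := by simp
  u_zero := dif_neg (by omega)
  u_sq n := U_sq _ _
  u_comm n b := by
    refine commute_of_adjoin (adjoin_U n) ((inc k q (n + 1)).comp (inc k q n)) ?_ b
    rintro _ ⟨i, hi, rfl⟩
    rw [AlgHom.comp_apply, inc_U hi.2, inc_U (by omega)]
    exact U_comm _ (by omega)
  u_cap x := by
    obtain ⟨c, rfl⟩ := exists_algebraMap le_rfl x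
    rw [AlgHom.commutes, LinearMap.smul_apply, AlgHom.toLinearMap_apply, AlgHom.commutes,
      ← Algebra.commutes, mul_assoc, U_sq, ← Algebra.smul_def, smul_smul, smul_eq_mul,
      Algebra.algebraMap_self_apply, mul_comm]
  braid_up n := by
    rw [inc_U (by omega)]
    exact U_braid _ (by omega) (by omega)
  braid_down n := by
    rcases n with _ | n
    · rw [U, dif_neg (by omega), map_zero, zero_mul, zero_mul]
    · rw [inc_U (by omega)]
      exact U_braid _ (by omega) (by omega)
  adjoin n := by
    refine eq_top_iff.2 ((adjoin_U (n + 2)).ge.trans (Algebra.adjoin_mono ?_))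
    rintro _ ⟨i, hi, rfl⟩
    rcases (show i < n + 1 ∨ i = n + 1 by omega) with h | rfl
    · exact Or.inl ⟨U k q (n + 1) i, inc_U h⟩
    · exact Or.inr rfl
  lift_one S _ _ φ s hs := by
    have h1 : s * s = (q + q⁻¹) • s := by simpa using hs 1
    obtain ⟨Φ, hΦ⟩ := exists_lift (q := q) 2 (fun _ => s) (fun _ _ => h1)
      (fun _ _ _ _ => by omega) (fun _ _ _ _ _ => rfl)
    refine ⟨Φ, fun x => ?_, hΦ 1 (by omega)⟩
    exact DFunLike.congr_fun (hom_ext (f := Φ.comp (inc k q 1)) (g := φ) (fun i hi => by omega)) x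
  lift_succ n S _ _ φ s hsq hcomm hb1 hb2 := by
    have hφ : ∀ i, i < n + 1 →
        s * φ (U k q (n + 2) i) = φ (U k q (n + 2) i) * s := fun i hi => by
      rw [← inc_U hi]; exact hcomm _
    suffices ∃ Φ : Alg k q (n + 3) →ₐ[k] S, ∀ i, 1 ≤ i ∧ i < n + 3 → Φ (U k q (n + 3) i) =
        if i = n + 2 then s else φ (U k q (n + 2) i) by
      obtain ⟨Φ, hΦ⟩ := this
      refine ⟨Φ, fun x => ?_, ?_⟩
      · refine DFunLike.congr_fun (hom_ext (f := Φ.comp (inc k q (n + 2))) (g := φ)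
          (fun i hi => ?_)) x
        rw [AlgHom.comp_apply, inc_U hi.2, hΦ _ (by omega), if_neg (by omega)]
      · rw [hΦ _ (by omega), if_pos rfl]
    refine exists_lift (q := q) (n + 3) (fun i => if i = n + 2 then s else φ (U k q (n + 2) i))
      ?_ ?_ ?_
    · intro i hi
      split_ifs
      · exact hsq
      · rw [← map_mul, U_sq, map_smul]
    · intro i j hi hj h
      split_ifs with h1 h2 h2
      · omega
      · obtain rfl : j = n + 1 := by omega
        exact hb1
      · obtain rfl : i = n + 1 := by omega
        exact hb2
      · rw [← map_mul, ← map_mul, U_braid _ (by omega) h]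
    · intro i j hi hj h
      split_ifs with h1 h2 h2
      · rfl
      · exact hφ _ (by omega)
      · exact (hφ _ (by omega)).symm
      · rw [← map_mul, ← map_mul, U_comm _ h]

theorem inc2_U (h2 : q + q⁻¹ ≠ 0) {n i : ℕ} (hi : i < n) :
    (tower q h2).inc2 n (U k q n i) = U k q (n + 2) i := by
  rw [Tower.inc2_apply]
  exact (congrArg _ (inc_U hi)).trans (inc_U (by omega))

theorem incl_eq_inc2 (h2 : q + q⁻¹ ≠ 0) (n : ℕ) : incl k q n = (tower q h2).inc2 n := by
  refine hom_ext fun i hi => ?_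
  rw [inc2_U h2 hi.2, incl]
  conv_lhs => rw [U, dif_pos hi]
  rw [RingQuot.liftAlgHom_mkAlgHom_apply, FreeAlgebra.lift_ι_apply]

theorem loc_succ (h2 : q + q⁻¹ ≠ 0) (n j : ℕ) :
    loc k q (n + 2) (j + 1) = (tower q h2).u (n + 1) * (tower q h2).inc2 n (loc k q n j) := by
  induction j with
  | zero =>
    rw [loc, loc, loc, map_one, one_mul, mul_one]
    rfl
  | succ j ih =>
    have hU : U k q (n + 2) (n - 1 - 2 * j) =
        (tower q h2).inc2 n (U k q n (n - 1 - 2 * j)) := by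
      -- With truncated subtraction the index is `0` when `n = 0`, where the convention makes both
      -- generators zero.
      rcases Nat.eq_zero_or_pos n with rfl | hn
      · rw [U, dif_neg (by omega), U, dif_neg (by omega), map_zero]
      · rw [inc2_U h2 (by omega)]
    rw [loc, ih, loc.eq_2 k q n j, map_mul, ← hU, ← mul_assoc,
      show n + 2 - 1 - 2 * (j + 1) = n - 1 - 2 * j by omega]

/-- Descent from the last generator by `U_i = U_i U_{i+1} U_i`. -/
theorem U_mem_span {n : ℕ} (z : Alg k q (n + 1)) (j : ℕ) : ∀ i, 1 ≤ i → i + j = n →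
    U k q (n + 1) i ∈ Submodule.span k {t | ∃ b c, t = b * U k q (n + 1) n * c ∨ t = b * z * c} := by
  induction j with
  | zero =>
    rintro i - rfl
    exact Submodule.subset_span ⟨1, 1, Or.inl (by simp)⟩
  | succ j ih =>
    intro i hi hn
    rw [← U_braid (n + 1) (i := i) (j := i + 1) (by omega) (by omega)]
    exact (mul_mem_twoSided k _ _ _ _ (mul_mem_twoSided k _ _ _ _
      (ih (i + 1) (by omega) (by omega))).1).2

theorem mem_weights {n l : ℕ} : l ∈ weights n ↔ l ≤ n ∧ l % 2 = n % 2 := by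
  simp [weights]

/-- The labels of the simple modules of the Temperley–Lieb algebras. -/
noncomputable def labels (h2 : q + q⁻¹ ≠ 0) : Labels (tower q h2) ℕ where
  IsWeight n l := l ∈ weights n
  Top n l := l = n
  le m l := l ≤ m
  s n l := loc k q n ((n - l) / 2)
  y n l := loc k q n ((n - l) / 2 + 1)
  -- Each level has a single top label, so no second element is needed to separate characters.
  z _ _ := 0
  isWeight_zero l := by rw [mem_weights]; omega
  isWeight_one l := by rw [mem_weights]; omega
  isWeight_succ n l := by rw [mem_weights, mem_weights]; omega
  not_top n l := by rw [mem_weights]; omega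
  s_top n l h := by rw [h, Nat.sub_self, Nat.zero_div, loc]
  s_succ n l h := by
    rw [mem_weights] at h
    rw [show (n + 2 - l) / 2 = (n - l) / 2 + 1 by omega, loc_succ h2]
  y_zero l h := by
    rw [h, loc, U, dif_neg (by omega), mul_zero]
  y_top n l h := by
    rw [h, show (n + 1 - (n + 1)) / 2 + 1 = 0 + 1 by omega, loc, loc, one_mul]
    rfl
  y_succ n l h := by
    rw [mem_weights] at h
    rw [show (n + 2 - l) / 2 = (n - l) / 2 + 1 by omega, loc_succ h2]
  z_succ n l h := by rw [map_zero, mul_zero]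
  z_sq n l h := ⟨1, one_ne_zero, by simp⟩
  z_comm n l h a := by rw [mul_zero, zero_mul, sub_zero]; exact zero_mem _
  scalar n l h a := by
    subst h
    rcases l with _ | n
    · obtain ⟨c, rfl⟩ := exists_algebraMap (by omega) a
      exact ⟨c, by rw [sub_self]; exact zero_mem _⟩
    · refine exists_sub_algebraMap_mem (adjoin_U (n + 1))
        (fun a x hx => (mul_mem_twoSided k _ _ _ _ hx).1)
        (fun a x hx => (mul_mem_twoSided k _ _ _ _ hx).2) ?_ a
      rintro _ ⟨i, hi, rfl⟩
      refine ⟨0, ?_⟩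
      rw [map_zero, sub_zero, show (n + 1 - (n + 1)) / 2 + 1 = 0 + 1 by omega, loc, loc, one_mul]
      exact U_mem_span _ (n - i) i hi.1 (by omega)
  exists_top_zero L _ _ ρ _ := ⟨0, rfl, fun v => ρ.zero_act v⟩
  exists_top n L _ _ ρ _ _ := ⟨n + 1, rfl, fun v => ρ.zero_act v⟩
  top_unique n l m hl hm h := absurd (hl.trans hm.symm) h
  le_refl l := le_rfl
  top_le n l m hl hm := by rw [mem_weights] at hl; omega
  eq_of_le_top n l m hl hm h := by rw [mem_weights] at hm; omega

open AlgRep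

theorem isSimpleOfWeight_iff (h2 : q + q⁻¹ ≠ 0) {n : ℕ} (μ : ℕ) (L : Type v) [AddCommGroup L]
    [Module k L] [Module (Alg k q n) L] [IsScalarTower k (Alg k q n) L] :
    IsSimpleOfWeight k q n μ L ↔ (labels h2).IsL n μ (ofModule k (Alg k q n) L) := by
  unfold IsSimpleOfWeight
  rw [isSimple_ofModule_iff k]
  refine and_congr_right fun _ => and_congr_right fun _ => and_congr_right fun _ =>
    forall_congr' fun v => ?_
  exact ⟨fun h => ⟨h, zero_act _ v⟩, fun h => h.1⟩

theorem isStandard_iff (h2 : q + q⁻¹ ≠ 0) {n : ℕ} (μ : ℕ) (D : Type v) [AddCommGroup D]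
    [Module k D] [Module (Alg k q n) D] [IsScalarTower k (Alg k q n) D] :
    IsStandard k q n μ D ↔ (labels h2).IsStd n μ (ofModule k (Alg k q n) D) :=
  Labels.isStandardModule_iff (S := labels h2) (fun μ L => isSimpleOfWeight_iff h2 μ L) D

theorem glob_filtration (h2 : q + q⁻¹ ≠ 0) (n : ℕ) (M : Type v) [AddCommGroup M] [Module k M]
    [Module (Alg k q n) M] [IsScalarTower k (Alg k q n) M] (hM : Nonempty (Filtration k q n M)) :
    Nonempty (Filtration k q (n + 2) (G k q n M)) ∧
      ∀ (F : Filtration k q n M) (F' : Filtration k q (n + 2) (G k q n M)),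
        ∀ μ ∈ weights (n + 2), F'.mult μ = if μ ∈ weights n then F.mult μ else 0 :=
  Labels.filtration_globalise (labels h2) (incl_eq_inc2 h2 n) rfl (incl_commute_eps n)
    (fun μ D => isStandard_iff h2 μ D) (fun μ D => isStandard_iff h2 μ D)
    (hd := fun μ => Finset.decidableMem μ (weights n)) M hM

end TL

/-! ### The blob algebras -/

namespace Blob

section Identities

variable {k : Type u} [Field k] {R : Type v} [Ring R] [Algebra k R] {δ : k} {x : R}

theorem smul_one_add_mul (hx : x * x = δ • x) (a b a' b' : k) :
    (a • (1 : R) + b • x) * (a' • (1 : R) + b' • x) =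
      (a * a') • (1 : R) + (a * b' + b * a' + b * b' * δ) • x := by
  simp only [add_mul, mul_add, smul_mul_assoc, mul_smul_comm, one_mul, mul_one, hx, smul_smul,
    add_smul]
  module

theorem mul_smul_one_add_mul {c γ : k} {s : R} (hs : s * s = c • s) (hx : s * x * s = γ • s)
    (a b : k) : s * (a • (1 : R) + b • x) * s = (a • c + b • γ) • s := by
  rw [mul_add, add_mul, mul_smul_comm, mul_smul_comm, smul_mul_assoc, smul_mul_assoc, mul_one, hs,
    hx, add_smul, smul_smul, smul_smul, smul_eq_mul, smul_eq_mul]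

theorem sub_algebraMap_sq (hx : x * x = δ • x) :
    (x - algebraMap k R δ) * (x - algebraMap k R δ) = (-δ) • (x - algebraMap k R δ) := by
  rw [mul_sub, sub_mul, hx, ← Algebra.smul_def, sub_self, zero_sub, ← Algebra.commutes,
    ← Algebra.smul_def, neg_smul]

theorem inv_mul_add_mul_sub (hδ : δ ≠ 0) (x : R) : algebraMap k R δ⁻¹ * x +
    algebraMap k R (-δ⁻¹) * (x - algebraMap k R δ) = 1 := by
  rw [mul_sub, ← map_mul, neg_mul, inv_mul_cancel₀ hδ, map_neg, map_neg, map_one, neg_mul]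
  abel

end Identities

variable {k : Type u} [Field k] {q γ δ : k}

theorem adjoin_gens (n : ℕ) : Algebra.adjoin k
    {x | x = e k q γ δ n ∨ ∃ i, (1 ≤ i ∧ i < n) ∧ U k q γ δ n i = x} = ⊤ := by
  refine eq_top_iff.2 fun a _ => ?_
  obtain ⟨x, rfl⟩ := RingQuot.mkAlgHom_surjective k (Rel k q γ δ n) a
  induction x using FreeAlgebra.induction with
  | grade0 r => rw [AlgHom.commutes]; exact Subalgebra.algebraMap_mem _ r
  | grade1 g =>
    cases g with
    | e h => exact Algebra.subset_adjoin (Or.inl (by rw [Blob.e, dif_pos h]))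
    | U i h => exact Algebra.subset_adjoin (Or.inr ⟨i, h, dif_pos h⟩)
  | mul a b ha hb => rw [map_mul]; exact mul_mem (ha trivial) (hb trivial)
  | add a b ha hb => rw [map_add]; exact add_mem (ha trivial) (hb trivial)

theorem e_zero : e k q γ δ 0 = 0 := dif_neg (by omega)

theorem hom_ext {n : ℕ} {S : Type w} [Ring S] [Algebra k S] {f g : Alg k q γ δ n →ₐ[k] S}
    (he : 0 < n → f (e k q γ δ n) = g (e k q γ δ n))
    (h : ∀ i, 1 ≤ i ∧ i < n → f (U k q γ δ n i) = g (U k q γ δ n i)) : f = g := by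
  refine AlgHom.ext_of_adjoin_eq_top (adjoin_gens n) ?_
  rintro _ (rfl | ⟨i, hi, rfl⟩)
  · rcases Nat.eq_zero_or_pos n with rfl | hn
    · rw [e_zero, map_zero, map_zero]
    · exact he hn
  · exact h i hi

theorem exists_lift (n : ℕ) {S : Type w} [Ring S] [Algebra k S] (x : S) (g : ℕ → S)
    (hsq : ∀ i, 1 ≤ i ∧ i < n → g i * g i = (q + q⁻¹) • g i)
    (hbraid : ∀ i j, 1 ≤ i ∧ i < n → 1 ≤ j ∧ j < n → i = j + 1 ∨ j = i + 1 →
      g i * g j * g i = g i)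
    (hcomm : ∀ i j, 1 ≤ i ∧ i < n → 1 ≤ j ∧ j < n → ¬ (i = j + 1 ∨ j = i + 1) →
      g i * g j = g j * g i)
    (hUeU : 1 < n → g 1 * x * g 1 = γ • g 1) (hee : 0 < n → x * x = δ • x)
    (hUe : ∀ i, 1 ≤ i ∧ i < n → i ≠ 1 → g i * x = x * g i) :
    ∃ Φ : Alg k q γ δ n →ₐ[k] S, (0 < n → Φ (e k q γ δ n) = x) ∧
      ∀ i, 1 ≤ i ∧ i < n → Φ (U k q γ δ n i) = g i := by
  let f : Gen n → S := fun
    | .e _ => x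
    | .U i _ => g i
  refine ⟨RingQuot.liftAlgHom k ⟨FreeAlgebra.lift k f, ?_⟩, fun h => ?_, fun i hi => ?_⟩
  · intro a b hab
    cases hab with
    | sq i hi => simpa only [map_mul, map_smul, FreeAlgebra.lift_ι_apply] using hsq i hi
    | braid i j hi hj h =>
      simpa only [map_mul, FreeAlgebra.lift_ι_apply] using hbraid i j hi hj h
    | comm i j hi hj h =>
      simpa only [map_mul, FreeAlgebra.lift_ι_apply] using hcomm i j hi hj h
    | UeU he h1 => simpa only [map_mul, map_smul, FreeAlgebra.lift_ι_apply] using hUeU h1.2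
    | ee he => simpa only [map_mul, map_smul, FreeAlgebra.lift_ι_apply] using hee he
    | Ue he i hi h => simpa only [map_mul, FreeAlgebra.lift_ι_apply] using hUe i hi h
  · rw [e, dif_pos h, RingQuot.liftAlgHom_mkAlgHom_apply, FreeAlgebra.lift_ι_apply]
  · rw [U, dif_pos hi, RingQuot.liftAlgHom_mkAlgHom_apply, FreeAlgebra.lift_ι_apply]

theorem exists_inc (n : ℕ) : ∃ Φ : Alg k q γ δ n →ₐ[k] Alg k q γ δ (n + 1),
    (0 < n → Φ (e k q γ δ n) = e k q γ δ (n + 1)) ∧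
    ∀ i, 1 ≤ i ∧ i < n → Φ (U k q γ δ n i) = U k q γ δ (n + 1) i :=
  exists_lift n _ _ (fun i _ => U_sq _ i) (fun _ _ _ hj h => U_braid _ (by omega) h)
    (fun _ _ _ _ h => U_comm _ h) (fun _ => U_e_U _) (fun _ => e_e _) (fun _ _ h => U_e _ h)

variable (k q γ δ) in
/-- The inclusion `b_n → b_{n+1}`. -/
noncomputable def inc (n : ℕ) : Alg k q γ δ n →ₐ[k] Alg k q γ δ (n + 1) := (exists_inc n).choose

theorem inc_U {n i : ℕ} (hi : i < n) :
    inc k q γ δ n (U k q γ δ n i) = U k q γ δ (n + 1) i := by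
  rcases Nat.eq_zero_or_pos i with rfl | h
  · rw [U, dif_neg (by omega), U, dif_neg (by omega), map_zero]
  · exact (exists_inc n).choose_spec.2 i ⟨h, hi⟩

theorem inc_e {n : ℕ} (hn : 0 < n) : inc k q γ δ n (e k q γ δ n) = e k q γ δ (n + 1) :=
  (exists_inc n).choose_spec.1 hn

theorem exists_algebraMap (a : Alg k q γ δ 0) : ∃ c, a = algebraMap k (Alg k q γ δ 0) c := by
  obtain ⟨c, hc⟩ := exists_sub_algebraMap_mem (adjoin_gens 0) (X := ⊥)
    (fun a x hx => by rw [(Submodule.mem_bot k).1 hx, mul_zero]; exact zero_mem _)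
    (fun a x hx => by rw [(Submodule.mem_bot k).1 hx, zero_mul]; exact zero_mem _)
    (by
      rintro _ (rfl | ⟨i, hi, rfl⟩)
      · exact ⟨0, by rw [e_zero, map_zero, sub_zero]; exact zero_mem _⟩
      · omega) a
  exact ⟨c, sub_eq_zero.1 ((Submodule.mem_bot k).1 hc)⟩

theorem exists_smul_one_add (a : Alg k q γ δ 1) :
    ∃ c c' : k, a = c • (1 : Alg k q γ δ 1) + c' • e k q γ δ 1 := by
  have ha : a ∈ Algebra.adjoin k
      {x | x = e k q γ δ 1 ∨ ∃ i, (1 ≤ i ∧ i < 1) ∧ U k q γ δ 1 i = x} :=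
    adjoin_gens (k := k) (q := q) (γ := γ) (δ := δ) 1 ▸ Algebra.mem_top
  induction ha using Algebra.adjoin_induction with
  | mem x hx =>
    rcases hx with rfl | ⟨i, hi, -⟩
    · exact ⟨0, 1, by rw [zero_smul, one_smul, zero_add]⟩
    · omega
  | algebraMap r => exact ⟨r, 0, by rw [zero_smul, add_zero, Algebra.algebraMap_eq_smul_one]⟩
  | add x y _ _ hx hy =>
    obtain ⟨a, b, rfl⟩ := hx
    obtain ⟨a', b', rfl⟩ := hy
    exact ⟨a + a', b + b', by rw [add_smul, add_smul, add_add_add_comm]⟩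
  | mul x y _ _ hx hy =>
    obtain ⟨a, b, rfl⟩ := hx
    obtain ⟨a', b', rfl⟩ := hy
    exact ⟨_, _, smul_one_add_mul (e_e 1) a b a' b'⟩

variable (k q γ δ) in
theorem exists_character {c : k} (hc : c * c = δ * c) :
    ∃ Φ : Alg k q γ δ 1 →ₐ[k] k, Φ (e k q γ δ 1) = c := by
  obtain ⟨Φ, h, -⟩ := exists_lift (q := q) (γ := γ) (δ := δ) 1 c (fun _ => (0 : k))
    (fun _ _ => by omega) (fun _ _ _ _ => by omega) (fun _ _ _ _ => by omega)
    (fun _ => by omega) (fun _ => hc) (fun _ _ => by omega)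
  exact ⟨Φ, h one_pos⟩

variable (q γ) in
-- A combination of the two characters of `b_1`, with `e ↦ 0` and `e ↦ δ`. The condition on `e`
-- fixes the coefficient of the second as `γ / δ`, and the condition on `1` then fixes the first.
theorem exists_cap (hδ : δ ≠ 0) : ∃ cap : Alg k q γ δ 1 →ₗ[k] k,
    cap 1 = q + q⁻¹ ∧ cap (e k q γ δ 1) = γ := by
  obtain ⟨Φ, hΦ⟩ := exists_character k q γ δ (c := 0) (by ring)
  obtain ⟨Ψ, hΨ⟩ := exists_character k q γ δ (c := δ) rfl
  refine ⟨(q + q⁻¹ - γ / δ) • Φ.toLinearMap + (γ / δ) • Ψ.toLinearMap, ?_, ?_⟩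
  · simp
  · simp [hΦ, hΨ, hδ]

variable (q γ) in
/-- The tower of the blob algebras. -/
noncomputable def tower (h2 : q + q⁻¹ ≠ 0) (hδ : δ ≠ 0) :
    Tower k (Alg k q γ δ) (q + q⁻¹) where
  inc := inc k q γ δ
  u n := U k q γ δ (n + 1) n
  cap := (exists_cap q γ hδ).choose
  d_ne := h2
  scalar := exists_algebraMap
  cap_one := (exists_cap q γ hδ).choose_spec.1
  u_zero := dif_neg (by omega)
  u_sq n := U_sq _ _
  u_comm n b := by
    refine commute_of_adjoin (adjoin_gens n) ((inc k q γ δ (n + 1)).comp (inc k q γ δ n)) ?_ b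
    rintro _ (rfl | ⟨i, hi, rfl⟩)
    · rcases Nat.eq_zero_or_pos n with rfl | hn
      · rw [e_zero, map_zero, mul_zero, zero_mul]
      · rw [AlgHom.comp_apply, inc_e hn, inc_e (by omega)]
        exact U_e _ (by omega)
    · rw [AlgHom.comp_apply, inc_U hi.2, inc_U (by omega)]
      exact U_comm _ (by omega)
  u_cap x := by
    obtain ⟨c, c', rfl⟩ := exists_smul_one_add x
    rw [map_add, map_smul, map_smul, map_add, map_smul, map_smul, map_one, inc_e one_pos,
      (exists_cap q γ hδ).choose_spec.1, (exists_cap q γ hδ).choose_spec.2]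
    exact mul_smul_one_add_mul (U_sq 2 1) (U_e_U 2) c c'
  braid_up n := by
    rw [inc_U (by omega)]
    exact U_braid _ (by omega) (by omega)
  braid_down n := by
    rcases n with _ | n
    · rw [U, dif_neg (by omega), map_zero, zero_mul, zero_mul]
    · rw [inc_U (by omega)]
      exact U_braid _ (by omega) (by omega)
  adjoin n := by
    refine eq_top_iff.2 ((adjoin_gens (n + 2)).ge.trans (Algebra.adjoin_mono ?_))
    rintro _ (rfl | ⟨i, hi, rfl⟩)
    · exact Or.inl ⟨e k q γ δ (n + 1), inc_e (by omega)⟩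
    · rcases (show i < n + 1 ∨ i = n + 1 by omega) with h | rfl
      · exact Or.inl ⟨U k q γ δ (n + 1) i, inc_U h⟩
      · exact Or.inr rfl
  lift_one S _ _ φ s hs := by
    have h1 : s * s = (q + q⁻¹) • s := by
      have := hs 1
      rwa [map_one, mul_one, (exists_cap q γ hδ).choose_spec.1] at this
    have he := hs (e k q γ δ 1)
    rw [(exists_cap q γ hδ).choose_spec.2] at he
    obtain ⟨Φ, hΦe, hΦ⟩ := exists_lift (q := q) (γ := γ) (δ := δ) 2 (φ (e k q γ δ 1)) (fun _ => s)
      (fun _ _ => h1) (fun _ _ _ _ => by omega) (fun _ _ _ _ _ => rfl) (fun _ => he)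
      (fun _ => by rw [← map_mul, e_e, map_smul]) (fun _ _ => by omega)
    refine ⟨Φ, fun x => ?_, hΦ 1 (by omega)⟩
    refine DFunLike.congr_fun (hom_ext (f := Φ.comp (inc k q γ δ 1)) (g := φ) (fun _ => ?_)
      (fun i hi => by omega)) x
    rw [AlgHom.comp_apply, inc_e one_pos, hΦe (by omega)]
  lift_succ n S _ _ φ s hsq hcomm hb1 hb2 := by
    have hφ : ∀ i, i < n + 1 →
        s * φ (U k q γ δ (n + 2) i) = φ (U k q γ δ (n + 2) i) * s := fun i hi => by
      rw [← inc_U hi]; exact hcomm _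
    suffices ∃ Φ : Alg k q γ δ (n + 3) →ₐ[k] S,
        (0 < n + 3 → Φ (e k q γ δ (n + 3)) = φ (e k q γ δ (n + 2))) ∧
        ∀ i, 1 ≤ i ∧ i < n + 3 → Φ (U k q γ δ (n + 3) i) =
          if i = n + 2 then s else φ (U k q γ δ (n + 2) i) by
      obtain ⟨Φ, hΦe, hΦ⟩ := this
      refine ⟨Φ, fun x => ?_, ?_⟩
      · refine DFunLike.congr_fun (hom_ext (f := Φ.comp (inc k q γ δ (n + 2))) (g := φ)
          (fun _ => ?_) (fun i hi => ?_)) x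
        · rw [AlgHom.comp_apply, inc_e (by omega), hΦe (by omega)]
        · rw [AlgHom.comp_apply, inc_U hi.2, hΦ _ (by omega), if_neg (by omega)]
      · rw [hΦ _ (by omega), if_pos rfl]
    refine exists_lift (q := q) (n + 3) _
      (fun i => if i = n + 2 then s else φ (U k q γ δ (n + 2) i)) ?_ ?_ ?_ ?_ ?_ ?_
    · intro i hi
      split_ifs
      · exact hsq
      · rw [← map_mul, U_sq, map_smul]
    · intro i j hi hj h
      split_ifs with h1 h2 h2
      · omega
      · obtain rfl : j = n + 1 := by omega
        exact hb1
      · obtain rfl : i = n + 1 := by omega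
        exact hb2
      · rw [← map_mul, ← map_mul, U_braid _ (by omega) h]
    · intro i j hi hj h
      split_ifs with h1 h2 h2
      · rfl
      · exact hφ _ (by omega)
      · exact (hφ _ (by omega)).symm
      · rw [← map_mul, ← map_mul, U_comm _ h]
    · intro _
      rw [if_neg (by omega), ← map_mul, ← map_mul, U_e_U, map_smul]
    · intro _
      rw [← map_mul, e_e, map_smul]
    · intro i hi h
      split_ifs
      · rw [← inc_e (by omega)]
        exact hcomm _
      · rw [← map_mul, ← map_mul, U_e _ h]

theorem inc2_U (h2 : q + q⁻¹ ≠ 0) (hδ : δ ≠ 0) {n i : ℕ} (hi : i < n) :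
    (tower q γ h2 hδ).inc2 n (U k q γ δ n i) = U k q γ δ (n + 2) i := by
  rw [Tower.inc2_apply]
  exact (congrArg _ (inc_U hi)).trans (inc_U (by omega))

theorem inc2_e (h2 : q + q⁻¹ ≠ 0) (hδ : δ ≠ 0) {n : ℕ} (hn : 0 < n) :
    (tower q γ h2 hδ).inc2 n (e k q γ δ n) = e k q γ δ (n + 2) := by
  rw [Tower.inc2_apply]
  exact (congrArg _ (inc_e hn)).trans (inc_e (by omega))

theorem incl_eq_inc2 (h2 : q + q⁻¹ ≠ 0) (hδ : δ ≠ 0) (n : ℕ) :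
    incl k q γ δ n = (tower q γ h2 hδ).inc2 n := by
  refine hom_ext (fun hn => ?_) fun i hi => ?_
  · rw [inc2_e h2 hδ hn, incl]
    conv_lhs => rw [e, dif_pos hn]
    rw [RingQuot.liftAlgHom_mkAlgHom_apply, FreeAlgebra.lift_ι_apply, inclGen]
  · rw [inc2_U h2 hδ hi.2, incl]
    conv_lhs => rw [U, dif_pos hi]
    rw [RingQuot.liftAlgHom_mkAlgHom_apply, FreeAlgebra.lift_ι_apply, inclGen]

theorem loc_succ (h2 : q + q⁻¹ ≠ 0) (hδ : δ ≠ 0) (n j : ℕ) :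
    loc k q γ δ (n + 2) (j + 1) =
      (tower q γ h2 hδ).u (n + 1) * (tower q γ h2 hδ).inc2 n (loc k q γ δ n j) := by
  induction j with
  | zero =>
    rw [loc, loc, loc, map_one, one_mul, mul_one]
    rfl
  | succ j ih =>
    have hU : U k q γ δ (n + 2) (n - 1 - 2 * j) =
        (tower q γ h2 hδ).inc2 n (U k q γ δ n (n - 1 - 2 * j)) := by
      rcases Nat.eq_zero_or_pos n with rfl | hn
      · rw [U, dif_neg (by omega), U, dif_neg (by omega), map_zero]
      · rw [inc2_U h2 hδ (by omega)]
    rw [loc, ih, loc.eq_2 k q γ δ n j, map_mul, ← hU, ← mul_assoc,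
      show n + 2 - 1 - 2 * (j + 1) = n - 1 - 2 * j by omega]

theorem U_mem_span {n : ℕ} (z : Alg k q γ δ (n + 1)) (j : ℕ) : ∀ i, 1 ≤ i → i + j = n →
    U k q γ δ (n + 1) i ∈
      Submodule.span k {t | ∃ b c, t = b * U k q γ δ (n + 1) n * c ∨ t = b * z * c} := by
  induction j with
  | zero =>
    rintro i - rfl
    exact Submodule.subset_span ⟨1, 1, Or.inl (by simp)⟩
  | succ j ih =>
    intro i hi hn
    rw [← U_braid (n + 1) (i := i) (j := i + 1) (by omega) (by omega)]
    exact (mul_mem_twoSided k _ _ _ _ (mul_mem_twoSided k _ _ _ _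
      (ih (i + 1) (by omega) (by omega))).1).2

theorem mem_weights {n : ℕ} {l : ℤ} :
    l ∈ weights n ↔ l.natAbs ≤ n ∧ l.natAbs % 2 = n % 2 := by
  simp only [weights, Finset.mem_filter, Finset.mem_Icc]
  omega

variable (k q γ δ) in
/-- The element that singles out the trivial module with label `l` of `b_n` for `n = |l|`. -/
noncomputable def zTop (n : ℕ) (l : ℤ) : Alg k q γ δ n :=
  if 0 < l then e k q γ δ n - algebraMap k _ δ else if l < 0 then e k q γ δ n else 0

theorem e_mul_zTop (n : ℕ) (l : ℤ) :
    e k q γ δ n * zTop k q γ δ n l = zTop k q γ δ n l * e k q γ δ n := by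
  unfold zTop
  split_ifs
  · rw [mul_sub, sub_mul, Algebra.commutes]
  · rfl
  · rw [mul_zero, zero_mul]

theorem inc2_zTop (h2 : q + q⁻¹ ≠ 0) (hδ : δ ≠ 0) {n : ℕ} {l : ℤ} (hl : l ∈ weights n) :
    (tower q γ h2 hδ).inc2 n (zTop k q γ δ n l) = zTop k q γ δ (n + 2) l := by
  rw [mem_weights] at hl
  unfold zTop
  split_ifs
  · rw [map_sub, AlgHom.commutes, inc2_e h2 hδ (by omega)]
  · rw [inc2_e h2 hδ (by omega)]
  · rw [map_zero]

theorem loc_top_succ {n : ℕ} {l : ℤ} (hl : l.natAbs = n + 1) :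
    loc k q γ δ (n + 1) ((n + 1 - l.natAbs) / 2 + 1) = U k q γ δ (n + 1) n := by
  rw [hl, show (n + 1 - (n + 1)) / 2 + 1 = 0 + 1 by omega, loc, loc, one_mul]
  rfl

theorem loc_top {n : ℕ} {l : ℤ} (hl : l.natAbs = n) :
    loc k q γ δ n ((n - l.natAbs) / 2) = 1 := by
  rw [hl, Nat.sub_self, Nat.zero_div, loc]

theorem U_mem_twoSided {n : ℕ} {l : ℤ} (hl : l.natAbs = n) (z : Alg k q γ δ n) {i : ℕ}
    (hi : 1 ≤ i ∧ i < n) : U k q γ δ n i ∈ Submodule.span k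
      {t | ∃ b c, t = b * loc k q γ δ n ((n - l.natAbs) / 2 + 1) * c ∨ t = b * z * c} := by
  rcases n with _ | n
  · omega
  · rw [loc_top_succ hl]
    exact U_mem_span z (n - i) i hi.1 (by omega)

/-- It suffices to check generators: `e` commutes with `zTop`, and every `U_i` lies in the ideal of
the last one. -/
theorem zTop_comm {n : ℕ} {l : ℤ} (hl : l.natAbs = n) (a : Alg k q γ δ n) :
    a * zTop k q γ δ n l - zTop k q γ δ n l * a ∈ Submodule.span k
      {t | ∃ b c, t = b * loc k q γ δ n ((n - l.natAbs) / 2 + 1) * c} := by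
  -- Using `y` for both generators turns the two-generator ideal of `mul_mem_twoSided` into the
  -- ideal of `y` alone.
  let y := loc k q γ δ n ((n - l.natAbs) / 2 + 1)
  have h : a * zTop k q γ δ n l - zTop k q γ δ n l * a ∈ Submodule.span k
      {t | ∃ b c, t = b * y * c ∨ t = b * y * c} := by
    refine commutator_mem (adjoin_gens n) (fun a x hx => (mul_mem_twoSided k _ _ _ _ hx).1)
      (fun a x hx => (mul_mem_twoSided k _ _ _ _ hx).2) ?_ a
    rintro _ (rfl | ⟨i, hi, rfl⟩)
    · rw [e_mul_zTop, sub_self]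
      exact zero_mem _
    · have hU := U_mem_twoSided hl y hi
      exact sub_mem (mul_mem_twoSided k _ _ _ _ hU).2 (mul_mem_twoSided k _ _ _ _ hU).1
  simpa only [or_self] using h

theorem zTop_sq (hδ : δ ≠ 0) (n : ℕ) (l : ℤ) : ∃ c : k, c ≠ 0 ∧
    zTop k q γ δ n l * zTop k q γ δ n l = c • zTop k q γ δ n l := by
  unfold zTop
  split_ifs
  · exact ⟨-δ, neg_ne_zero.2 hδ, sub_algebraMap_sq (e_e n)⟩
  · exact ⟨δ, hδ, e_e n⟩
  · exact ⟨1, one_ne_zero, by simp⟩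

theorem act_eq_zero_of_mem_span {R : Type w} [Ring R] [Algebra k R] {V : Type w'} [AddCommGroup V]
    [Module k V] (ρ : AlgRep k R V) {y x : R} (hy : ∀ v, ρ y v = 0)
    (hx : x ∈ Submodule.span k {t | ∃ b c, t = b * y * c}) (v : V) : ρ x v = 0 := by
  have : Submodule.span k {t | ∃ b c, t = b * y * c} ≤ LinearMap.ker (ρ.orbit v) := by
    refine Submodule.span_le.2 ?_
    rintro _ ⟨b, c, rfl⟩
    rw [SetLike.mem_coe, LinearMap.mem_ker, AlgRep.orbit_apply, AlgRep.mul_act, AlgRep.mul_act, hy,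
      map_zero]
  exact this hx

/-- If `e` does not act as zero, some `e w` generates `L`. Since `(e - δ) e = 0` and `e - δ`
commutes with the whole algebra once the `U_i` act as zero, `e - δ` kills `L`. -/
theorem exists_zTop_act_eq_zero (n : ℕ) {L : Type w} [AddCommGroup L] [Module k L]
    {ρ : AlgRep k (Alg k q γ δ (n + 1)) L} (h : ρ.IsSimple)
    (hU : ∀ v, ρ (U k q γ δ (n + 1) n) v = 0) :
    ∃ l : ℤ, l.natAbs = n + 1 ∧ ∀ v, ρ (zTop k q γ δ (n + 1) l) v = 0 := by
  by_cases he : ∀ v, ρ (e k q γ δ (n + 1)) v = 0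
  · refine ⟨-(n + 1 : ℕ), by omega, fun v => ?_⟩
    rw [zTop, if_neg (by omega), if_pos (by omega), he]
  · push Not at he
    obtain ⟨w, hw⟩ := he
    refine ⟨(n + 1 : ℕ), by omega, fun v => ?_⟩
    have hl : ((n + 1 : ℕ) : ℤ).natAbs = n + 1 := by omega
    obtain ⟨a, rfl⟩ := h.2 _ hw v
    have h1 := act_eq_zero_of_mem_span ρ (y := U k q γ δ (n + 1) n) hU
      (loc_top_succ (k := k) (q := q) (γ := γ) (δ := δ) hl ▸ zTop_comm hl a)
      (ρ (e k q γ δ (n + 1)) w)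
    rw [AlgRep.sub_act, AlgRep.mul_act, AlgRep.mul_act, ← AlgRep.mul_act ρ _ (e k q γ δ (n + 1))]
      at h1
    have h3 : zTop k q γ δ (n + 1) ((n + 1 : ℕ) : ℤ) * e k q γ δ (n + 1) = 0 := by
      rw [zTop, if_pos (by omega), sub_mul, e_e, ← Algebra.smul_def, sub_self]
    rw [h3, AlgRep.zero_act, map_zero, zero_sub, neg_eq_zero] at h1
    exact h1

/-- The labels of the simple modules of the blob algebras. -/
noncomputable def labels (h2 : q + q⁻¹ ≠ 0) (hδ : δ ≠ 0) : Labels (tower q γ h2 hδ) ℤ where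
  IsWeight n l := l ∈ weights n
  Top n l := l.natAbs = n
  le m l := m = l ∨ |l| < |m|
  s n l := loc k q γ δ n ((n - l.natAbs) / 2)
  y n l := loc k q γ δ n ((n - l.natAbs) / 2 + 1)
  -- The factor `loc` makes `z` test the action of `e` only on the iterated localisation, as in the
  -- definition of the simple modules.
  z n l := zTop k q γ δ n l * loc k q γ δ n ((n - l.natAbs) / 2)
  isWeight_zero l := by rw [mem_weights]; omega
  isWeight_one l := by rw [mem_weights]; omega
  isWeight_succ n l := by rw [mem_weights, mem_weights]; omega
  not_top n l := by rw [mem_weights]; omega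
  s_top n l h := loc_top h
  s_succ n l h := by
    rw [mem_weights] at h
    rw [show (n + 2 - l.natAbs) / 2 = (n - l.natAbs) / 2 + 1 by omega, loc_succ h2 hδ]
  y_zero l h := by
    rw [h, loc, U, dif_neg (by omega), mul_zero]
  y_top n l h := loc_top_succ h
  y_succ n l h := by
    rw [mem_weights] at h
    rw [show (n + 2 - l.natAbs) / 2 = (n - l.natAbs) / 2 + 1 by omega, loc_succ h2 hδ]
  z_succ n l h := by
    rw [map_mul, inc2_zTop h2 hδ h, ← inc2_zTop h2 hδ h, ← mul_assoc, Tower.u_inc2, mul_assoc]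
    rw [mem_weights] at h
    rw [show (n + 2 - l.natAbs) / 2 = (n - l.natAbs) / 2 + 1 by omega, loc_succ h2 hδ]
  z_sq n l h := by
    rw [loc_top h, mul_one]
    exact zTop_sq hδ n l
  z_comm n l h a := by
    rw [loc_top h, mul_one]
    exact zTop_comm h a
  scalar n l h a := by
    refine exists_sub_algebraMap_mem (adjoin_gens n)
      (fun a x hx => (mul_mem_twoSided k _ _ _ _ hx).1)
      (fun a x hx => (mul_mem_twoSided k _ _ _ _ hx).2) ?_ a
    rintro _ (rfl | ⟨i, hi, rfl⟩)
    · rw [loc_top h, mul_one]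
      rcases lt_trichotomy l 0 with hl | rfl | hl
      · refine ⟨0, Submodule.subset_span ⟨1, 1, Or.inr ?_⟩⟩
        rw [one_mul, mul_one, zTop, if_neg hl.not_gt, if_pos hl, map_zero, sub_zero]
      · obtain rfl : n = 0 := h.symm
        exact ⟨0, by rw [map_zero, sub_zero, e_zero]; exact zero_mem _⟩
      · refine ⟨δ, Submodule.subset_span ⟨1, 1, Or.inr ?_⟩⟩
        rw [one_mul, mul_one, zTop, if_pos hl]
    · exact ⟨0, by rw [map_zero, sub_zero]; exact U_mem_twoSided h _ hi⟩
  exists_top_zero L _ _ ρ _ := ⟨0, rfl, fun v => by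
    rw [zTop, if_neg (by omega), if_neg (by omega), zero_mul, AlgRep.zero_act]⟩
  exists_top n L _ _ ρ h hu := by
    obtain ⟨l, hl, hz⟩ := exists_zTop_act_eq_zero n h hu
    exact ⟨l, hl, fun v => by rw [loc_top hl, mul_one, hz]⟩
  top_unique n l m hl hm h := by
    rw [loc_top hl, loc_top hm, mul_one, mul_one]
    have key := inv_mul_add_mul_sub hδ (e k q γ δ n)
    rcases lt_trichotomy l 0 with h1 | rfl | h1
    -- Two distinct top labels of one level have opposite signs, and `δ⁻¹ e - δ⁻¹ (e - δ) = 1`.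
    · refine ⟨algebraMap k _ δ⁻¹, algebraMap k _ (-δ⁻¹), ?_⟩
      rw [zTop, if_neg h1.not_gt, if_pos h1, zTop, if_pos (by omega)]
      exact key
    · omega
    · refine ⟨algebraMap k _ (-δ⁻¹), algebraMap k _ δ⁻¹, ?_⟩
      rw [zTop, if_pos h1, zTop, if_neg (by omega), if_pos (by omega), add_comm]
      exact key
  le_refl l := Or.inl rfl
  top_le n l m hl hm := by
    rw [mem_weights] at hl
    rw [Int.abs_eq_natAbs, Int.abs_eq_natAbs]
    omega
  eq_of_le_top n l m hl hm h := by
    rw [mem_weights] at hm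
    rw [Int.abs_eq_natAbs, Int.abs_eq_natAbs] at h
    omega

open AlgRep

theorem isSimpleOfWeight_iff (h2 : q + q⁻¹ ≠ 0) (hδ : δ ≠ 0) {n : ℕ} (μ : ℤ) (L : Type v)
    [AddCommGroup L] [Module k L] [Module (Alg k q γ δ n) L] [IsScalarTower k (Alg k q γ δ n) L] :
    IsSimpleOfWeight k q γ δ n μ L ↔
      (labels h2 hδ).IsL n μ (ofModule k (Alg k q γ δ n) L) := by
  unfold IsSimpleOfWeight
  rw [isSimple_ofModule_iff k]
  refine and_congr_right fun _ => and_congr_right fun _ => and_congr_right fun _ => ?_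
  change _ ↔ ∀ v : L, loc k q γ δ n ((n - μ.natAbs) / 2 + 1) • v = 0 ∧
    (zTop k q γ δ n μ * loc k q γ δ n ((n - μ.natAbs) / 2)) • v = 0
  rw [forall_and]
  refine and_congr_right fun _ => ?_
  rcases lt_trichotomy μ 0 with h | rfl | h
  · rw [zTop, if_neg h.not_gt, if_pos h]
    exact ⟨fun hv => hv.2 h, fun hv => ⟨fun h' => absurd h' h.not_gt, fun _ => hv⟩⟩
  · rw [zTop, if_neg (lt_irrefl _), if_neg (lt_irrefl _), zero_mul]
    exact ⟨fun _ v => zero_smul _ v,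
      fun _ => ⟨fun h => absurd h (lt_irrefl _), fun h => absurd h (lt_irrefl _)⟩⟩
  · rw [zTop, if_pos h]
    simp only [sub_mul, sub_smul, sub_eq_zero]
    exact ⟨fun hv => hv.1 h, fun hv => ⟨fun _ => hv, fun h' => absurd h' h.not_gt⟩⟩

theorem isStandard_iff (h2 : q + q⁻¹ ≠ 0) (hδ : δ ≠ 0) {n : ℕ} (μ : ℤ) (D : Type v)
    [AddCommGroup D] [Module k D] [Module (Alg k q γ δ n) D] [IsScalarTower k (Alg k q γ δ n) D] :
    IsStandard k q γ δ n μ D ↔ (labels h2 hδ).IsStd n μ (ofModule k (Alg k q γ δ n) D) :=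
  Labels.isStandardModule_iff (S := labels h2 hδ) (fun μ L => isSimpleOfWeight_iff h2 hδ μ L) D

theorem glob_filtration (h2 : q + q⁻¹ ≠ 0) (hδ : δ ≠ 0) (n : ℕ) (M : Type v) [AddCommGroup M]
    [Module k M] [Module (Alg k q γ δ n) M] [IsScalarTower k (Alg k q γ δ n) M]
    (hM : Nonempty (Filtration k q γ δ n M)) :
    Nonempty (Filtration k q γ δ (n + 2) (G k q γ δ n M)) ∧
      ∀ (F : Filtration k q γ δ n M) (F' : Filtration k q γ δ (n + 2) (G k q γ δ n M)),
        ∀ μ ∈ weights (n + 2), F'.mult μ = if μ ∈ weights n then F.mult μ else 0 :=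
  Labels.filtration_globalise (labels h2 hδ) (incl_eq_inc2 h2 hδ n) rfl (incl_commute_eps n)
    (fun μ D => isStandard_iff h2 hδ μ D) (fun μ D => isStandard_iff h2 hδ μ D)
    (hd := fun μ => Finset.decidableMem μ (weights n)) M hM

end Blob

theorem mainTheorem6 (k : Type u) [Field k] (q : k) (hq : q ≠ 0) (h2 : q + q⁻¹ ≠ 0) (n : ℕ) :
    (∀ (M : Type v) [AddCommGroup M] [Module k M] [Module (TL.Alg k q n) M]
        [IsScalarTower k (TL.Alg k q n) M],
      Nonempty (TL.Filtration k q n M) →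
        Nonempty (TL.Filtration k q (n + 2) (TL.G k q n M)) ∧
        ∀ (F : TL.Filtration k q n M) (F' : TL.Filtration k q (n + 2) (TL.G k q n M)),
          ∀ μ ∈ TL.weights (n + 2), F'.mult μ = if μ ∈ TL.weights n then F.mult μ else 0) ∧
    (∀ (γ δ : k), δ ≠ 0 →
      ∀ (M : Type v) [AddCommGroup M] [Module k M] [Module (Blob.Alg k q γ δ n) M]
        [IsScalarTower k (Blob.Alg k q γ δ n) M],
      Nonempty (Blob.Filtration k q γ δ n M) →
        Nonempty (Blob.Filtration k q γ δ (n + 2) (Blob.G k q γ δ n M)) ∧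
        ∀ (F : Blob.Filtration k q γ δ n M)
          (F' : Blob.Filtration k q γ δ (n + 2) (Blob.G k q γ δ n M)),
          ∀ μ ∈ Blob.weights (n + 2),
            F'.mult μ = if μ ∈ Blob.weights n then F.mult μ else 0) :=
  ⟨fun M _ _ _ _ hM => TL.glob_filtration h2 n M hM,
    fun _ _ hδ M _ _ _ _ hM => Blob.glob_filtration h2 hδ n M hM⟩
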